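/- Let $K$ be a commutative field of any characteristic. Let $\mathcal P_\nearrow$ be the non-symmetric operad over $K$ generated by two operations $m,\nearrow$ of arity $2$ with the relations $m\circ(\nearrow,I)=\nearrow\circ(I,m)$, $m\circ(m,I)=m\circ(I,m)$ and $\nearrow\circ(\nearrow,I)=\nearrow\circ(I,\nearrow)$. A $\mathcal P_\nearrow$-bialgebra of type $1$ is a $\mathcal P_\nearrow$-algebra $A$ with a coassociative (non counitary) coproduct $\tilde\Delta:A\to A\otimes A$, written $\tilde\Delta(x)=x'\otimes x''$, such that for both products $*\in\{m,\nearrow\}$ and all $x,y\in A$, $$\tilde\Delta(x*y)=(x*y')\otimes y''+x'\otimes(x''*y)+x\otimes y .$$ Put $\mathrm{Prim}(A)=\ker\tilde\Delta$, and let $\mathbb{PRIM}^{(1)}_\nearrow(n)$ be the space of all $p\in\mathcal P_\nearrow(n)$ such that $p.(a_1,\dots,a_n)\in \mathrm{Prim}(A)$ for every $\mathcal P_\nearrow$-bialgebra $A$ of type $1$ and all $a_1,\dots,a_n\in \mathrm{Prim}(A)$; this is a suboperad of $\mathcal P_\nearrow$. (1) The non-symmetric operad $\mathbb{PRIM}^{(1)}_\nearrow$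 is freely generated by the element $\nearrow-\,m\in\mathcal P_\nearrow(2)$. (When $\mathcal P_\nearrow(n)$ is identified with the space spanned by the planar forests with $n$ vertices, $\nearrow$ is the ladder with two vertices and $m$ is the forest $\bullet\bullet$.) (2) Let $\mathcal H$ be the vector space with basis the planar rooted forests, with concatenation as product and the coproduct $$\Delta(F)=\sum_c P^c(F)\otimes R^c(F),$$ where $c$ runs over the left-admissible cuts of $F$, including the empty cut ($1\otimes F$) and the total cut ($F\otimes 1$); here the set of the vertices over such a cut is any set of vertices of $F$ that contains, with a vertex, all the vertices above it and all the vertices to the left of it, and $P^c(F)$, $R^c(F)$ are the forests formed by the vertices over the cut and by the other vertices. Let $F\nearrow G$ be the forest obtained by grafting $F$ on the leftmost leaf of $G$ (with $F\nearrow 1=F$), extended bilinearly to $\mathcal H$. For planar binary trees $t$ define $p_t\in\mathcal H$ by $p_{|}=\bullet$ and $p_{t_1\vee t_2}=p_{t_1}p_{t_2}-p_{t_1}\nearrow p_{t_2}$. Then $(p_t)_t$, with $t$ running over all planar binary trees, is a basis of $\mathrm{Prim}(\mathcal H)=\{x\in\mathcal H: \Delta(x)=x\otimes1+1\otimes x\}$.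 (3) Let $\mathcal P_\nearrow^\Sigma$ be the symmetrisation of $\mathcal P_\nearrow$ and $\mathbb{FREE}_2$ the free symmetric operad generated by one element of $\mathbb{FREE}_2(2)$. Then $(\mathbb{A}ss,\mathcal P_\nearrow^\Sigma,\mathbb{FREE}_2)$ is a good triple of operads (for the bialgebras of type $1$). That is: - the suboperad of $\mathcal P_\nearrow^\Sigma$ of the operations that preserve the primitive elements of every bialgebra of type $1$ is isomorphic to $\mathbb{FREE}_2$; - for every vector space $V$, the free $\mathcal P_\nearrow^\Sigma$-algebra generated by $V$ has a unique structure of bialgebra of type $1$ in which the elements of $V$ are primitive; - for every bialgebra $A$ of type $1$ the following are equivalent: (a) $A$ is connected, i.e. $A=\bigcup_r F_r$ where $F_0=0$ and $F_{r+1}=\{x:\tilde\Delta(x)\in F_r\otimes F_r\}$; (b) $A$ is isomorphic, as a bialgebra, to $U(\mathrm{Prim}(A))$, where $U$ is the left adjoint of the restriction functor from $\mathcal P_\nearrow^\Sigma$-algebras to algebras over the primitive suboperad, and the elements of $\mathrm{Prim}(A)$ are primitive in $U(\mathrm{Prim}(A))$; (c) $A$ is, as a coalgebra, cofree over $\mathrm{Prim}(A)$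 among connected coassociative coalgebras. -/

import Mathlib

open scoped TensorProduct

universe u

set_option linter.unusedVariables false

namespace ForestOperads

noncomputable section

/-! ## Non-symmetric operads -/

/-- Concatenation of blocks: the `j`-th element of the `i`-th block, for blocks of lengths
`k 0, k 1, …` put one after the other. -/
def block {n : ℕ} (k : Fin n → ℕ) {N : ℕ} (h : ∑ i, k i = N) : (Σ i, Fin (k i)) ≃ Fin N :=
  finSigmaFinEquiv.trans (finCongr h)

/-- A non-symmetric operad in `K`-vector spaces. The composition is
`p ∘ (p_1, …, p_n) ∈ P(k_1 + … + k_n)`; the arity of the result is a free variable `N` with a proof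
of `k_1 + … + k_n = N`. -/
structure NSOperad (K : Type u) [Field K] where
  obj : ℕ → Type u
  [grp : ∀ n, AddCommGroup (obj n)]
  [mod : ∀ n, Module K (obj n)]
  one : obj 1
  comp : ∀ {n : ℕ} (k : Fin n → ℕ) {N : ℕ} (_ : ∑ i, k i = N),
    obj n → (∀ i, obj (k i)) → obj N
  comp_add : ∀ {n : ℕ} (k : Fin n → ℕ) {N : ℕ} (h : ∑ i, k i = N) (p q : obj n)
    (r : ∀ i, obj (k i)), comp k h (p + q) r = comp k h p r + comp k h q r
  comp_smul : ∀ {n : ℕ} (k : Fin n → ℕ) {N : ℕ} (h : ∑ i, k i = N) (c : K) (p : obj n)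
    (r : ∀ i, obj (k i)), comp k h (c • p) r = c • comp k h p r
  comp_update_add : ∀ {n : ℕ} (k : Fin n → ℕ) {N : ℕ} (h : ∑ i, k i = N) (p : obj n)
    (r : ∀ i, obj (k i)) (i : Fin n) (x y : obj (k i)),
    comp k h p (Function.update r i (x + y)) =
      comp k h p (Function.update r i x) + comp k h p (Function.update r i y)
  comp_update_smul : ∀ {n : ℕ} (k : Fin n → ℕ) {N : ℕ} (h : ∑ i, k i = N) (p : obj n)
    (r : ∀ i, obj (k i)) (i : Fin n) (c : K) (x : obj (k i)),
    comp k h p (Function.update r i (c • x)) = c • comp k h p (Function.update r i x)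
  comp_one : ∀ {n : ℕ} (h : ∑ _i : Fin n, 1 = n) (p : obj n),
    comp (fun _ => 1) h p (fun _ => one) = p
  one_comp : ∀ {n : ℕ} (h : ∑ _i : Fin 1, n = n) (p : obj n),
    comp (fun _ => n) h one (fun _ => p) = p
  assoc : ∀ {n : ℕ} (k : Fin n → ℕ) {N : ℕ} (h : ∑ i, k i = N)
    (l : Fin N → ℕ) {T : ℕ} (hl : ∑ s, l s = T)
    (M : Fin n → ℕ) (hM : ∀ i, ∑ j, l (block k h ⟨i, j⟩) = M i) (hT : ∑ i, M i = T)
    (p : obj n) (q : ∀ i, obj (k i)) (r : ∀ s, obj (l s)),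
    comp l hl (comp k h p q) r =
      comp M hT p (fun i => comp (fun j => l (block k h ⟨i, j⟩)) (hM i) (q i)
        (fun j => r (block k h ⟨i, j⟩)))

attribute [instance] NSOperad.grp NSOperad.mod

/-- The pair of arities `(a, b)`. -/
def arities (a b : ℕ) (i : Fin 2) : ℕ := Fin.cases a (fun _ => b) i

theorem sum_arities {a b N : ℕ} (h : a + b = N) : ∑ i, arities a b i = N := by
  rw [Fin.sum_univ_two]; exact h

namespace NSOperad

variable {K : Type u} [Field K]

/-- `p ∘ (x, y)` for `p ∈ P(2)`. -/
def comp₂ (P : NSOperad K) {a b N : ℕ} (h : a + b = N) (p : P.obj 2) (x : P.obj a) (y : P.obj b) :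
    P.obj N :=
  P.comp (arities a b) (sum_arities h) p
    (fun i => Fin.cases (motive := fun i => P.obj (arities a b i)) x (fun _ => y) i)

/-- Morphisms of non-symmetric operads. -/
structure Hom (P Q : NSOperad K) where
  map : ∀ n, P.obj n →ₗ[K] Q.obj n
  map_one : map 1 P.one = Q.one
  map_comp : ∀ {n : ℕ} (k : Fin n → ℕ) {N : ℕ} (h : ∑ i, k i = N) (p : P.obj n)
    (r : ∀ i, P.obj (k i)), map N (P.comp k h p r) = Q.comp k h (map n p) (fun i => map (k i) (r i))

/-- `P` is freely generated, as a non-symmetric operad, by the element `x ∈ P(n)`. -/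
def IsFreelyGeneratedBy (P : NSOperad K) {n : ℕ} (x : P.obj n) : Prop :=
  ∀ (Q : NSOperad K) (y : Q.obj n), ∃! φ : Hom P Q, φ.map n x = y

/-- Suboperads. -/
structure Suboperad (P : NSOperad K) where
  carrier : ∀ n, Submodule K (P.obj n)
  one_mem : P.one ∈ carrier 1
  comp_mem : ∀ {n : ℕ} (k : Fin n → ℕ) {N : ℕ} (h : ∑ i, k i = N) (p : P.obj n)
    (r : ∀ i, P.obj (k i)), p ∈ carrier n → (∀ i, r i ∈ carrier (k i)) →
    P.comp k h p r ∈ carrier N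

theorem coe_update {P : NSOperad K} (S : ∀ n, Submodule K (P.obj n)) {n : ℕ} (k : Fin n → ℕ)
    (r : ∀ i, S (k i)) (i : Fin n) (x : S (k i)) :
    (fun j => ((Function.update r i x j : S (k j)) : P.obj (k j))) =
      Function.update (fun j => ((r j : S (k j)) : P.obj (k j))) i (x : P.obj (k i)) := by
  funext j
  exact Function.apply_update (fun j (y : S (k j)) => (y : P.obj (k j))) r i x j

/-- A suboperad is an operad. -/
def Suboperad.toOperad {P : NSOperad K} (S : Suboperad P) : NSOperad K where
  obj n := S.carrier n
  one := ⟨P.one, S.one_mem⟩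
  comp k _ h p r := ⟨P.comp k h p (fun i => r i), S.comp_mem k h p _ p.2 (fun i => (r i).2)⟩
  comp_add k _ h p q r := Subtype.ext (P.comp_add k h _ _ _)
  comp_smul k _ h c p r := Subtype.ext (P.comp_smul k h _ _ _)
  comp_update_add k _ h p r i x y := by
    apply Subtype.ext
    simp only [coe_update S.carrier k]
    exact P.comp_update_add k h p _ i x y
  comp_update_smul k _ h p r i c x := by
    apply Subtype.ext
    simp only [coe_update S.carrier k]
    exact P.comp_update_smul k h p _ i c x
  comp_one h p := Subtype.ext (P.comp_one h _)
  one_comp h p := Subtype.ext (P.one_comp h _)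
  assoc k _ h l _ hl M hM hT p q r := Subtype.ext (P.assoc k h l hl M hM hT _ _ _)

/-- Algebras over a non-symmetric operad. -/
structure Algebra (P : NSOperad K) (A : Type u) [AddCommGroup A] [Module K A] where
  act : ∀ {n : ℕ}, P.obj n → (Fin n → A) → A
  act_add : ∀ {n : ℕ} (p q : P.obj n) (a : Fin n → A), act (p + q) a = act p a + act q a
  act_smul : ∀ {n : ℕ} (c : K) (p : P.obj n) (a : Fin n → A), act (c • p) a = c • act p a
  act_update_add : ∀ {n : ℕ} (p : P.obj n) (a : Fin n → A) (i : Fin n) (x y : A),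
    act p (Function.update a i (x + y)) =
      act p (Function.update a i x) + act p (Function.update a i y)
  act_update_smul : ∀ {n : ℕ} (p : P.obj n) (a : Fin n → A) (i : Fin n) (c : K) (x : A),
    act p (Function.update a i (c • x)) = c • act p (Function.update a i x)
  act_one : ∀ a : Fin 1 → A, act P.one a = a 0
  act_comp : ∀ {n : ℕ} (k : Fin n → ℕ) {N : ℕ} (h : ∑ i, k i = N) (p : P.obj n)
    (r : ∀ i, P.obj (k i)) (a : Fin N → A),
    act (P.comp k h p r) a = act p (fun i => act (r i) (fun j => a (block k h ⟨i, j⟩)))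

namespace Algebra

variable {P Q : NSOperad K} {A B : Type u} [AddCommGroup A] [Module K A]
  [AddCommGroup B] [Module K B]

theorem update_pair_zero {A : Type u} (x y z : A) : Function.update ![x, y] 0 z = ![z, y] := by
  funext i; fin_cases i <;> rfl

theorem update_pair_one {A : Type u} (x y z : A) : Function.update ![x, y] 1 z = ![x, z] := by
  funext i; fin_cases i <;> rfl

/-- The bilinear product `(x, y) ↦ p.(x, y)` given by `p ∈ P(2)`. -/
def bin (α : P.Algebra A) (p : P.obj 2) : A →ₗ[K] A →ₗ[K] A :=
  LinearMap.mk₂ K (fun x y => α.act p ![x, y])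
    (fun x x' y => by
      simpa only [update_pair_zero] using α.act_update_add p ![x, y] 0 x x')
    (fun c x y => by
      simpa only [update_pair_zero] using α.act_update_smul p ![x, y] 0 c x)
    (fun x y y' => by
      simpa only [update_pair_one] using α.act_update_add p ![x, y] 1 y y')
    (fun c x y => by
      simpa only [update_pair_one] using α.act_update_smul p ![x, y] 1 c y)

/-- Morphisms of `P`-algebras. -/
def IsHom (α : P.Algebra A) (β : P.Algebra B) (f : A →ₗ[K] B) : Prop :=
  ∀ {n : ℕ} (p : P.obj n) (a : Fin n → A), f (α.act p a) = β.act p (fun i => f (a i))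

/-- Restriction of an algebra structure to a suboperad. -/
def restrict (α : P.Algebra A) (S : Suboperad P) : S.toOperad.Algebra A where
  act p a := α.act (Subtype.val p) a
  act_add p q a := α.act_add _ _ a
  act_smul c p a := α.act_smul c _ a
  act_update_add p a i x y := α.act_update_add _ a i x y
  act_update_smul p a i c x := α.act_update_smul _ a i c x
  act_one a := α.act_one a
  act_comp k _ h p r a := α.act_comp k h _ _ a

/-- A subspace stable under the operations of a suboperad is an algebra over it. -/
def restrictSub (α : P.Algebra A) (S : Suboperad P) (V : Submodule K A)
    (hV : ∀ {n : ℕ} (p : P.obj n), p ∈ S.carrier n → ∀ a : Fin n → A, (∀ i, a i ∈ V) →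
      α.act p a ∈ V) : S.toOperad.Algebra V where
  act p a := ⟨α.act (Subtype.val p) (fun i => a i), hV p.1 p.2 _ (fun i => (a i).2)⟩
  act_add p q a := Subtype.ext (α.act_add _ _ _)
  act_smul c p a := Subtype.ext (α.act_smul c _ _)
  act_update_add p a i x y := by
    apply Subtype.ext
    have key : ∀ z : V, (fun j => ((Function.update a i z j : V) : A)) =
        Function.update (fun j => ((a j : V) : A)) i (z : A) := fun z => by
      funext j
      exact Function.apply_update (fun _ (y : V) => (y : A)) a i z j
    simp only [key, Submodule.coe_add]
    exact α.act_update_add _ _ i x y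
  act_update_smul p a i c x := by
    apply Subtype.ext
    have key : ∀ z : V, (fun j => ((Function.update a i z j : V) : A)) =
        Function.update (fun j => ((a j : V) : A)) i (z : A) := fun z => by
      funext j
      exact Function.apply_update (fun _ (y : V) => (y : A)) a i z j
    simp only [key, Submodule.coe_smul]
    exact α.act_update_smul _ _ i c x
  act_one a := Subtype.ext (α.act_one _)
  act_comp k _ h p r a := Subtype.ext (α.act_comp k h _ _ _)

end Algebra

end NSOperad

/-! ## Non-symmetric operads given by generators and relations -/

/-- Formal operadic expressions in generators `G`. -/
inductive Pre (K : Type u) (G : ℕ → Type u) : ℕ → Type u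
  | gen {n : ℕ} : G n → Pre K G n
  | one : Pre K G 1
  | zero {n : ℕ} : Pre K G n
  | add {n : ℕ} : Pre K G n → Pre K G n → Pre K G n
  | smul {n : ℕ} : K → Pre K G n → Pre K G n
  | comp {n : ℕ} (k : Fin n → ℕ) {N : ℕ} (h : ∑ i, k i = N) :
      Pre K G n → (∀ i, Pre K G (k i)) → Pre K G N

/-- `p ∘ (x, y)` for formal expressions. -/
def Pre.comp₂ {K : Type u} {G : ℕ → Type u} {a b N : ℕ} (h : a + b = N) (p : Pre K G 2)
    (x : Pre K G a) (y : Pre K G b) : Pre K G N :=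
  Pre.comp (arities a b) (sum_arities h) p
    (fun i => Fin.cases (motive := fun i => Pre K G (arities a b i)) x (fun _ => y) i)

/-- The smallest congruence on formal expressions that contains `R` and all the identities which
hold in non-symmetric operads. -/
inductive PreRel {K : Type u} [Field K] {G : ℕ → Type u}
    (R : ∀ n, Pre K G n → Pre K G n → Prop) : ∀ n, Pre K G n → Pre K G n → Prop
  | of {n : ℕ} {x y : Pre K G n} : R n x y → PreRel R n x y
  | refl {n : ℕ} (x : Pre K G n) : PreRel R n x x
  | symm {n : ℕ} {x y : Pre K G n} : PreRel R n x y → PreRel R n y x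
  | trans {n : ℕ} {x y z : Pre K G n} : PreRel R n x y → PreRel R n y z → PreRel R n x z
  | add_congr {n : ℕ} {x x' y y' : Pre K G n} : PreRel R n x x' → PreRel R n y y' →
      PreRel R n (x.add y) (x'.add y')
  | smul_congr {n : ℕ} (c : K) {x x' : Pre K G n} : PreRel R n x x' →
      PreRel R n (x.smul c) (x'.smul c)
  | comp_congr {n : ℕ} (k : Fin n → ℕ) {N : ℕ} (h : ∑ i, k i = N) {p p' : Pre K G n}
      {r r' : ∀ i, Pre K G (k i)} : PreRel R n p p' → (∀ i, PreRel R (k i) (r i) (r' i)) →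
      PreRel R N (Pre.comp k h p r) (Pre.comp k h p' r')
  | add_comm {n : ℕ} (x y : Pre K G n) : PreRel R n (x.add y) (y.add x)
  | add_assoc {n : ℕ} (x y z : Pre K G n) : PreRel R n ((x.add y).add z) (x.add (y.add z))
  | zero_add {n : ℕ} (x : Pre K G n) : PreRel R n (Pre.zero.add x) x
  | smul_add {n : ℕ} (c : K) (x y : Pre K G n) :
      PreRel R n ((x.add y).smul c) ((x.smul c).add (y.smul c))
  | add_smul {n : ℕ} (c d : K) (x : Pre K G n) :
      PreRel R n (x.smul (c + d)) ((x.smul c).add (x.smul d))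
  | mul_smul {n : ℕ} (c d : K) (x : Pre K G n) : PreRel R n (x.smul (c * d)) ((x.smul d).smul c)
  | one_smul {n : ℕ} (x : Pre K G n) : PreRel R n (x.smul 1) x
  | zero_smul {n : ℕ} (x : Pre K G n) : PreRel R n (x.smul 0) Pre.zero
  | smul_zero {n : ℕ} (c : K) : PreRel R n (Pre.zero.smul c) Pre.zero
  | comp_add {n : ℕ} (k : Fin n → ℕ) {N : ℕ} (h : ∑ i, k i = N) (p q : Pre K G n)
      (r : ∀ i, Pre K G (k i)) :
      PreRel R N (Pre.comp k h (p.add q) r) ((Pre.comp k h p r).add (Pre.comp k h q r))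
  | comp_smul {n : ℕ} (k : Fin n → ℕ) {N : ℕ} (h : ∑ i, k i = N) (c : K) (p : Pre K G n)
      (r : ∀ i, Pre K G (k i)) :
      PreRel R N (Pre.comp k h (p.smul c) r) ((Pre.comp k h p r).smul c)
  | comp_update_add {n : ℕ} (k : Fin n → ℕ) {N : ℕ} (h : ∑ i, k i = N) (p : Pre K G n)
      (r : ∀ i, Pre K G (k i)) (i : Fin n) (x y : Pre K G (k i)) :
      PreRel R N (Pre.comp k h p (Function.update r i (x.add y)))
        ((Pre.comp k h p (Function.update r i x)).add (Pre.comp k h p (Function.update r i y)))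
  | comp_update_smul {n : ℕ} (k : Fin n → ℕ) {N : ℕ} (h : ∑ i, k i = N) (p : Pre K G n)
      (r : ∀ i, Pre K G (k i)) (i : Fin n) (c : K) (x : Pre K G (k i)) :
      PreRel R N (Pre.comp k h p (Function.update r i (x.smul c)))
        ((Pre.comp k h p (Function.update r i x)).smul c)
  | comp_one {n : ℕ} (h : ∑ _i : Fin n, 1 = n) (p : Pre K G n) :
      PreRel R n (Pre.comp (fun _ => 1) h p (fun _ => Pre.one)) p
  | one_comp {n : ℕ} (h : ∑ _i : Fin 1, n = n) (p : Pre K G n) :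
      PreRel R n (Pre.comp (fun _ => n) h Pre.one (fun _ => p)) p
  | assoc {n : ℕ} (k : Fin n → ℕ) {N : ℕ} (h : ∑ i, k i = N)
      (l : Fin N → ℕ) {T : ℕ} (hl : ∑ s, l s = T)
      (M : Fin n → ℕ) (hM : ∀ i, ∑ j, l (block k h ⟨i, j⟩) = M i) (hT : ∑ i, M i = T)
      (p : Pre K G n) (q : ∀ i, Pre K G (k i)) (r : ∀ s, Pre K G (l s)) :
      PreRel R T (Pre.comp l hl (Pre.comp k h p q) r)
        (Pre.comp M hT p (fun i => Pre.comp (fun j => l (block k h ⟨i, j⟩)) (hM i) (q i)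
          (fun j => r (block k h ⟨i, j⟩))))

section Presented

variable {K : Type u} [Field K] {G : ℕ → Type u} (R : ∀ n, Pre K G n → Pre K G n → Prop)

def preSetoid (n : ℕ) : Setoid (Pre K G n) where
  r := PreRel R n
  iseqv := ⟨PreRel.refl, PreRel.symm, PreRel.trans⟩

/-- The space of operations of arity `n` of the presented operad. -/
def PreQuot (n : ℕ) : Type u := Quotient (preSetoid R n)

namespace PreQuot

def mk {n : ℕ} (x : Pre K G n) : PreQuot R n := Quotient.mk (preSetoid R n) x

theorem sound {n : ℕ} {x y : Pre K G n} (h : PreRel R n x y) : mk R x = mk R y :=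
  Quotient.sound (s := preSetoid R n) h

def out {n : ℕ} (x : PreQuot R n) : Pre K G n := Quotient.out (s := preSetoid R n) x

theorem mk_out {n : ℕ} (x : PreQuot R n) : mk R (out R x) = x :=
  Quotient.out_eq (s := preSetoid R n) x

theorem out_mk {n : ℕ} (x : Pre K G n) : PreRel R n (out R (mk R x)) x :=
  Quotient.mk_out (s := preSetoid R n) x

instance (n : ℕ) : Add (PreQuot R n) := ⟨fun x y => mk R ((out R x).add (out R y))⟩

instance (n : ℕ) : Zero (PreQuot R n) := ⟨mk R Pre.zero⟩

instance (n : ℕ) : SMul K (PreQuot R n) := ⟨fun c x => mk R ((out R x).smul c)⟩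

instance (n : ℕ) : AddCommMonoid (PreQuot R n) where
  add_assoc x y z := sound R <|
    ((PreRel.add_congr (out_mk R _) (.refl _)).trans (PreRel.add_assoc _ _ _)).trans
      (PreRel.add_congr (.refl _) (out_mk R _)).symm
  zero_add x := (sound R ((PreRel.add_congr (out_mk R _) (.refl _)).trans (.zero_add _))).trans
    (mk_out R x)
  add_zero x := (sound R (((PreRel.add_congr (.refl _) (out_mk R _)).trans
    (.add_comm _ _)).trans (.zero_add _))).trans (mk_out R x)
  add_comm x y := sound R (.add_comm _ _)
  nsmul := nsmulRec

instance (n : ℕ) : Module K (PreQuot R n) where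
  one_smul x := (sound R (.one_smul _)).trans (mk_out R x)
  mul_smul c d x := sound R ((PreRel.mul_smul c d _).trans (.smul_congr _ (out_mk R _).symm))
  smul_zero c := sound R ((PreRel.smul_congr c (out_mk R _)).trans (.smul_zero c))
  smul_add c x y := sound R (((PreRel.smul_congr c (out_mk R _)).trans (.smul_add c _ _)).trans
    (.add_congr (out_mk R _).symm (out_mk R _).symm))
  add_smul c d x := sound R ((PreRel.add_smul c d _).trans
    (.add_congr (out_mk R _).symm (out_mk R _).symm))
  zero_smul x := sound R (.zero_smul _)

instance (n : ℕ) : AddCommGroup (PreQuot R n) := Module.addCommMonoidToAddCommGroup K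

theorem out_update {n : ℕ} (k : Fin n → ℕ) (r : ∀ i, PreQuot R (k i)) (i : Fin n)
    (x : PreQuot R (k i)) (x' : Pre K G (k i)) (hx : PreRel R (k i) (out R x) x') (j : Fin n) :
    PreRel R (k j) (out R (Function.update r i x j))
      (Function.update (fun j => out R (r j)) i x' j) := by
  by_cases hj : j = i
  · subst hj; simpa using hx
  · simpa [Function.update_of_ne hj] using PreRel.refl _

end PreQuot

/-- The non-symmetric operad with generators `G` and relations `R`. -/
def NSOperad.presented : NSOperad K where
  obj := PreQuot R
  one := PreQuot.mk R Pre.one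
  comp k _ h p r := PreQuot.mk R (Pre.comp k h (PreQuot.out R p) (fun i => PreQuot.out R (r i)))
  comp_add k _ h p q r := PreQuot.sound R (((PreRel.comp_congr k h (PreQuot.out_mk R _) (fun _ => .refl _)).trans
    (.comp_add k h _ _ _)).trans (.add_congr (PreQuot.out_mk R _).symm (PreQuot.out_mk R _).symm))
  comp_smul k _ h c p r := PreQuot.sound R (((PreRel.comp_congr k h (PreQuot.out_mk R _)
    (fun _ => .refl _)).trans (.comp_smul k h c _ _)).trans (.smul_congr c (PreQuot.out_mk R _).symm))
  comp_update_add k _ h p r i x y := PreQuot.sound R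
    (((PreRel.comp_congr k h (.refl _) (PreQuot.out_update R k r i _ _ (PreQuot.out_mk R _))).trans
      (.comp_update_add k h _ _ i _ _)).trans
      (.add_congr
        ((PreQuot.out_mk R _).trans (.comp_congr k h (.refl _) (PreQuot.out_update R k r i _ _ (.refl _)))).symm
        ((PreQuot.out_mk R _).trans (.comp_congr k h (.refl _) (PreQuot.out_update R k r i _ _ (.refl _)))).symm))
  comp_update_smul k _ h p r i c x := PreQuot.sound R
    (((PreRel.comp_congr k h (.refl _) (PreQuot.out_update R k r i _ _ (PreQuot.out_mk R _))).trans
      (.comp_update_smul k h _ _ i c _)).trans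
      (.smul_congr c
        ((PreQuot.out_mk R _).trans (.comp_congr k h (.refl _) (PreQuot.out_update R k r i _ _ (.refl _)))).symm))
  comp_one h p := (PreQuot.sound R ((PreRel.comp_congr _ h (.refl _) (fun _ => PreQuot.out_mk R _)).trans
    (.comp_one h _))).trans (PreQuot.mk_out R p)
  one_comp h p := (PreQuot.sound R ((PreRel.comp_congr _ h (PreQuot.out_mk R _) (fun _ => .refl _)).trans
    (.one_comp h _))).trans (PreQuot.mk_out R p)
  assoc k _ h l _ hl M hM hT p q r := PreQuot.sound R
    (((PreRel.comp_congr l hl (PreQuot.out_mk R _) (fun _ => .refl _)).trans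
      (.assoc k h l hl M hM hT _ _ _)).trans
      (.comp_congr M hT (.refl _) (fun _ => (PreQuot.out_mk R _).symm)))

end Presented

/-! ## Symmetric operads -/

section Permutations

variable {n : ℕ}

/-- The permutation of `k_1 + … + k_n` elements that permutes the blocks according to `σ`. -/
def blockPerm (σ : Equiv.Perm (Fin n)) (k : Fin n → ℕ) {N : ℕ}
    (h' : ∑ i, k (σ i) = N) (h : ∑ i, k i = N) : Equiv.Perm (Fin N) :=
  (block (fun i => k (σ i)) h').symm.trans
    ((Equiv.sigmaCongrLeft (β := fun i => Fin (k i)) σ).trans (block k h))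

/-- The permutation of `k_1 + … + k_n` elements that permutes the `i`-th block by `τ i`. -/
def blockSum (k : Fin n → ℕ) {N : ℕ} (h : ∑ i, k i = N) (τ : ∀ i, Equiv.Perm (Fin (k i))) :
    Equiv.Perm (Fin N) :=
  (block k h).symm.trans ((Equiv.sigmaCongrRight τ).trans (block k h))

end Permutations

/-- A (symmetric) operad: `perm σ p` is the right action `p · σ` of the symmetric group. -/
structure SymOperad (K : Type u) [Field K] extends NSOperad K where
  perm : ∀ {n : ℕ}, Equiv.Perm (Fin n) → obj n → obj n
  perm_add : ∀ {n : ℕ} (σ : Equiv.Perm (Fin n)) (p q : obj n),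
    perm σ (p + q) = perm σ p + perm σ q
  perm_smul : ∀ {n : ℕ} (σ : Equiv.Perm (Fin n)) (c : K) (p : obj n),
    perm σ (c • p) = c • perm σ p
  perm_one : ∀ {n : ℕ} (p : obj n), perm 1 p = p
  perm_mul : ∀ {n : ℕ} (σ τ : Equiv.Perm (Fin n)) (p : obj n),
    perm (σ * τ) p = perm τ (perm σ p)
  perm_comp : ∀ {n : ℕ} (σ : Equiv.Perm (Fin n)) (k : Fin n → ℕ) {N : ℕ}
    (h' : ∑ i, k (σ i) = N) (h : ∑ i, k i = N) (p : obj n) (r : ∀ i, obj (k i)),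
    comp (fun i => k (σ i)) h' (perm σ p) (fun i => r (σ i)) =
      perm (blockPerm σ k h' h) (comp k h p r)
  comp_perm : ∀ {n : ℕ} (k : Fin n → ℕ) {N : ℕ} (h : ∑ i, k i = N) (p : obj n)
    (τ : ∀ i, Equiv.Perm (Fin (k i))) (r : ∀ i, obj (k i)),
    comp k h p (fun i => perm (τ i) (r i)) = perm (blockSum k h τ) (comp k h p r)

namespace SymOperad

variable {K : Type u} [Field K]

/-- Morphisms of operads. -/
structure Hom (P Q : SymOperad K) extends NSOperad.Hom P.toNSOperad Q.toNSOperad where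
  map_perm : ∀ {n : ℕ} (σ : Equiv.Perm (Fin n)) (p : P.obj n),
    map n (P.perm σ p) = Q.perm σ (map n p)

/-- Isomorphic operads. -/
def IsIso (P Q : SymOperad K) : Prop := ∃ φ : Hom P Q, ∀ n, Function.Bijective (φ.map n)

/-- Suboperads of a symmetric operad. -/
structure Suboperad (P : SymOperad K) extends NSOperad.Suboperad P.toNSOperad where
  perm_mem : ∀ {n : ℕ} (σ : Equiv.Perm (Fin n)) (p : P.obj n), p ∈ carrier n →
    P.perm σ p ∈ carrier n

/-- A suboperad is an operad. -/
def Suboperad.toSymOperad {P : SymOperad K} (S : Suboperad P) : SymOperad K where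
  toNSOperad := S.toSuboperad.toOperad
  perm σ p := ⟨P.perm σ p.1, S.perm_mem σ _ p.2⟩
  perm_add σ p q := Subtype.ext (P.perm_add σ _ _)
  perm_smul σ c p := Subtype.ext (P.perm_smul σ c _)
  perm_one p := Subtype.ext (P.perm_one _)
  perm_mul σ τ p := Subtype.ext (P.perm_mul σ τ _)
  perm_comp σ k _ h' h p r :=
    Subtype.ext (P.perm_comp σ k h' h p.1 (fun i => (r i).1))
  comp_perm k _ h p τ r := Subtype.ext (P.comp_perm k h p.1 τ (fun i => (r i).1))

/-- Algebras over a symmetric operad: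
`(p · σ).(a_1, …, a_n) = p.(a_{σ⁻¹(1)}, …, a_{σ⁻¹(n)})`. -/
structure Algebra (P : SymOperad K) (A : Type u) [AddCommGroup A] [Module K A] extends
    NSOperad.Algebra P.toNSOperad A where
  act_perm : ∀ {n : ℕ} (σ : Equiv.Perm (Fin n)) (p : P.obj n) (a : Fin n → A),
    act (P.perm σ p) a = act p (fun i => a (σ.symm i))

end SymOperad

/-! ## Symmetric operads given by generators and relations -/

/-- Formal expressions in generators `G`, with permutations. -/
inductive SPre (K : Type u) (G : ℕ → Type u) : ℕ → Type u
  | gen {n : ℕ} : G n → SPre K G n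
  | one : SPre K G 1
  | zero {n : ℕ} : SPre K G n
  | add {n : ℕ} : SPre K G n → SPre K G n → SPre K G n
  | smul {n : ℕ} : K → SPre K G n → SPre K G n
  | comp {n : ℕ} (k : Fin n → ℕ) {N : ℕ} (h : ∑ i, k i = N) :
      SPre K G n → (∀ i, SPre K G (k i)) → SPre K G N
  | perm {n : ℕ} : Equiv.Perm (Fin n) → SPre K G n → SPre K G n

/-- The smallest congruence on formal expressions that contains `R` and all the identities which
hold in symmetric operads. -/
inductive SPreRel {K : Type u} [Field K] {G : ℕ → Type u}
    (R : ∀ n, SPre K G n → SPre K G n → Prop) : ∀ n, SPre K G n → SPre K G n → Prop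
  | of {n : ℕ} {x y : SPre K G n} : R n x y → SPreRel R n x y
  | refl {n : ℕ} (x : SPre K G n) : SPreRel R n x x
  | symm {n : ℕ} {x y : SPre K G n} : SPreRel R n x y → SPreRel R n y x
  | trans {n : ℕ} {x y z : SPre K G n} : SPreRel R n x y → SPreRel R n y z → SPreRel R n x z
  | add_congr {n : ℕ} {x x' y y' : SPre K G n} : SPreRel R n x x' → SPreRel R n y y' →
      SPreRel R n (x.add y) (x'.add y')
  | smul_congr {n : ℕ} (c : K) {x x' : SPre K G n} : SPreRel R n x x' →
      SPreRel R n (x.smul c) (x'.smul c)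
  | comp_congr {n : ℕ} (k : Fin n → ℕ) {N : ℕ} (h : ∑ i, k i = N) {p p' : SPre K G n}
      {r r' : ∀ i, SPre K G (k i)} : SPreRel R n p p' → (∀ i, SPreRel R (k i) (r i) (r' i)) →
      SPreRel R N (SPre.comp k h p r) (SPre.comp k h p' r')
  | perm_congr {n : ℕ} (σ : Equiv.Perm (Fin n)) {x x' : SPre K G n} : SPreRel R n x x' →
      SPreRel R n (x.perm σ) (x'.perm σ)
  | add_comm {n : ℕ} (x y : SPre K G n) : SPreRel R n (x.add y) (y.add x)
  | add_assoc {n : ℕ} (x y z : SPre K G n) : SPreRel R n ((x.add y).add z) (x.add (y.add z))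
  | zero_add {n : ℕ} (x : SPre K G n) : SPreRel R n (SPre.zero.add x) x
  | smul_add {n : ℕ} (c : K) (x y : SPre K G n) :
      SPreRel R n ((x.add y).smul c) ((x.smul c).add (y.smul c))
  | add_smul {n : ℕ} (c d : K) (x : SPre K G n) :
      SPreRel R n (x.smul (c + d)) ((x.smul c).add (x.smul d))
  | mul_smul {n : ℕ} (c d : K) (x : SPre K G n) :
      SPreRel R n (x.smul (c * d)) ((x.smul d).smul c)
  | one_smul {n : ℕ} (x : SPre K G n) : SPreRel R n (x.smul 1) x
  | zero_smul {n : ℕ} (x : SPre K G n) : SPreRel R n (x.smul 0) SPre.zero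
  | smul_zero {n : ℕ} (c : K) : SPreRel R n (SPre.zero.smul c) SPre.zero
  | comp_add {n : ℕ} (k : Fin n → ℕ) {N : ℕ} (h : ∑ i, k i = N) (p q : SPre K G n)
      (r : ∀ i, SPre K G (k i)) :
      SPreRel R N (SPre.comp k h (p.add q) r) ((SPre.comp k h p r).add (SPre.comp k h q r))
  | comp_smul {n : ℕ} (k : Fin n → ℕ) {N : ℕ} (h : ∑ i, k i = N) (c : K) (p : SPre K G n)
      (r : ∀ i, SPre K G (k i)) :
      SPreRel R N (SPre.comp k h (p.smul c) r) ((SPre.comp k h p r).smul c)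
  | comp_update_add {n : ℕ} (k : Fin n → ℕ) {N : ℕ} (h : ∑ i, k i = N) (p : SPre K G n)
      (r : ∀ i, SPre K G (k i)) (i : Fin n) (x y : SPre K G (k i)) :
      SPreRel R N (SPre.comp k h p (Function.update r i (x.add y)))
        ((SPre.comp k h p (Function.update r i x)).add (SPre.comp k h p (Function.update r i y)))
  | comp_update_smul {n : ℕ} (k : Fin n → ℕ) {N : ℕ} (h : ∑ i, k i = N) (p : SPre K G n)
      (r : ∀ i, SPre K G (k i)) (i : Fin n) (c : K) (x : SPre K G (k i)) :
      SPreRel R N (SPre.comp k h p (Function.update r i (x.smul c)))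
        ((SPre.comp k h p (Function.update r i x)).smul c)
  | comp_one {n : ℕ} (h : ∑ _i : Fin n, 1 = n) (p : SPre K G n) :
      SPreRel R n (SPre.comp (fun _ => 1) h p (fun _ => SPre.one)) p
  | one_comp {n : ℕ} (h : ∑ _i : Fin 1, n = n) (p : SPre K G n) :
      SPreRel R n (SPre.comp (fun _ => n) h SPre.one (fun _ => p)) p
  | assoc {n : ℕ} (k : Fin n → ℕ) {N : ℕ} (h : ∑ i, k i = N)
      (l : Fin N → ℕ) {T : ℕ} (hl : ∑ s, l s = T)
      (M : Fin n → ℕ) (hM : ∀ i, ∑ j, l (block k h ⟨i, j⟩) = M i) (hT : ∑ i, M i = T)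
      (p : SPre K G n) (q : ∀ i, SPre K G (k i)) (r : ∀ s, SPre K G (l s)) :
      SPreRel R T (SPre.comp l hl (SPre.comp k h p q) r)
        (SPre.comp M hT p (fun i => SPre.comp (fun j => l (block k h ⟨i, j⟩)) (hM i) (q i)
          (fun j => r (block k h ⟨i, j⟩))))
  | perm_add {n : ℕ} (σ : Equiv.Perm (Fin n)) (x y : SPre K G n) :
      SPreRel R n ((x.add y).perm σ) ((x.perm σ).add (y.perm σ))
  | perm_smul {n : ℕ} (σ : Equiv.Perm (Fin n)) (c : K) (x : SPre K G n) :
      SPreRel R n ((x.smul c).perm σ) ((x.perm σ).smul c)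
  | perm_one {n : ℕ} (x : SPre K G n) : SPreRel R n (x.perm 1) x
  | perm_mul {n : ℕ} (σ τ : Equiv.Perm (Fin n)) (x : SPre K G n) :
      SPreRel R n (x.perm (σ * τ)) ((x.perm σ).perm τ)
  | perm_comp {n : ℕ} (σ : Equiv.Perm (Fin n)) (k : Fin n → ℕ) {N : ℕ}
      (h' : ∑ i, k (σ i) = N) (h : ∑ i, k i = N) (p : SPre K G n) (r : ∀ i, SPre K G (k i)) :
      SPreRel R N (SPre.comp (fun i => k (σ i)) h' (p.perm σ) (fun i => r (σ i)))
        ((SPre.comp k h p r).perm (blockPerm σ k h' h))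
  | comp_perm {n : ℕ} (k : Fin n → ℕ) {N : ℕ} (h : ∑ i, k i = N) (p : SPre K G n)
      (τ : ∀ i, Equiv.Perm (Fin (k i))) (r : ∀ i, SPre K G (k i)) :
      SPreRel R N (SPre.comp k h p (fun i => (r i).perm (τ i)))
        ((SPre.comp k h p r).perm (blockSum k h τ))

section SPresented

variable {K : Type u} [Field K] {G : ℕ → Type u} (R : ∀ n, SPre K G n → SPre K G n → Prop)

def spreSetoid (n : ℕ) : Setoid (SPre K G n) where
  r := SPreRel R n
  iseqv := ⟨SPreRel.refl, SPreRel.symm, SPreRel.trans⟩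

/-- The space of operations of arity `n` of the presented symmetric operad. -/
def SPreQuot (n : ℕ) : Type u := Quotient (spreSetoid R n)

namespace SPreQuot

def mk {n : ℕ} (x : SPre K G n) : SPreQuot R n := Quotient.mk (spreSetoid R n) x

theorem sound {n : ℕ} {x y : SPre K G n} (h : SPreRel R n x y) : mk R x = mk R y :=
  Quotient.sound (s := spreSetoid R n) h

def out {n : ℕ} (x : SPreQuot R n) : SPre K G n := Quotient.out (s := spreSetoid R n) x

theorem mk_out {n : ℕ} (x : SPreQuot R n) : mk R (out R x) = x :=
  Quotient.out_eq (s := spreSetoid R n) x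

theorem out_mk {n : ℕ} (x : SPre K G n) : SPreRel R n (out R (mk R x)) x :=
  Quotient.mk_out (s := spreSetoid R n) x

instance (n : ℕ) : Add (SPreQuot R n) := ⟨fun x y => mk R ((out R x).add (out R y))⟩

instance (n : ℕ) : Zero (SPreQuot R n) := ⟨mk R SPre.zero⟩

instance (n : ℕ) : SMul K (SPreQuot R n) := ⟨fun c x => mk R ((out R x).smul c)⟩

instance (n : ℕ) : AddCommMonoid (SPreQuot R n) where
  add_assoc x y z := sound R <|
    ((SPreRel.add_congr (out_mk R _) (.refl _)).trans (SPreRel.add_assoc _ _ _)).trans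
      (SPreRel.add_congr (.refl _) (out_mk R _)).symm
  zero_add x := (sound R ((SPreRel.add_congr (out_mk R _) (.refl _)).trans (.zero_add _))).trans
    (mk_out R x)
  add_zero x := (sound R (((SPreRel.add_congr (.refl _) (out_mk R _)).trans
    (.add_comm _ _)).trans (.zero_add _))).trans (mk_out R x)
  add_comm x y := sound R (.add_comm _ _)
  nsmul := nsmulRec

instance (n : ℕ) : Module K (SPreQuot R n) where
  one_smul x := (sound R (.one_smul _)).trans (mk_out R x)
  mul_smul c d x := sound R ((SPreRel.mul_smul c d _).trans (.smul_congr _ (out_mk R _).symm))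
  smul_zero c := sound R ((SPreRel.smul_congr c (out_mk R _)).trans (.smul_zero c))
  smul_add c x y := sound R (((SPreRel.smul_congr c (out_mk R _)).trans (.smul_add c _ _)).trans
    (.add_congr (out_mk R _).symm (out_mk R _).symm))
  add_smul c d x := sound R ((SPreRel.add_smul c d _).trans
    (.add_congr (out_mk R _).symm (out_mk R _).symm))
  zero_smul x := sound R (.zero_smul _)

instance (n : ℕ) : AddCommGroup (SPreQuot R n) := Module.addCommMonoidToAddCommGroup K

theorem out_update {n : ℕ} (k : Fin n → ℕ) (r : ∀ i, SPreQuot R (k i)) (i : Fin n)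
    (x : SPreQuot R (k i)) (x' : SPre K G (k i)) (hx : SPreRel R (k i) (out R x) x') (j : Fin n) :
    SPreRel R (k j) (out R (Function.update r i x j))
      (Function.update (fun j => out R (r j)) i x' j) := by
  by_cases hj : j = i
  · subst hj; simpa using hx
  · simpa [Function.update_of_ne hj] using SPreRel.refl _

end SPreQuot

/-- The symmetric operad with generators `G` and relations `R`. -/
def SymOperad.presented : SymOperad K where
  obj := SPreQuot R
  one := SPreQuot.mk R SPre.one
  comp k _ h p r := SPreQuot.mk R (SPre.comp k h (SPreQuot.out R p) (fun i => SPreQuot.out R (r i)))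
  comp_add k _ h p q r := SPreQuot.sound R (((SPreRel.comp_congr k h (SPreQuot.out_mk R _) (fun _ => .refl _)).trans
    (.comp_add k h _ _ _)).trans (.add_congr (SPreQuot.out_mk R _).symm (SPreQuot.out_mk R _).symm))
  comp_smul k _ h c p r := SPreQuot.sound R (((SPreRel.comp_congr k h (SPreQuot.out_mk R _)
    (fun _ => .refl _)).trans (.comp_smul k h c _ _)).trans (.smul_congr c (SPreQuot.out_mk R _).symm))
  comp_update_add k _ h p r i x y := SPreQuot.sound R
    (((SPreRel.comp_congr k h (.refl _) (SPreQuot.out_update R k r i _ _ (SPreQuot.out_mk R _))).trans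
      (.comp_update_add k h _ _ i _ _)).trans
      (.add_congr
        ((SPreQuot.out_mk R _).trans (.comp_congr k h (.refl _) (SPreQuot.out_update R k r i _ _ (.refl _)))).symm
        ((SPreQuot.out_mk R _).trans (.comp_congr k h (.refl _) (SPreQuot.out_update R k r i _ _ (.refl _)))).symm))
  comp_update_smul k _ h p r i c x := SPreQuot.sound R
    (((SPreRel.comp_congr k h (.refl _) (SPreQuot.out_update R k r i _ _ (SPreQuot.out_mk R _))).trans
      (.comp_update_smul k h _ _ i c _)).trans
      (.smul_congr c
        ((SPreQuot.out_mk R _).trans (.comp_congr k h (.refl _) (SPreQuot.out_update R k r i _ _ (.refl _)))).symm))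
  comp_one h p := (SPreQuot.sound R ((SPreRel.comp_congr _ h (.refl _) (fun _ => SPreQuot.out_mk R _)).trans
    (.comp_one h _))).trans (SPreQuot.mk_out R p)
  one_comp h p := (SPreQuot.sound R ((SPreRel.comp_congr _ h (SPreQuot.out_mk R _) (fun _ => .refl _)).trans
    (.one_comp h _))).trans (SPreQuot.mk_out R p)
  assoc k _ h l _ hl M hM hT p q r := SPreQuot.sound R
    (((SPreRel.comp_congr l hl (SPreQuot.out_mk R _) (fun _ => .refl _)).trans
      (.assoc k h l hl M hM hT _ _ _)).trans
      (.comp_congr M hT (.refl _) (fun _ => (SPreQuot.out_mk R _).symm)))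
  perm σ p := SPreQuot.mk R ((SPreQuot.out R p).perm σ)
  perm_add σ p q := SPreQuot.sound R (((SPreRel.perm_congr σ (SPreQuot.out_mk R _)).trans (.perm_add σ _ _)).trans
    (.add_congr (SPreQuot.out_mk R _).symm (SPreQuot.out_mk R _).symm))
  perm_smul σ c p := SPreQuot.sound R (((SPreRel.perm_congr σ (SPreQuot.out_mk R _)).trans
    (.perm_smul σ c _)).trans (.smul_congr c (SPreQuot.out_mk R _).symm))
  perm_one p := (SPreQuot.sound R (.perm_one _)).trans (SPreQuot.mk_out R p)
  perm_mul σ τ p := SPreQuot.sound R ((SPreRel.perm_mul σ τ _).trans (.perm_congr τ (SPreQuot.out_mk R _).symm))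
  perm_comp σ k _ h' h p r := SPreQuot.sound R
    (((SPreRel.comp_congr _ h' (SPreQuot.out_mk R _) (fun _ => .refl _)).trans
      (.perm_comp σ k h' h _ (fun i => SPreQuot.out R (r i)))).trans (.perm_congr _ (SPreQuot.out_mk R _).symm))
  comp_perm k _ h p τ r := SPreQuot.sound R
    (((SPreRel.comp_congr k h (.refl _) (fun _ => SPreQuot.out_mk R _)).trans
      (.comp_perm k h _ τ _)).trans (.perm_congr _ (SPreQuot.out_mk R _).symm))

end SPresented

/-! ## Symmetrisation and the free operad on one binary operation -/

section Symmetrisation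

variable {K : Type u} [Field K]

/-- The relations which make `P → P^Σ` a morphism of non-symmetric operads. -/
inductive SymmRel (P : NSOperad K) : ∀ n, SPre K P.obj n → SPre K P.obj n → Prop
  | one : SymmRel P 1 (.gen P.one) .one
  | add {n : ℕ} (p q : P.obj n) : SymmRel P n (.gen (p + q)) ((SPre.gen p).add (.gen q))
  | smul {n : ℕ} (c : K) (p : P.obj n) : SymmRel P n (.gen (c • p)) ((SPre.gen p).smul c)
  | comp {n : ℕ} (k : Fin n → ℕ) {N : ℕ} (h : ∑ i, k i = N) (p : P.obj n)
      (r : ∀ i, P.obj (k i)) :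
      SymmRel P N (.gen (P.comp k h p r)) (SPre.comp k h (.gen p) (fun i => .gen (r i)))

/-- The symmetrisation `P^Σ` of a non-symmetric operad `P`: the symmetric operad freely generated
by the non-symmetric operad `P`, so that `P^Σ(n) ≅ P(n) ⊗ K[S_n]` and the algebras over `P^Σ` are
those over `P`. -/
def symmetrisation (P : NSOperad K) : SymOperad K := SymOperad.presented (SymmRel P)

/-- The canonical map `P(n) → P^Σ(n)`. -/
def toSymmetrisation (P : NSOperad K) {n : ℕ} (p : P.obj n) : (symmetrisation P).obj n :=
  SPreQuot.mk (SymmRel P) (.gen p)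

/-- One generator, in arity `2`. -/
inductive OneBinary : ℕ → Type u
  | star : OneBinary 2

/-- The free symmetric operad generated by one element of arity `2` (without symmetry). -/
def free₂ (K : Type u) [Field K] : SymOperad K :=
  SymOperad.presented (K := K) (G := OneBinary) (fun _ _ _ => False)

end Symmetrisation

/-! ## The operad `P_↗` -/

/-- The two generators `m` and `↗`, in arity `2`. -/
inductive GraftGen : ℕ → Type u
  | m : GraftGen 2
  | up : GraftGen 2

/-- The relations `m ∘ (↗, I) = ↗ ∘ (I, m)`, `m ∘ (m, I) = m ∘ (I, m)` and
`↗ ∘ (↗, I) = ↗ ∘ (I, ↗)`. -/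
inductive GraftRel (K : Type u) : ∀ n, Pre K GraftGen n → Pre K GraftGen n → Prop
  | m_up : GraftRel K 3 (Pre.comp₂ (b := 1) rfl (.gen .m) (.gen .up) .one)
      (Pre.comp₂ (a := 1) rfl (.gen .up) .one (.gen .m))
  | m_m : GraftRel K 3 (Pre.comp₂ (b := 1) rfl (.gen .m) (.gen .m) .one)
      (Pre.comp₂ (a := 1) rfl (.gen .m) .one (.gen .m))
  | up_up : GraftRel K 3 (Pre.comp₂ (b := 1) rfl (.gen .up) (.gen .up) .one)
      (Pre.comp₂ (a := 1) rfl (.gen .up) .one (.gen .up))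

/-- The non-symmetric operad `P_↗`. -/
def graftOperad (K : Type u) [Field K] : NSOperad K := NSOperad.presented (GraftRel K)

/-- The operation `m ∈ P_↗(2)`, i.e. the forest with two vertices and no edge. -/
def opM (K : Type u) [Field K] : (graftOperad K).obj 2 := PreQuot.mk (GraftRel K) (.gen .m)

/-- The operation `↗ ∈ P_↗(2)`, i.e. the ladder with two vertices. -/
def opUp (K : Type u) [Field K] : (graftOperad K).obj 2 := PreQuot.mk (GraftRel K) (.gen .up)

/-! ## Coalgebras -/

section Coalgebras

variable {K : Type u} [Field K] {C D : Type u} [AddCommGroup C] [Module K C]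
  [AddCommGroup D] [Module K D]

/-- Coassociativity of a (non counitary) coproduct. -/
def IsCoassoc (δ : C →ₗ[K] C ⊗[K] C) : Prop :=
  (TensorProduct.assoc K C C C).toLinearMap ∘ₗ δ.rTensor C ∘ₗ δ = δ.lTensor C ∘ₗ δ

/-- Morphisms of coalgebras. -/
def IsCoalgHom (δ : C →ₗ[K] C ⊗[K] C) (δ' : D →ₗ[K] D ⊗[K] D) (f : C →ₗ[K] D) : Prop :=
  δ' ∘ₗ f = TensorProduct.map f f ∘ₗ δ

/-- The filtration `F_0 = 0`, `F_{r+1} = {x | δ(x) ∈ F_r ⊗ F_r}`; thus `F_1 = Ker δ`. -/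
def primFiltration (δ : C →ₗ[K] C ⊗[K] C) : ℕ → Submodule K C
  | 0 => ⊥
  | r + 1 => (LinearMap.range (TensorProduct.map (primFiltration δ r).subtype
      (primFiltration δ r).subtype)).comap δ

/-- Connected (non counitary) coalgebras. -/
def IsConnectedCoalg (δ : C →ₗ[K] C ⊗[K] C) : Prop := ∀ x, ∃ r, x ∈ primFiltration δ r

/-- `(C, δ)` is the cofree connected coassociative coalgebra over the vector space `V`, with
projection `π : C → V`. -/
def IsCofreeConnected (δ : C →ₗ[K] C ⊗[K] C) {V : Type u} [AddCommGroup V] [Module K V]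
    (π : C →ₗ[K] V) : Prop :=
  IsCoassoc δ ∧ IsConnectedCoalg δ ∧
  ∀ (D : Type u) [AddCommGroup D] [Module K D] (δ' : D →ₗ[K] D ⊗[K] D),
    IsCoassoc δ' → IsConnectedCoalg δ' → ∀ f : D →ₗ[K] V,
      ∃! g : D →ₗ[K] C, IsCoalgHom δ' δ g ∧ π ∘ₗ g = f

/-- The compatibility `δ(x * y) = (x ⊗ 1) * δ(y) + δ(x) * (1 ⊗ y) + x ⊗ y` of a bilinear product
with a coproduct: in Sweedler notation `(x * y') ⊗ y'' + x' ⊗ (x'' * y) + x ⊗ y`. -/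
def InfCompat (μ : C →ₗ[K] C →ₗ[K] C) (δ : C →ₗ[K] C ⊗[K] C) : Prop :=
  ∀ x y, δ (μ x y) = (μ x).rTensor C (δ y) + (μ.flip y).lTensor C (δ x) + x ⊗ₜ[K] y

end Coalgebras

/-! ## Bialgebras of type 1 and their primitive operations -/

section Bialgebras

variable (K : Type u) [Field K]

/-- A `P_↗`-bialgebra of type `1`. -/
structure BialgOne (A : Type u) [AddCommGroup A] [Module K A] where
  alg : (graftOperad K).Algebra A
  δ : A →ₗ[K] A ⊗[K] A
  coassoc : IsCoassoc δ
  compat_m : InfCompat (alg.bin (opM K)) δ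
  compat_up : InfCompat (alg.bin (opUp K)) δ

/-- The suboperad `PRIM_↗^(1)` of `P_↗`. -/
def PRIM : (graftOperad K).Suboperad where
  carrier n :=
    { carrier := {p | ∀ (A : Type u) [AddCommGroup A] [Module K A] (B : BialgOne K A)
        (a : Fin n → A), (∀ i, a i ∈ LinearMap.ker B.δ) → B.alg.act p a ∈ LinearMap.ker B.δ}
      add_mem' := fun {p q} hp hq A _ _ B a ha => by
        rw [B.alg.act_add]; exact Submodule.add_mem _ (hp A B a ha) (hq A B a ha)
      zero_mem' := fun A _ _ B a _ => by
        have h := B.alg.act_smul (n := n) 0 0 a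
        rw [zero_smul, zero_smul] at h
        rw [h]; exact Submodule.zero_mem _
      smul_mem' := fun c p hp A _ _ B a ha => by
        rw [B.alg.act_smul]; exact Submodule.smul_mem _ c (hp A B a ha) }
  one_mem := fun A _ _ B a ha => by rw [B.alg.act_one]; exact ha 0
  comp_mem := fun k _ h p r hp hr A _ _ B a ha => by
    rw [B.alg.act_comp]
    exact hp A B _ (fun i => hr i A B _ (fun j => ha _))

/-- The symmetrised operad `P_↗^Σ`. -/
abbrev symGraft : SymOperad K := symmetrisation (graftOperad K)

/-- A bialgebra of type `1` over the symmetric operad `P_↗^Σ`. -/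
structure SymBialgOne (A : Type u) [AddCommGroup A] [Module K A] where
  alg : (symGraft K).Algebra A
  δ : A →ₗ[K] A ⊗[K] A
  coassoc : IsCoassoc δ
  compat_m : InfCompat (alg.toAlgebra.bin (toSymmetrisation _ (opM K))) δ
  compat_up : InfCompat (alg.toAlgebra.bin (toSymmetrisation _ (opUp K))) δ

/-- The primitive operad of the triple: the operations of `P_↗^Σ` which preserve primitive
elements. -/
def symPRIM : (symGraft K).Suboperad where
  carrier n :=
    { carrier := {p | ∀ (A : Type u) [AddCommGroup A] [Module K A] (B : SymBialgOne K A)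
        (a : Fin n → A), (∀ i, a i ∈ LinearMap.ker B.δ) → B.alg.act p a ∈ LinearMap.ker B.δ}
      add_mem' := fun {p q} hp hq A _ _ B a ha => by
        rw [B.alg.act_add]; exact Submodule.add_mem _ (hp A B a ha) (hq A B a ha)
      zero_mem' := fun A _ _ B a _ => by
        have h := B.alg.act_smul (n := n) 0 0 a
        rw [zero_smul, zero_smul] at h
        rw [h]; exact Submodule.zero_mem _
      smul_mem' := fun c p hp A _ _ B a ha => by
        rw [B.alg.act_smul]; exact Submodule.smul_mem _ c (hp A B a ha) }
  one_mem := fun A _ _ B a ha => by rw [B.alg.act_one]; exact ha 0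
  comp_mem := fun k _ h p r hp hr A _ _ B a ha => by
    rw [B.alg.act_comp]
    exact hp A B _ (fun i => hr i A B _ (fun j => ha _))
  perm_mem := fun σ p hp A _ _ B a ha => by
    rw [B.alg.act_perm]; exact hp A B _ (fun i => ha _)

end Bialgebras

/-! ## Good triples -/

section GoodTriple

variable {K : Type u} [Field K] {A : Type u} [AddCommGroup A] [Module K A]

/-- The space of primitive elements. -/
def SymBialgOne.prim (B : SymBialgOne K A) : Submodule K A := LinearMap.ker B.δ

/-- The primitive elements form an algebra over the primitive operad. -/
def SymBialgOne.primAlg (B : SymBialgOne K A) : (symPRIM K).toOperad.Algebra B.prim :=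
  B.alg.toAlgebra.restrictSub (symPRIM K).toSuboperad B.prim (fun p hp a ha => hp A B a ha)

/-- Isomorphic bialgebras of type `1`. -/
def SymBialgOne.IsIso (B : SymBialgOne K A) {A' : Type u} [AddCommGroup A'] [Module K A']
    (B' : SymBialgOne K A') : Prop :=
  ∃ e : A ≃ₗ[K] A', B.alg.toAlgebra.IsHom B'.alg.toAlgebra e.toLinearMap ∧
    IsCoalgHom B.δ B'.δ e.toLinearMap

/-- `j : V → F` is the free `P_↗^Σ`-algebra generated by the vector space `V`. -/
def IsFreeAlgebra {V F : Type u} [AddCommGroup V] [Module K V] [AddCommGroup F] [Module K F]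
    (φ : (symGraft K).Algebra F) (j : V →ₗ[K] F) : Prop :=
  ∀ (E : Type u) [AddCommGroup E] [Module K E] (ε : (symGraft K).Algebra E) (f : V →ₗ[K] E),
    ∃! g : F →ₗ[K] E, φ.toAlgebra.IsHom ε.toAlgebra g ∧ g ∘ₗ j = f

/-- `j : L → U` is the universal enveloping `P_↗^Σ`-algebra of the algebra `L` over the primitive
operad: `L ↦ U(L)` is left adjoint to the restriction of algebra structures. -/
def IsEnveloping {L U : Type u} [AddCommGroup L] [Module K L] [AddCommGroup U] [Module K U]
    (lam : (symPRIM K).toOperad.Algebra L) (υ : (symGraft K).Algebra U) (j : L →ₗ[K] U) : Prop :=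
  lam.IsHom (υ.toAlgebra.restrict (symPRIM K).toSuboperad) j ∧
  ∀ (E : Type u) [AddCommGroup E] [Module K E] (ε : (symGraft K).Algebra E) (f : L →ₗ[K] E),
    lam.IsHom (ε.toAlgebra.restrict (symPRIM K).toSuboperad) f →
      ∃! g : U →ₗ[K] E, υ.toAlgebra.IsHom ε.toAlgebra g ∧ g ∘ₗ j = f

/-- `B` is isomorphic, as a bialgebra, to the enveloping algebra `U(Prim(B))`, the coproduct of
the latter being the one for which the elements of `Prim(B)` are primitive. -/
def IsEnvelopingOfPrim (B : SymBialgOne K A) : Prop :=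
  ∃ (U : Type u) (_ : AddCommGroup U) (_ : Module K U) (BU : SymBialgOne K U)
    (j : B.prim →ₗ[K] U), IsEnveloping B.primAlg BU.alg j ∧ (∀ x, BU.δ (j x) = 0) ∧ B.IsIso BU

/-- `(Ass, P_↗^Σ, 𝒫)` is a good triple of operads, for the bialgebras of type `1`:
* the primitive operad is isomorphic to `𝒫`;
* the free `P_↗^Σ`-algebra over any vector space `V` is in a unique way a bialgebra in which the
  elements of `V` are primitive;
* the structure theorem holds: for every bialgebra `B`, it is equivalent that `B` is connected,
  that `B` is isomorphic to `U(Prim(B))`, and that `B` is cofree over `Prim(B)` among connected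
  coassociative coalgebras. -/
def IsGoodTriple (Pr : SymOperad K) : Prop :=
  SymOperad.IsIso Pr (symPRIM K).toSymOperad ∧
  (∀ (V F : Type u) [AddCommGroup V] [Module K V] [AddCommGroup F] [Module K F]
    (φ : (symGraft K).Algebra F) (j : V →ₗ[K] F), IsFreeAlgebra φ j →
      ∃! B : SymBialgOne K F, B.alg = φ ∧ ∀ v, B.δ (j v) = 0) ∧
  ∀ (A : Type u) [AddCommGroup A] [Module K A] (B : SymBialgOne K A),
    [IsConnectedCoalg B.δ,
      IsEnvelopingOfPrim B,
      ∃ π : A →ₗ[K] B.prim, IsCofreeConnected B.δ π].TFAE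

end GoodTriple

/-! ## The infinitesimal Hopf algebra of planar forests -/

/-- Planar rooted forests: `nil` is the empty forest `1`, and `cons G F` is `B⁺(G) F`, the forest
whose first tree is obtained by grafting the trees of `G` on a common root. -/
inductive PForest : Type
  | nil : PForest
  | cons : PForest → PForest → PForest

namespace PForest

/-- Concatenation. -/
def append : PForest → PForest → PForest
  | nil, H => H
  | cons G F, H => cons G (append F H)

/-- `F ↗ G`: grafting of `F` on the leftmost leaf of `G`. -/
def graft (F : PForest) : PForest → PForest
  | nil => F
  | cons G H => cons (graft F G) H

/-- The vertices of `B⁺(G) F`: the root `inl none`, the vertices of `G`, the vertices of `F`. -/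
def Vert : PForest → Type
  | nil => Empty
  | cons G F => Option (Vert G) ⊕ Vert F

@[reducible] def vertFintype : ∀ F : PForest, Fintype (Vert F)
  | nil => inferInstanceAs (Fintype Empty)
  | cons G F =>
    letI := vertFintype G
    letI := vertFintype F
    inferInstanceAs (Fintype (Option (Vert G) ⊕ Vert F))

instance (F : PForest) : Fintype (Vert F) := vertFintype F

/-- `s ≥_high s'`: there is a path going up from `s'` to `s`. -/
def GeHigh : ∀ F : PForest, Vert F → Vert F → Prop
  | cons _ _, .inl _, .inl none => True
  | cons G _, .inl (some a), .inl (some b) => GeHigh G a b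
  | cons _ F, .inr a, .inr b => GeHigh F a b
  | cons _ _, _, _ => False

/-- `s ≥_left s'`: `s` and `s'` are not comparable for `≥_high` and `s` is more on the left. -/
def GeLeft : ∀ F : PForest, Vert F → Vert F → Prop
  | cons _ _, .inl _, .inr _ => True
  | cons G _, .inl (some a), .inl (some b) => GeLeft G a b
  | cons _ F, .inr a, .inr b => GeLeft F a b
  | cons _ _, _, _ => False

/-- A cut, recorded by the set `S` of the vertices over it, is left-admissible (possibly empty or
total): `S` is stable under going up (admissibility) and under going left. -/
def IsLeftAdm (F : PForest) (S : Set (Vert F)) : Prop :=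
  ∀ x ∈ S, ∀ y, GeHigh F y x ∨ GeLeft F y x → y ∈ S

open scoped Classical in
/-- The planar forest formed by the vertices of `F` in `S`. -/
def sub : ∀ F : PForest, Set (Vert F) → PForest
  | nil, _ => nil
  | cons G F, S =>
    if (Sum.inl none : Option (Vert G) ⊕ Vert F) ∈ S then
      cons (sub G {v | (Sum.inl (some v) : Option (Vert G) ⊕ Vert F) ∈ S})
        (sub F {v | (Sum.inr v : Option (Vert G) ⊕ Vert F) ∈ S})
    else
      append (sub G {v | (Sum.inl (some v) : Option (Vert G) ⊕ Vert F) ∈ S})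
        (sub F {v | (Sum.inr v : Option (Vert G) ⊕ Vert F) ∈ S})

end PForest

section ForestAlgebra

variable (K : Type u) [Field K]

/-- The space `H` with basis the planar forests. -/
abbrev HForest := PForest →₀ K

variable {K}

/-- The basis element given by a forest. -/
def ofForest (F : PForest) : HForest K := Finsupp.single F 1

/-- Bilinear extension to `H` of an operation on forests. -/
def bilinExt (f : PForest → PForest → PForest) : HForest K →ₗ[K] HForest K →ₗ[K] HForest K :=
  Finsupp.linearCombination K
    (fun F => Finsupp.linearCombination K (fun G => ofForest (f F G)))

/-- The product of `H`. -/
def mulH : HForest K →ₗ[K] HForest K →ₗ[K] HForest K := bilinExt PForest.append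

/-- The product `↗` of `H`. -/
def graftH : HForest K →ₗ[K] HForest K →ₗ[K] HForest K := bilinExt PForest.graft

open scoped Classical in
/-- The coproduct of `H`: the sum of `P^c(F) ⊗ R^c(F)` over the left-admissible cuts `c` of `F`,
the empty cut giving `1 ⊗ F` and the total cut giving `F ⊗ 1`. -/
def coprodH : HForest K →ₗ[K] HForest K ⊗[K] HForest K :=
  Finsupp.linearCombination K (fun F =>
    ∑ S : Set (PForest.Vert F) with PForest.IsLeftAdm F S,
      ofForest (PForest.sub F S) ⊗ₜ[K] ofForest (PForest.sub F Sᶜ))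

variable (K) in
/-- The primitive elements of `H`: `Δ(x) = x ⊗ 1 + 1 ⊗ x`. -/
def primH : Submodule K (HForest K) :=
  LinearMap.eqLocus coprodH
    ((TensorProduct.mk K (HForest K) (HForest K)).flip (ofForest PForest.nil) +
      TensorProduct.mk K (HForest K) (HForest K) (ofForest PForest.nil))

/-- Planar binary trees. -/
inductive BinTree : Type
  | leaf : BinTree
  | node : BinTree → BinTree → BinTree

/-- The elements `p_t`: the leaf gives the one-vertex tree, and
`p_{t₁ ∨ t₂} = p_{t₁} p_{t₂} - p_{t₁} ↗ p_{t₂}`. -/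
def pElem : BinTree → HForest K
  | .leaf => ofForest (.cons .nil .nil)
  | .node t₁ t₂ => mulH (pElem t₁) (pElem t₂) - graftH (pElem t₁) (pElem t₂)

end ForestAlgebra

end

end ForestOperads

/-!
Write `∘ = ↗ - m`. In a bialgebra of type `1` both products satisfy `δ(p * q) = p ⊗ q` for primitive
`p`, `q`, so that `p ∘ q` is primitive. The theorem says that `∘` is, in every respect, the only
source of primitive elements, and the proof is a comparison of `P_↗`-bialgebras with words.

*From a connected bialgebra to words.* The recursion `e(x) = x - e(x') x''` (`IsPrimProj`) defines a
projection on the primitive elements which kills all products `p y` with `p` primitive. Hence a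
connected bialgebra is the space of words in its primitive elements (`InfCompat.mem_of_prim`), with
deconcatenation as coproduct: it is cofree (`InfCompat.exists_isCofreeConnected`), and a linear map
defined on the primitive elements extends to a morphism for `m` (`InfCompat.exists_extension`). The
product `↗` is determined by `m` and by `∘` on primitive elements, because for a primitive `a`
`a ↗ (b w) = (a ∘ b) w + a b w` and `(a w) ↗ y = a ↗ (w ↗ y) - (a ∘ w) ↗ y`, where `a ∘ w` lies as low
in the filtration as `w`. So this extension respects `↗` as soon as the linear map respects `∘`
(`IsGraftPair.map_up`). This is the structure theorem `SymBialgOne.structure_tfae`. The coproduct of a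
free algebra `A` comes from a product on `A × (A ⊗ A)` for which `x ↦ (x, δ x)` is a morphism exactly
when `δ` is compatible with the products (`infExt`, `IsFreeAlgebra.existsUnique_bialg`).

*From words to a bialgebra.* Conversely the two formulas above define, for an arbitrary magma `X`, a
product `↗` on the words in `X` which, with concatenation and deconcatenation, gives a bialgebra
(`wordBialg`). Its primitive elements are the combinations of letters.

*The primitive operations.* The same formulas, read in the operad, show that `P_↗(n)` is spanned by
the products `t₁ ⋯ t_r` of iterations of `∘` along binary trees with `n` leaves altogether
(`mem_wordOpSpan`). At the letters of a free magma these products take distinct words as values, so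
they are a basis; and as the value of a primitive operation is a combination of letters, such an
operation is a combination of single trees. The morphism from the free operad on one binary operation
to the primitive operations which sends the generator to `∘` is therefore bijective, in arity `n` and
in the symmetrised version (`injective_and_le_range`, `toPRIM_bijective`, `toSymPRIM_bijective`).

*The forests.* When `X` is the magma of the binary trees, that is the free magma on one generator, the
words in `X` are the algebra `H` of forests, the letter `t` being sent to `± p_t` (`wordToForest`). A
left-admissible cut of a forest `B⁺(G) F`, where `B⁺(G)` is the tree whose root carries the forest `G`,
is either a cut of `G` or the whole tree `B⁺(G)` with a cut of `F`. This recursion for the coproduct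
(`coprodH_consH`) gives its compatibility with both products of `H`, so that `wordToForest` carries
deconcatenation to the coproduct of `H` and letters to a basis of the primitive elements
(`pElem_basis`).
-/

namespace ForestOperads

noncomputable section

/-! ### Blocks -/

/-- The position of the `j`-th element of the `i`-th block: the blocks are laid out in order. -/
theorem block_val {n : ℕ} (k : Fin n → ℕ) {N : ℕ} (h : ∑ i, k i = N) (i : Fin n) (j : Fin (k i)) :
    (block k h ⟨i, j⟩ : ℕ) = (∑ i', if i' < i then k i' else 0) + j := by
  have : (block k h ⟨i, j⟩ : ℕ) = (finSigmaFinEquiv (⟨i, j⟩ : Σ i, Fin (k i)) : ℕ) := rfl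
  rw [this, finSigmaFinEquiv_apply, Nat.add_right_cancel_iff, ← Finset.sum_filter]
  refine Finset.sum_bij (fun a _ => Fin.castLE i.2.le a) ?_ ?_ ?_ ?_
  · intro a _
    simp only [Finset.mem_filter, Finset.mem_univ, true_and]
    exact Fin.lt_def.mpr a.2
  · intro a _ b _ hab
    exact Fin.castLE_injective _ hab
  · intro b hb
    simp only [Finset.mem_filter, Finset.mem_univ, true_and] at hb
    exact ⟨⟨b, hb⟩, Finset.mem_univ _, rfl⟩
  · intro a _; rfl

theorem prefix_add_le {n : ℕ} (k : Fin n → ℕ) {i i' : Fin n} (hi : i' < i) :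
    (∑ a, if a < i' then k a else 0) + k i' ≤ ∑ a, if a < i then k a else 0 := by
  have : k i' = ∑ a, if a = i' then k a else 0 := by simp
  rw [this, ← Finset.sum_add_distrib]
  refine Finset.sum_le_sum fun a _ => ?_
  rcases lt_trichotomy a i' with h | h | h
  · simp [h, h.ne, h.trans hi]
  · simp [h, hi]
  · simp [h.not_gt, h.ne']

theorem block_lt_iff {n : ℕ} (k : Fin n → ℕ) {N : ℕ} (h : ∑ i, k i = N) (i i' : Fin n)
    (j : Fin (k i)) (j' : Fin (k i')) :
    block k h ⟨i', j'⟩ < block k h ⟨i, j⟩ ↔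
      i' < i ∨ (i' = i ∧ (j' : ℕ) < j) := by
  rw [Fin.lt_def, block_val, block_val]
  rcases lt_trichotomy i' i with hi | hi | hi
  · have := prefix_add_le k hi
    have := j'.2
    simp only [hi, true_or, iff_true]
    omega
  · subst hi; simp
  · have := prefix_add_le k hi
    have := j.2
    simp only [hi.not_gt, hi.ne', false_and, or_false, iff_false]
    omega

/-- Concatenating blocks of blocks does not depend on the bracketing. -/
theorem block_block {n : ℕ} (k : Fin n → ℕ) {N : ℕ} (h : ∑ i, k i = N)
    (l : Fin N → ℕ) {T : ℕ} (hl : ∑ s, l s = T)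
    (M : Fin n → ℕ) (hM : ∀ i, ∑ j, l (block k h ⟨i, j⟩) = M i) (hT : ∑ i, M i = T)
    (i : Fin n) (j : Fin (k i)) (s : Fin (l (block k h ⟨i, j⟩))) :
    block M hT ⟨i, block _ (hM i) ⟨j, s⟩⟩ = block l hl ⟨block k h ⟨i, j⟩, s⟩ := by
  apply Fin.ext
  rw [block_val, block_val, block_val, ← add_assoc]
  congr 1
  rw [← (block k h).sum_comp, Fintype.sum_sigma]
  have : ∀ i' : Fin n, (∑ j', if block k h ⟨i', j'⟩ < block k h ⟨i, j⟩ then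
      l (block k h ⟨i', j'⟩) else 0) = (if i' < i then M i' else 0) +
      if i' = i then (∑ j', if j' < j then l (block k h ⟨i, j'⟩) else 0) else 0 := by
    intro i'
    simp only [block_lt_iff]
    rcases lt_trichotomy i' i with hi | hi | hi
    · simp [hi, hi.ne, hM]
    · subst hi; simp
    · simp [hi.not_gt, hi.ne']
  simp only [this, Finset.sum_add_distrib]
  simp

theorem blockPerm_symm_block {n : ℕ} (σ : Equiv.Perm (Fin n)) (k : Fin n → ℕ) {N : ℕ}
    (h' : ∑ i, k (σ i) = N) (h : ∑ i, k i = N) (i : Fin n) (j : Fin (k (σ i))) :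
    (blockPerm σ k h' h).symm (block k h ⟨σ i, j⟩) = block (fun i => k (σ i)) h' ⟨i, j⟩ := by
  rw [Equiv.symm_apply_eq]
  simp [blockPerm]

theorem blockSum_symm_block {n : ℕ} (k : Fin n → ℕ) {N : ℕ} (h : ∑ i, k i = N)
    (τ : ∀ i, Equiv.Perm (Fin (k i))) (i : Fin n) (j : Fin (k i)) :
    (blockSum k h τ).symm (block k h ⟨i, j⟩) = block k h ⟨i, (τ i).symm j⟩ := by
  rw [Equiv.symm_apply_eq]
  simp [blockSum]

theorem update_block {A : Type*} {n : ℕ} (k : Fin n → ℕ) {N : ℕ} (h : ∑ i, k i = N) (a : Fin N → A)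
    (i : Fin n) (j : Fin (k i)) (x : A) (i' : Fin n) :
    (fun j' => Function.update a (block k h ⟨i, j⟩) x (block k h ⟨i', j'⟩)) =
      Function.update (β := fun i => Fin (k i) → A) (fun i j => a (block k h ⟨i, j⟩)) i
        (Function.update (fun j => a (block k h ⟨i, j⟩)) j x) i' := by
  funext j'
  by_cases hi : i' = i
  · subst hi
    by_cases hj : j' = j
    · subst hj; simp
    · rw [Function.update_self, Function.update_of_ne hj, Function.update_of_ne]
      simpa using hj
  · rw [Function.update_of_ne hi, Function.update_of_ne]
    rintro h
    exact hi (congrArg Sigma.fst ((block k _).injective h))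

/-! ### The endomorphism operad -/

section Endomorphisms

variable {K : Type u} [Field K] {A : Type u} [AddCommGroup A] [Module K A]

/-- Composition of multilinear maps. -/
def endComp {n : ℕ} (k : Fin n → ℕ) {N : ℕ} (h : ∑ i, k i = N)
    (p : MultilinearMap K (fun _ : Fin n => A) A)
    (r : ∀ i, MultilinearMap K (fun _ : Fin (k i) => A) A) :
    MultilinearMap K (fun _ : Fin N => A) A where
  toFun a := p (fun i => r i (fun j => a (block k h ⟨i, j⟩)))
  map_update_add' {inst} a s x y := by
    obtain rfl : inst = instDecidableEqFin N := Subsingleton.elim _ _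
    obtain ⟨⟨i, j⟩, rfl⟩ := (block k h).surjective s
    have key : ∀ z : A, (fun i' => r i' (fun j' => Function.update a (block k h ⟨i, j⟩) z
        (block k h ⟨i', j'⟩))) =
        Function.update (fun i' => r i' (fun j' => a (block k h ⟨i', j'⟩))) i
          (r i (Function.update (fun j => a (block k h ⟨i, j⟩)) j z)) := by
      intro z
      funext i'
      rw [update_block]
      exact Function.apply_update (fun i (b : Fin (k i) → A) => r i b) _ i _ i'
    simp only [key, MultilinearMap.map_update_add]
  map_update_smul' {inst} a s c x := by
    obtain rfl : inst = instDecidableEqFin N := Subsingleton.elim _ _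
    obtain ⟨⟨i, j⟩, rfl⟩ := (block k h).surjective s
    have key : ∀ z : A, (fun i' => r i' (fun j' => Function.update a (block k h ⟨i, j⟩) z
        (block k h ⟨i', j'⟩))) =
        Function.update (fun i' => r i' (fun j' => a (block k h ⟨i', j'⟩))) i
          (r i (Function.update (fun j => a (block k h ⟨i, j⟩)) j z)) := by
      intro z
      funext i'
      rw [update_block]
      exact Function.apply_update (fun i (b : Fin (k i) → A) => r i b) _ i _ i'
    simp only [key, MultilinearMap.map_update_smul]

@[simp] theorem endComp_apply {n : ℕ} (k : Fin n → ℕ) {N : ℕ} (h : ∑ i, k i = N)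
    (p : MultilinearMap K (fun _ : Fin n => A) A)
    (r : ∀ i, MultilinearMap K (fun _ : Fin (k i) => A) A) (a : Fin N → A) :
    endComp k h p r a = p (fun i => r i (fun j => a (block k h ⟨i, j⟩))) := rfl

theorem apply_update_apply {n : ℕ} (k : Fin n → ℕ)
    (r : ∀ i, MultilinearMap K (fun _ : Fin (k i) => A) A) (i : Fin n)
    (x : MultilinearMap K (fun _ : Fin (k i) => A) A) (b : ∀ i, Fin (k i) → A) :
    (fun i' => Function.update r i x i' (b i')) =
      Function.update (fun i' => r i' (b i')) i (x (b i)) := by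
  funext i'
  exact Function.apply_update (fun i (f : MultilinearMap K (fun _ : Fin (k i) => A) A) => f (b i))
    r i x i'

theorem block_ones {n : ℕ} (h : ∑ _i : Fin n, 1 = n) (i : Fin n) (j : Fin 1) :
    block (fun _ => 1) h ⟨i, j⟩ = i := by
  apply Fin.ext
  rw [block_val]
  have : (∑ a : Fin n, if a < i then 1 else 0) = (i : ℕ) := by
    rw [← Finset.sum_filter, Finset.filter_gt_eq_Iio]; simp
  rw [this]; omega

theorem block_single {n : ℕ} (h : ∑ _i : Fin 1, n = n) (i : Fin 1) (j : Fin n) :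
    block (fun _ => n) h ⟨i, j⟩ = j := by
  apply Fin.ext
  rw [block_val]
  simp [Subsingleton.elim _ i]

variable (K A) in
/-- The endomorphism operad of a vector space `A`: its operations of arity `n` are the
multilinear maps `Aⁿ → A`. -/
def endOperad : SymOperad K where
  obj n := MultilinearMap K (fun _ : Fin n => A) A
  one := LinearMap.id.compMultilinearMap (MultilinearMap.ofSubsingleton K A A 0 LinearMap.id)
  comp k _ h p r := endComp k h p r
  comp_add k _ h p q r := by ext; simp
  comp_smul k _ h c p r := by ext; simp
  comp_update_add k _ h p r i x y := by
    ext a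
    simp only [endComp_apply, apply_update_apply, _root_.add_apply,
      MultilinearMap.map_update_add]
  comp_update_smul k _ h p r i c x := by
    ext a
    simp only [endComp_apply, apply_update_apply, _root_.smul_apply,
      MultilinearMap.map_update_smul]
  comp_one h p := by
    ext a
    exact congrArg p (funext fun i => congrArg a (block_ones h i 0))
  one_comp h p := by
    ext a
    exact congrArg p (funext fun j => congrArg a (block_single h 0 j))
  assoc k _ h l _ hl M hM hT p q r := by
    ext a
    exact congrArg p (funext fun i => congrArg (q i) (funext fun j => congrArg (r _)
      (funext fun s => congrArg a (block_block k h l hl M hM hT i j s).symm)))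
  perm σ p := p.domDomCongr σ.symm
  perm_add σ p q := rfl
  perm_smul σ c p := rfl
  perm_one p := by ext; rfl
  perm_mul σ τ p := by ext; rfl
  perm_comp σ k _ h' h p r := by
    ext a
    simp only [endComp_apply, MultilinearMap.domDomCongr_apply]
    congr 1
    funext i'
    obtain ⟨i, rfl⟩ := σ.surjective i'
    refine (congrArg (fun i => r (σ i) (fun j => a (block (fun i => k (σ i)) h' ⟨i, j⟩)))
      (σ.symm_apply_apply i)).trans ?_
    exact congrArg (r (σ i)) (funext fun j =>
      congrArg a (blockPerm_symm_block σ k h' h i j).symm)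
  comp_perm k _ h p τ r := by
    ext a
    exact congrArg p (funext fun i => congrArg (r i) (funext fun j =>
      congrArg a (blockSum_symm_block k h τ i j).symm))

end Endomorphisms

/-! ### Morphisms out of presented operads -/

section Presented

variable {K : Type u} [Field K] {G : ℕ → Type u}

/-- The value in an operad `Q` of a formal expression, given values of the generators. -/
def Pre.eval (Q : NSOperad K) (g : ∀ n, G n → Q.obj n) : ∀ {n : ℕ}, Pre K G n → Q.obj n
  | _, .gen x => g _ x
  | _, .one => Q.one
  | _, .zero => 0
  | _, .add x y => x.eval Q g + y.eval Q g
  | _, .smul c x => c • x.eval Q g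
  | _, .comp k h p r => Q.comp k h (p.eval Q g) (fun i => (r i).eval Q g)

theorem Pre.eval_update (Q : NSOperad K) (g : ∀ n, G n → Q.obj n) {n : ℕ} (k : Fin n → ℕ)
    (r : ∀ i, Pre K G (k i)) (i : Fin n) (x : Pre K G (k i)) :
    (fun j => (Function.update r i x j).eval Q g) =
      Function.update (fun j => (r j).eval Q g) i (x.eval Q g) := by
  funext j
  exact Function.apply_update (fun j (y : Pre K G (k j)) => y.eval Q g) r i x j

theorem PreRel.eval_eq {R : ∀ n, Pre K G n → Pre K G n → Prop} (Q : NSOperad K)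
    (g : ∀ n, G n → Q.obj n) (hg : ∀ n x y, R n x y → x.eval Q g = y.eval Q g)
    {n : ℕ} {x y : Pre K G n} (h : PreRel R n x y) : x.eval Q g = y.eval Q g := by
  induction h with
  | of h => exact hg _ _ _ h
  | refl x => rfl
  | symm _ ih => exact ih.symm
  | trans _ _ ih ih' => exact ih.trans ih'
  | add_congr _ _ ih ih' => simp only [Pre.eval, ih, ih']
  | smul_congr c _ ih => simp only [Pre.eval, ih]
  | comp_congr k h _ _ ih ih' => simp only [Pre.eval, ih, ih']
  | add_comm x y => exact _root_.add_comm _ _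
  | add_assoc x y z => exact _root_.add_assoc _ _ _
  | zero_add x => exact _root_.zero_add _
  | smul_add c x y => exact _root_.smul_add _ _ _
  | add_smul c d x => exact _root_.add_smul _ _ _
  | mul_smul c d x => exact SemigroupAction.mul_smul _ _ _
  | one_smul x => exact _root_.one_smul _ _
  | zero_smul x => exact _root_.zero_smul _ _
  | smul_zero c => exact _root_.smul_zero _
  | comp_add k h p q r => exact Q.comp_add _ _ _ _ _
  | comp_smul k h c p r => exact Q.comp_smul _ _ _ _ _
  | comp_update_add k h p r i x y =>
    simp only [Pre.eval, Pre.eval_update]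
    exact Q.comp_update_add _ _ _ _ _ _ _
  | comp_update_smul k h p r i c x =>
    simp only [Pre.eval, Pre.eval_update]
    exact Q.comp_update_smul _ _ _ _ _ _ _
  | comp_one h p => exact Q.comp_one _ _
  | one_comp h p => exact Q.one_comp _ _
  | assoc k h l hl M hM hT p q r => exact Q.assoc _ _ _ _ _ _ _ _ _ _

namespace NSOperad

variable (R : ∀ n, Pre K G n → Pre K G n → Prop)

theorem presented_mk_comp {n : ℕ} (k : Fin n → ℕ) {N : ℕ} (h : ∑ i, k i = N) (p : Pre K G n)
    (r : ∀ i, Pre K G (k i)) :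
    PreQuot.mk R (Pre.comp k h p r) =
      (presented R).comp k h (PreQuot.mk R p) (fun i => PreQuot.mk R (r i)) :=
  (PreQuot.sound R (.comp_congr k h (PreQuot.out_mk R _) fun _ => PreQuot.out_mk R _)).symm

theorem presented_mk_add {n : ℕ} (x y : Pre K G n) :
    PreQuot.mk R (x.add y) = PreQuot.mk R x + PreQuot.mk R y :=
  (PreQuot.sound R (.add_congr (PreQuot.out_mk R _) (PreQuot.out_mk R _))).symm

theorem presented_mk_smul {n : ℕ} (c : K) (x : Pre K G n) :
    PreQuot.mk R (x.smul c) = c • PreQuot.mk R x :=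
  (PreQuot.sound R (.smul_congr c (PreQuot.out_mk R _))).symm

/-- Induction on the elements of a presented operad. -/
theorem presented_induction {motive : ∀ n, (presented R).obj n → Prop}
    (gen : ∀ {n} (x : G n), motive n (PreQuot.mk R (.gen x)))
    (one : motive 1 (presented R).one)
    (zero : ∀ {n}, motive n 0)
    (add : ∀ {n} (x y : (presented R).obj n), motive n x → motive n y → motive n (x + y))
    (smul : ∀ {n} (c : K) (x : (presented R).obj n), motive n x → motive n (c • x))
    (comp : ∀ {n : ℕ} (k : Fin n → ℕ) {N : ℕ} (h : ∑ i, k i = N) (p : (presented R).obj n)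
      (r : ∀ i, (presented R).obj (k i)), motive n p → (∀ i, motive (k i) (r i)) →
      motive N ((presented R).comp k h p r))
    {n : ℕ} (p : (presented R).obj n) : motive n p := by
  have key : ∀ {n : ℕ} (x : Pre K G n), motive n (PreQuot.mk R x) := by
    intro n x
    induction x with
    | gen x => exact gen x
    | one => exact one
    | zero => exact zero
    | add x y ihx ihy => rw [presented_mk_add]; exact add _ _ ihx ihy
    | smul c x ih => rw [presented_mk_smul]; exact smul _ _ ih
    | comp k h p r ihp ihr => rw [presented_mk_comp]; exact comp _ _ _ _ ihp ihr
  rw [← PreQuot.mk_out R p]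
  exact key _

/-- The universal property of a presented operad. -/
def presentedLift (Q : NSOperad K) (g : ∀ n, G n → Q.obj n)
    (hg : ∀ n x y, R n x y → x.eval Q g = y.eval Q g) : Hom (presented R) Q where
  map n :=
    { toFun := fun p => (PreQuot.out R p).eval Q g
      map_add' := fun x y => PreRel.eval_eq Q g hg (PreQuot.out_mk R _)
      map_smul' := fun c x => PreRel.eval_eq Q g hg (PreQuot.out_mk R _) }
  map_one := PreRel.eval_eq Q g hg (PreQuot.out_mk R _)
  map_comp k _ h p r := PreRel.eval_eq Q g hg (PreQuot.out_mk R _)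

theorem presentedLift_mk (Q : NSOperad K) (g : ∀ n, G n → Q.obj n)
    (hg : ∀ n x y, R n x y → x.eval Q g = y.eval Q g) {n : ℕ} (x : Pre K G n) :
    (presentedLift R Q g hg).map n (PreQuot.mk R x) = x.eval Q g :=
  PreRel.eval_eq Q g hg (PreQuot.out_mk R _)

theorem Hom.ext_map {P Q : NSOperad K} {φ ψ : Hom P Q} (h : ∀ n p, φ.map n p = ψ.map n p) :
    φ = ψ := by
  have : φ.map = ψ.map := funext fun n => LinearMap.ext (h n)
  cases φ; cases ψ; congr

theorem presented_hom_ext {Q : NSOperad K} {φ ψ : Hom (presented R) Q}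
    (h : ∀ n (x : G n), φ.map n (PreQuot.mk R (.gen x)) = ψ.map n (PreQuot.mk R (.gen x))) :
    φ = ψ := by
  refine Hom.ext_map fun n p => ?_
  induction p using presented_induction with
  | gen x => exact h _ x
  | one => rw [φ.map_one, ψ.map_one]
  | zero => rw [map_zero, map_zero]
  | add x y hx hy => rw [map_add, map_add, hx, hy]
  | smul c x hx => rw [map_smul, map_smul, hx]
  | comp k h p r hp hr => rw [φ.map_comp, ψ.map_comp, hp]; simp only [hr]

end NSOperad

/-- The value in an operad `Q` of a formal expression, given values of the generators. -/
def SPre.eval (Q : SymOperad K) (g : ∀ n, G n → Q.obj n) : ∀ {n : ℕ}, SPre K G n → Q.obj n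
  | _, .gen x => g _ x
  | _, .one => Q.one
  | _, .zero => 0
  | _, .add x y => x.eval Q g + y.eval Q g
  | _, .smul c x => c • x.eval Q g
  | _, .comp k h p r => Q.comp k h (p.eval Q g) (fun i => (r i).eval Q g)
  | _, .perm σ x => Q.perm σ (x.eval Q g)

theorem SPre.eval_update (Q : SymOperad K) (g : ∀ n, G n → Q.obj n) {n : ℕ} (k : Fin n → ℕ)
    (r : ∀ i, SPre K G (k i)) (i : Fin n) (x : SPre K G (k i)) :
    (fun j => (Function.update r i x j).eval Q g) =
      Function.update (fun j => (r j).eval Q g) i (x.eval Q g) := by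
  funext j
  exact Function.apply_update (fun j (y : SPre K G (k j)) => y.eval Q g) r i x j

theorem SPreRel.eval_eq {R : ∀ n, SPre K G n → SPre K G n → Prop} (Q : SymOperad K)
    (g : ∀ n, G n → Q.obj n) (hg : ∀ n x y, R n x y → x.eval Q g = y.eval Q g)
    {n : ℕ} {x y : SPre K G n} (h : SPreRel R n x y) : x.eval Q g = y.eval Q g := by
  induction h with
  | of h => exact hg _ _ _ h
  | refl x => rfl
  | symm _ ih => exact ih.symm
  | trans _ _ ih ih' => exact ih.trans ih'
  | add_congr _ _ ih ih' => simp only [SPre.eval, ih, ih']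
  | smul_congr c _ ih => simp only [SPre.eval, ih]
  | comp_congr k h _ _ ih ih' => simp only [SPre.eval, ih, ih']
  | perm_congr σ _ ih => simp only [SPre.eval, ih]
  | add_comm x y => exact _root_.add_comm _ _
  | add_assoc x y z => exact _root_.add_assoc _ _ _
  | zero_add x => exact _root_.zero_add _
  | smul_add c x y => exact _root_.smul_add _ _ _
  | add_smul c d x => exact _root_.add_smul _ _ _
  | mul_smul c d x => exact SemigroupAction.mul_smul _ _ _
  | one_smul x => exact _root_.one_smul _ _
  | zero_smul x => exact _root_.zero_smul _ _
  | smul_zero c => exact _root_.smul_zero _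
  | comp_add k h p q r => exact Q.comp_add _ _ _ _ _
  | comp_smul k h c p r => exact Q.comp_smul _ _ _ _ _
  | comp_update_add k h p r i x y =>
    simp only [SPre.eval, SPre.eval_update]
    exact Q.comp_update_add _ _ _ _ _ _ _
  | comp_update_smul k h p r i c x =>
    simp only [SPre.eval, SPre.eval_update]
    exact Q.comp_update_smul _ _ _ _ _ _ _
  | comp_one h p => exact Q.comp_one _ _
  | one_comp h p => exact Q.one_comp _ _
  | assoc k h l hl M hM hT p q r => exact Q.assoc _ _ _ _ _ _ _ _ _ _
  | perm_add σ x y => exact Q.perm_add _ _ _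
  | perm_smul σ c x => exact Q.perm_smul _ _ _
  | perm_one x => exact Q.perm_one _
  | perm_mul σ τ x => exact Q.perm_mul _ _ _
  | perm_comp σ k h' h p r => exact Q.perm_comp σ k h' h _ (fun i => (r i).eval Q g)
  | comp_perm k h p τ r => exact Q.comp_perm _ _ _ _ _

namespace SymOperad

variable (R : ∀ n, SPre K G n → SPre K G n → Prop)

theorem presented_mk_comp {n : ℕ} (k : Fin n → ℕ) {N : ℕ} (h : ∑ i, k i = N) (p : SPre K G n)
    (r : ∀ i, SPre K G (k i)) :
    SPreQuot.mk R (SPre.comp k h p r) =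
      (presented R).comp k h (SPreQuot.mk R p) (fun i => SPreQuot.mk R (r i)) :=
  (SPreQuot.sound R (.comp_congr k h (SPreQuot.out_mk R _) fun _ => SPreQuot.out_mk R _)).symm

theorem presented_mk_add {n : ℕ} (x y : SPre K G n) :
    SPreQuot.mk R (x.add y) = SPreQuot.mk R x + SPreQuot.mk R y :=
  (SPreQuot.sound R (.add_congr (SPreQuot.out_mk R _) (SPreQuot.out_mk R _))).symm

theorem presented_mk_smul {n : ℕ} (c : K) (x : SPre K G n) :
    SPreQuot.mk R (x.smul c) = c • SPreQuot.mk R x :=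
  (SPreQuot.sound R (.smul_congr c (SPreQuot.out_mk R _))).symm

theorem presented_mk_perm {n : ℕ} (σ : Equiv.Perm (Fin n)) (x : SPre K G n) :
    SPreQuot.mk R (x.perm σ) = (presented R).perm σ (SPreQuot.mk R x) :=
  (SPreQuot.sound R (.perm_congr σ (SPreQuot.out_mk R _))).symm

/-- Induction on the elements of a presented operad. -/
theorem presented_induction {motive : ∀ n, (presented R).obj n → Prop}
    (gen : ∀ {n} (x : G n), motive n (SPreQuot.mk R (.gen x)))
    (one : motive 1 (presented R).one)
    (zero : ∀ {n}, motive n 0)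
    (add : ∀ {n} (x y : (presented R).obj n), motive n x → motive n y → motive n (x + y))
    (smul : ∀ {n} (c : K) (x : (presented R).obj n), motive n x → motive n (c • x))
    (comp : ∀ {n : ℕ} (k : Fin n → ℕ) {N : ℕ} (h : ∑ i, k i = N) (p : (presented R).obj n)
      (r : ∀ i, (presented R).obj (k i)), motive n p → (∀ i, motive (k i) (r i)) →
      motive N ((presented R).comp k h p r))
    (perm : ∀ {n} (σ : Equiv.Perm (Fin n)) (x : (presented R).obj n), motive n x →
      motive n ((presented R).perm σ x))
    {n : ℕ} (p : (presented R).obj n) : motive n p := by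
  have key : ∀ {n : ℕ} (x : SPre K G n), motive n (SPreQuot.mk R x) := by
    intro n x
    induction x with
    | gen x => exact gen x
    | one => exact one
    | zero => exact zero
    | add x y ihx ihy => rw [presented_mk_add]; exact add _ _ ihx ihy
    | smul c x ih => rw [presented_mk_smul]; exact smul _ _ ih
    | comp k h p r ihp ihr => rw [presented_mk_comp]; exact comp _ _ _ _ ihp ihr
    | perm σ x ih => rw [presented_mk_perm]; exact perm _ _ ih
  rw [← SPreQuot.mk_out R p]
  exact key _

/-- The universal property of a presented operad. -/
def presentedLift (Q : SymOperad K) (g : ∀ n, G n → Q.obj n)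
    (hg : ∀ n x y, R n x y → x.eval Q g = y.eval Q g) : Hom (presented R) Q where
  map n :=
    { toFun := fun p => (SPreQuot.out R p).eval Q g
      map_add' := fun x y => SPreRel.eval_eq Q g hg (SPreQuot.out_mk R _)
      map_smul' := fun c x => SPreRel.eval_eq Q g hg (SPreQuot.out_mk R _) }
  map_one := SPreRel.eval_eq Q g hg (SPreQuot.out_mk R _)
  map_comp k _ h p r := SPreRel.eval_eq Q g hg (SPreQuot.out_mk R _)
  map_perm σ p := SPreRel.eval_eq Q g hg (SPreQuot.out_mk R _)

theorem presentedLift_mk (Q : SymOperad K) (g : ∀ n, G n → Q.obj n)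
    (hg : ∀ n x y, R n x y → x.eval Q g = y.eval Q g) {n : ℕ} (x : SPre K G n) :
    (presentedLift R Q g hg).map n (SPreQuot.mk R x) = x.eval Q g :=
  SPreRel.eval_eq Q g hg (SPreQuot.out_mk R _)

end SymOperad

end Presented

/-! ### Symmetrisation -/

section Symmetrisation

variable {K : Type u} [Field K]

variable (P : NSOperad K)

/-- The canonical morphism from a non-symmetric operad to its symmetrisation. -/
def symmetrisationHom : NSOperad.Hom P (symmetrisation P).toNSOperad where
  map n :=
    { toFun := toSymmetrisation P
      map_add' := fun x y => (SPreQuot.sound _ (.of (.add x y))).trans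
        (SymOperad.presented_mk_add _ _ _)
      map_smul' := fun c x => (SPreQuot.sound _ (.of (.smul c x))).trans
        (SymOperad.presented_mk_smul _ _ _) }
  map_one := SPreQuot.sound _ (.of .one)
  map_comp k _ h p r := (SPreQuot.sound _ (.of (.comp k h p r))).trans
    (SymOperad.presented_mk_comp _ _ _ _ _)

/-- The universal property of the symmetrisation. -/
def symmetrisationLift {Q : SymOperad K} (φ : NSOperad.Hom P Q.toNSOperad) :
    SymOperad.Hom (symmetrisation P) Q :=
  SymOperad.presentedLift (SymmRel P) Q (fun n p => φ.map n p) (by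
    rintro n x y (_ | _ | _ | _)
    · exact φ.map_one
    · exact map_add _ _ _
    · exact map_smul _ _ _
    · exact φ.map_comp _ _ _ _)

theorem symmetrisationLift_toSymmetrisation {Q : SymOperad K} (φ : NSOperad.Hom P Q.toNSOperad)
    {n : ℕ} (p : P.obj n) :
    (symmetrisationLift P φ).map n (toSymmetrisation P p) = φ.map n p :=
  SymOperad.presentedLift_mk _ _ _ _ _

end Symmetrisation

/-! ### Algebras as morphisms to the endomorphism operad -/

section OfHom

variable {K : Type u} [Field K] {A : Type u} [AddCommGroup A] [Module K A]

/-- The algebra structure given by a morphism to the endomorphism operad. -/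
def NSOperad.Algebra.ofHom {P : NSOperad K} (φ : NSOperad.Hom P (endOperad K A).toNSOperad) :
    P.Algebra A where
  act {n} p a := (show MultilinearMap K (fun _ : Fin n => A) A from φ.map n p) a
  act_add p q a := by rw [map_add]; rfl
  act_smul c p a := by rw [map_smul]; rfl
  act_update_add p a i x y := MultilinearMap.map_update_add _ _ _ _ _
  act_update_smul p a i c x := MultilinearMap.map_update_smul _ _ _ _ _
  act_one a := by rw [φ.map_one]; rfl
  act_comp k _ h p r a := by rw [φ.map_comp]; rfl

/-- The algebra structure given by a morphism to the endomorphism operad. -/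
def SymOperad.Algebra.ofHom {P : SymOperad K} (φ : SymOperad.Hom P (endOperad K A)) :
    P.Algebra A where
  toAlgebra := NSOperad.Algebra.ofHom φ.toHom
  act_perm {n} σ p a := by
    change (show MultilinearMap K (fun _ : Fin n => A) A from φ.map n (P.perm σ p)) a = _
    rw [φ.map_perm]; rfl

/-- An algebra over the symmetrisation of `P` is an algebra over `P`. -/
def SymOperad.Algebra.toNS {P : NSOperad K} (α : (symmetrisation P).Algebra A) : P.Algebra A where
  act p a := α.act (toSymmetrisation P p) a
  act_add p q a := by
    rw [← α.act_add]; exact congrArg (fun p => α.act p a) ((symmetrisationHom P).map _ |>.map_add p q)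
  act_smul c p a := by
    rw [← α.act_smul]
    exact congrArg (fun p => α.act p a) ((symmetrisationHom P).map _ |>.map_smul c p)
  act_update_add p a i x y := α.act_update_add _ _ _ _ _
  act_update_smul p a i c x := α.act_update_smul _ _ _ _ _
  act_one a := (congrArg (fun p => α.act p a) (symmetrisationHom P).map_one).trans (α.act_one a)
  act_comp k _ h p r a :=
    (congrArg (fun p => α.act p a) ((symmetrisationHom P).map_comp k h p r)).trans
      (α.act_comp k h _ _ a)

end OfHom

/-! ### Algebras with two products -/

theorem eq_pair {A : Type*} (a : Fin 2 → A) : a = ![a 0, a 1] := by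
  funext i; fin_cases i <;> rfl

section Products

variable {K : Type u} [Field K] {A B : Type u} [AddCommGroup A] [Module K A]
  [AddCommGroup B] [Module K B]

/-- The relations between the two products of a `P_↗`-algebra. -/
structure IsGraftPair (m up : A →ₗ[K] A →ₗ[K] A) : Prop where
  m_up : ∀ x y z, m (up x y) z = up x (m y z)
  m_m : ∀ x y z, m (m x y) z = m x (m y z)
  up_up : ∀ x y z, up (up x y) z = up x (up y z)

/-- A bilinear map as a multilinear map in two variables. -/
def binMultilinear (μ : A →ₗ[K] A →ₗ[K] A) : MultilinearMap K (fun _ : Fin 2 => A) A where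
  toFun a := μ (a 0) (a 1)
  map_update_add' {inst} a i x y := by
    obtain rfl : inst = instDecidableEqFin 2 := Subsingleton.elim _ _
    fin_cases i <;> simp [Function.update]
  map_update_smul' {inst} a i c x := by
    obtain rfl : inst = instDecidableEqFin 2 := Subsingleton.elim _ _
    fin_cases i <;> simp [Function.update]

/-- The values of the two generators of `P_↗` given by two bilinear products. -/
def graftGenVal (m up : A →ₗ[K] A →ₗ[K] A) :
    ∀ n, GraftGen.{u} n → (endOperad K A).obj n
  | _, .m => binMultilinear m
  | _, .up => binMultilinear up

theorem graftGenVal_sound {m up : A →ₗ[K] A →ₗ[K] A} (h : IsGraftPair m up) :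
    ∀ n (x y : Pre K GraftGen n), GraftRel K n x y →
      x.eval (endOperad K A).toNSOperad (graftGenVal m up) =
        y.eval (endOperad K A).toNSOperad (graftGenVal m up) := by
  rintro n x y (_ | _ | _)
  · exact MultilinearMap.ext fun a => h.m_up (a 0) (a 1) (a 2)
  · exact MultilinearMap.ext fun a => h.m_m (a 0) (a 1) (a 2)
  · exact MultilinearMap.ext fun a => h.up_up (a 0) (a 1) (a 2)

open NSOperad

/-- The `P_↗^Σ`-algebra given by two products which satisfy the relations of `P_↗`. -/
def symAlg {m up : A →ₗ[K] A →ₗ[K] A} (h : IsGraftPair m up) : (symGraft K).Algebra A :=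
  .ofHom (symmetrisationLift _ (NSOperad.presentedLift (GraftRel K) _ _ (graftGenVal_sound h)))

theorem symAlg_bin_m {m up : A →ₗ[K] A →ₗ[K] A} (h : IsGraftPair m up) :
    (symAlg h).bin (toSymmetrisation _ (opM K)) = m := by
  have key : (symmetrisationLift (graftOperad K) (presentedLift (GraftRel K) _ _
      (graftGenVal_sound h))).map 2 (toSymmetrisation _ (opM K)) = binMultilinear m :=
    (symmetrisationLift_toSymmetrisation _ _ _).trans (presentedLift_mk _ _ _ _ _)
  exact LinearMap.ext₂ fun x y =>
    congrArg (fun f : MultilinearMap K (fun _ : Fin 2 => A) A => f ![x, y]) key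

theorem symAlg_bin_up {m up : A →ₗ[K] A →ₗ[K] A} (h : IsGraftPair m up) :
    (symAlg h).bin (toSymmetrisation _ (opUp K)) = up := by
  have key : (symmetrisationLift (graftOperad K) (presentedLift (GraftRel K) _ _
      (graftGenVal_sound h))).map 2 (toSymmetrisation _ (opUp K)) = binMultilinear up :=
    (symmetrisationLift_toSymmetrisation _ _ _).trans (presentedLift_mk _ _ _ _ _)
  exact LinearMap.ext₂ fun x y =>
    congrArg (fun f : MultilinearMap K (fun _ : Fin 2 => A) A => f ![x, y]) key

namespace NSOperad

variable {P : NSOperad K}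

theorem Algebra.bin_apply (α : P.Algebra A) (p : P.obj 2) (x y : A) :
    α.bin p x y = α.act p ![x, y] := rfl

theorem block_arities_zero {a b N : ℕ} (h : a + b = N) (j : Fin a) :
    block (arities a b) (sum_arities h) ⟨0, j⟩ = Fin.cast h (Fin.castAdd b j) := by
  apply Fin.ext
  refine (block_val (arities a b) (sum_arities h) 0 j).trans ?_
  simp

theorem block_arities_one {a b N : ℕ} (h : a + b = N) (j : Fin b) :
    block (arities a b) (sum_arities h) ⟨1, j⟩ = Fin.cast h (Fin.natAdd a j) := by
  apply Fin.ext
  refine (block_val (arities a b) (sum_arities h) 1 j).trans ?_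
  simp [arities]

theorem Algebra.act_comp₂ (α : P.Algebra A) {a b N : ℕ} (h : a + b = N) (p : P.obj 2)
    (x : P.obj a) (y : P.obj b) (u : Fin N → A) :
    α.act (P.comp₂ h p x y) u =
      α.bin p (α.act x (fun i => u (Fin.cast h (Fin.castAdd b i))))
        (α.act y (fun i => u (Fin.cast h (Fin.natAdd a i)))) := by
  rw [comp₂, α.act_comp, Algebra.bin_apply, eq_pair (fun i => α.act _ _)]
  simp only [← block_arities_zero h, ← block_arities_one h]
  rfl

theorem presented_mk_comp₂ {G : ℕ → Type u} (R : ∀ n, Pre K G n → Pre K G n → Prop) {a b N : ℕ}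
    (h : a + b = N) (p : Pre K G 2) (x : Pre K G a) (y : Pre K G b) :
    PreQuot.mk R (Pre.comp₂ h p x y) =
      (presented R).comp₂ h (PreQuot.mk R p) (PreQuot.mk R x) (PreQuot.mk R y) := by
  refine (presented_mk_comp R _ _ _ _).trans (congrArg (comp _ _ _ _) (funext fun i => ?_))
  fin_cases i <;> rfl

end NSOperad

theorem graft_m_up : (graftOperad K).comp₂ (b := 1) (N := 3) rfl (opM K) (opUp K)
    (graftOperad K).one =
      (graftOperad K).comp₂ (a := 1) (N := 3) rfl (opUp K) (graftOperad K).one (opM K) := by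
  have := PreQuot.sound (GraftRel K) (.of .m_up)
  rw [presented_mk_comp₂, presented_mk_comp₂] at this
  exact this

theorem graft_m_m : (graftOperad K).comp₂ (b := 1) (N := 3) rfl (opM K) (opM K)
    (graftOperad K).one =
      (graftOperad K).comp₂ (a := 1) (N := 3) rfl (opM K) (graftOperad K).one (opM K) := by
  have := PreQuot.sound (GraftRel K) (.of .m_m)
  rw [presented_mk_comp₂, presented_mk_comp₂] at this
  exact this

theorem graft_up_up : (graftOperad K).comp₂ (b := 1) (N := 3) rfl (opUp K) (opUp K)
    (graftOperad K).one =
      (graftOperad K).comp₂ (a := 1) (N := 3) rfl (opUp K) (graftOperad K).one (opUp K) := by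
  have := PreQuot.sound (GraftRel K) (.of .up_up)
  rw [presented_mk_comp₂, presented_mk_comp₂] at this
  exact this

/-- A relation `p ∘ (q, 1) = r ∘ (1, s)` in the operad, read in an algebra. -/
theorem NSOperad.Algebra.bin_bin {P : NSOperad K} (α : P.Algebra A) {p q r s : P.obj 2}
    (h : P.comp₂ (b := 1) (N := 3) rfl p q P.one = P.comp₂ (a := 1) (N := 3) rfl r P.one s)
    (x y z : A) : α.bin p (α.bin q x y) z = α.bin r x (α.bin s y z) := by
  have := congrArg (fun t => α.act t ![x, y, z]) h
  simp only [Algebra.act_comp₂, α.act_one] at this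
  rw [eq_pair (fun i : Fin 2 => ![x, y, z] (Fin.cast _ (Fin.castAdd 1 i))),
    eq_pair (fun i : Fin 2 => ![x, y, z] (Fin.cast _ (Fin.natAdd 1 i)))] at this
  exact this

theorem NSOperad.Algebra.isGraftPair (α : (graftOperad K).Algebra A) :
    IsGraftPair (α.bin (opM K)) (α.bin (opUp K)) where
  m_up := α.bin_bin graft_m_up
  m_m := α.bin_bin graft_m_m
  up_up := α.bin_bin graft_up_up

/-- A linear map which respects the two products respects all the operations of `P_↗`. -/
theorem NSOperad.Algebra.isHom_of_bin {α : (graftOperad K).Algebra A}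
    {β : (graftOperad K).Algebra B} {g : A →ₗ[K] B}
    (hm : ∀ x y, g (α.bin (opM K) x y) = β.bin (opM K) (g x) (g y))
    (hup : ∀ x y, g (α.bin (opUp K) x y) = β.bin (opUp K) (g x) (g y)) : α.IsHom β g := by
  intro n p
  have hz : ∀ (C : Type u) [AddCommGroup C] [Module K C] (γ : (graftOperad K).Algebra C) {n : ℕ}
      (c : Fin n → C), γ.act 0 c = 0 := fun C _ _ γ n c => by
    have := γ.act_smul 0 0 c
    rwa [zero_smul, zero_smul] at this
  induction p using presented_induction with
  | gen x =>
    intro a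
    cases x with
    | m =>
      have := hm (a 0) (a 1)
      rw [α.bin_apply, β.bin_apply, ← eq_pair a, ← eq_pair (fun i => g (a i))] at this
      exact this
    | up =>
      have := hup (a 0) (a 1)
      rw [α.bin_apply, β.bin_apply, ← eq_pair a, ← eq_pair (fun i => g (a i))] at this
      exact this
  | one => intro a; exact (congrArg g (α.act_one a)).trans (β.act_one (fun i => g (a i))).symm
  | zero => intro a; exact (congrArg g (hz A α a)).trans ((map_zero g).trans (hz B β _).symm)
  | add x y hx hy =>
    intro a
    exact (congrArg g (α.act_add x y a)).trans ((map_add g _ _).trans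
      ((congrArg₂ (· + ·) (hx a) (hy a)).trans (β.act_add x y _).symm))
  | smul c x hx =>
    intro a
    exact (congrArg g (α.act_smul c x a)).trans ((map_smul g _ _).trans
      ((congrArg (c • ·) (hx a)).trans (β.act_smul c x _).symm))
  | comp k h p r hp hr =>
    intro a
    refine (congrArg g (α.act_comp k h p r a)).trans ((hp _).trans ?_)
    refine Eq.trans ?_ (β.act_comp k h p r _).symm
    exact congrArg (β.act p) (funext fun i => hr i _)

end Products

/-! ### Algebras over the symmetrised operad -/

section SymGraft

variable {K : Type u} [Field K] {A B : Type u} [AddCommGroup A] [Module K A]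
  [AddCommGroup B] [Module K B]

open NSOperad

/-- The product `m` of a `P_↗^Σ`-algebra. -/
abbrev SymOperad.Algebra.m (α : (symGraft K).Algebra A) : A →ₗ[K] A →ₗ[K] A :=
  α.bin (toSymmetrisation _ (opM K))

/-- The product `↗` of a `P_↗^Σ`-algebra. -/
abbrev SymOperad.Algebra.up (α : (symGraft K).Algebra A) : A →ₗ[K] A →ₗ[K] A :=
  α.bin (toSymmetrisation _ (opUp K))

theorem SymOperad.Algebra.isGraftPair (α : (symGraft K).Algebra A) : IsGraftPair α.m α.up :=
  α.toNS.isGraftPair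

theorem SymOperad.Algebra.isHom_of_bin {α : (symGraft K).Algebra A}
    {β : (symGraft K).Algebra B} {g : A →ₗ[K] B}
    (hm : ∀ x y, g (α.m x y) = β.m (g x) (g y))
    (hup : ∀ x y, g (α.up x y) = β.up (g x) (g y)) : α.toAlgebra.IsHom β.toAlgebra g := by
  intro n p
  have hz : ∀ (C : Type u) [AddCommGroup C] [Module K C] (γ : (symGraft K).Algebra C) {n : ℕ}
      (c : Fin n → C), γ.act 0 c = 0 := fun C _ _ γ n c => by
    have := γ.act_smul 0 0 c
    rwa [zero_smul, zero_smul] at this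
  have hns : α.toNS.IsHom β.toNS g := NSOperad.Algebra.isHom_of_bin hm hup
  induction p using SymOperad.presented_induction with
  | gen x => exact hns x
  | one =>
    intro a
    exact (congrArg g (α.act_one a)).trans (β.act_one (fun i => g (a i))).symm
  | zero => intro a; exact (congrArg g (hz A α a)).trans ((map_zero g).trans (hz B β _).symm)
  | add x y hx hy =>
    intro a
    exact (congrArg g (α.act_add x y a)).trans ((map_add g _ _).trans
      ((congrArg₂ (· + ·) (hx a) (hy a)).trans (β.act_add x y _).symm))
  | smul c x hx =>
    intro a
    exact (congrArg g (α.act_smul c x a)).trans ((map_smul g _ _).trans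
      ((congrArg (c • ·) (hx a)).trans (β.act_smul c x _).symm))
  | comp k h p r hp hr =>
    intro a
    refine (congrArg g (α.act_comp k h p r a)).trans ((hp _).trans ?_)
    refine Eq.trans ?_ (β.act_comp k h p r _).symm
    exact congrArg (β.act p) (funext fun i => hr i _)
  | perm σ x hx =>
    intro a
    exact (congrArg g (α.act_perm σ x a)).trans ((hx _).trans (β.act_perm σ x (fun i => g (a i))).symm)

theorem NSOperad.Algebra.IsHom.bin {P : NSOperad K} {α : P.Algebra A} {β : P.Algebra B}
    {g : A →ₗ[K] B} (h : α.IsHom β g) (p : P.obj 2) (x y : A) :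
    g (α.bin p x y) = β.bin p (g x) (g y) := by
  rw [α.bin_apply, β.bin_apply, h p, eq_pair (fun i => g _)]
  rfl

theorem NSOperad.Algebra.IsHom.comp {C : Type u} [AddCommGroup C] [Module K C] {P : NSOperad K}
    {α : P.Algebra A} {β : P.Algebra B} {γ : P.Algebra C} {g : B →ₗ[K] C} {f : A →ₗ[K] B}
    (hg : β.IsHom γ g) (hf : α.IsHom β f) : α.IsHom γ (g ∘ₗ f) := fun p a =>
  (congrArg g (hf p a)).trans (hg p _)

theorem NSOperad.Algebra.isHom_id {P : NSOperad K} (α : P.Algebra A) :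
    α.IsHom α LinearMap.id := fun _ _ => rfl

/-- The restriction of a bilinear product to a stable subspace. -/
def restrictBin (μ : A →ₗ[K] A →ₗ[K] A) (S : Submodule K A)
    (h : ∀ x ∈ S, ∀ y ∈ S, μ x y ∈ S) : S →ₗ[K] S →ₗ[K] S :=
  LinearMap.mk₂ K (fun x y => ⟨μ x y, h x x.2 y y.2⟩)
    (fun x x' y => Subtype.ext (by simp)) (fun c x y => Subtype.ext (by simp))
    (fun x y y' => Subtype.ext (by simp)) (fun c x y => Subtype.ext (by simp))

/-- A subspace stable under `m` and `↗` is an algebra of which the inclusion is a morphism. -/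
theorem exists_subalgebra (α : (symGraft K).Algebra A) (S : Submodule K A)
    (hm : ∀ x ∈ S, ∀ y ∈ S, α.m x y ∈ S) (hup : ∀ x ∈ S, ∀ y ∈ S, α.up x y ∈ S) :
    ∃ σ : (symGraft K).Algebra S, σ.toAlgebra.IsHom α.toAlgebra S.subtype := by
  have h : IsGraftPair (restrictBin α.m S hm) (restrictBin α.up S hup) :=
    ⟨fun x y z => Subtype.ext (α.isGraftPair.m_up x y z),
      fun x y z => Subtype.ext (α.isGraftPair.m_m x y z),
      fun x y z => Subtype.ext (α.isGraftPair.up_up x y z)⟩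
  refine ⟨symAlg h, SymOperad.Algebra.isHom_of_bin (fun x y => ?_) fun x y => ?_⟩
  · rw [SymOperad.Algebra.m, symAlg_bin_m]; rfl
  · rw [SymOperad.Algebra.up, symAlg_bin_up]; rfl

/-- A free algebra is generated by its generators. -/
theorem IsFreeAlgebra.eq_top {V : Type u} [AddCommGroup V] [Module K V]
    {φ : (symGraft K).Algebra A} {j : V →ₗ[K] A} (hφ : IsFreeAlgebra φ j) (S : Submodule K A)
    (hj : ∀ v, j v ∈ S)
    (hm : ∀ x ∈ S, ∀ y ∈ S, φ.m x y ∈ S) (hup : ∀ x ∈ S, ∀ y ∈ S, φ.up x y ∈ S) : S = ⊤ := by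
  obtain ⟨σ, hσ⟩ := exists_subalgebra φ S hm hup
  obtain ⟨g, ⟨hg, hgj⟩, -⟩ := hφ S σ (j.codRestrict S hj)
  have h := (hφ A φ j).unique (y₁ := S.subtype ∘ₗ g) (y₂ := LinearMap.id)
    ⟨hσ.comp hg, by rw [LinearMap.comp_assoc, hgj]; rfl⟩ ⟨NSOperad.Algebra.isHom_id _, rfl⟩
  rw [eq_top_iff]
  intro x _
  rw [← show S.subtype (g x) = x from congrArg (fun f => f x) h]
  exact (g x).2

/-- An enveloping algebra `U(L)` is generated by the image of `L`. -/
theorem IsEnveloping.eq_top {L : Type u} [AddCommGroup L] [Module K L]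
    {lam : (symPRIM K).toOperad.Algebra L} {φ : (symGraft K).Algebra A} {j : L →ₗ[K] A}
    (hφ : IsEnveloping lam φ j) (S : Submodule K A) (hj : ∀ v, j v ∈ S)
    (hm : ∀ x ∈ S, ∀ y ∈ S, φ.m x y ∈ S) (hup : ∀ x ∈ S, ∀ y ∈ S, φ.up x y ∈ S) : S = ⊤ := by
  obtain ⟨σ, hσ⟩ := exists_subalgebra φ S hm hup
  obtain ⟨g, ⟨hg, hgj⟩, -⟩ := hφ.2 S σ (j.codRestrict S hj) (fun p a =>
    Subtype.ext ((hφ.1 p a).trans (hσ p.1 (fun i => j.codRestrict S hj (a i))).symm))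
  have h := (hφ.2 A φ j hφ.1).unique (y₁ := S.subtype ∘ₗ g) (y₂ := LinearMap.id)
    ⟨hσ.comp hg, by rw [LinearMap.comp_assoc, hgj]; rfl⟩ ⟨NSOperad.Algebra.isHom_id _, rfl⟩
  rw [eq_top_iff]
  intro x _
  rw [← show S.subtype (g x) = x from congrArg (fun f => f x) h]
  exact (g x).2

end SymGraft

/-! ### The coproduct of a free algebra -/

section FreeCoproduct

variable {K : Type u} [Field K] {A : Type u} [AddCommGroup A] [Module K A]

/-- The product `(x, u) * (y, v) = (x * y, x * v + u * y + x ⊗ y)` on `A × (A ⊗ A)`: a linear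
map `δ` satisfies the compatibility `InfCompat` if and only if `x ↦ (x, δ x)` respects the
products. -/
def infExt (μ : A →ₗ[K] A →ₗ[K] A) :
    A × (A ⊗[K] A) →ₗ[K] A × (A ⊗[K] A) →ₗ[K] A × (A ⊗[K] A) :=
  LinearMap.mk₂ K (fun p q => (μ p.1 q.1,
      (μ p.1).rTensor A q.2 + (μ.flip q.1).lTensor A p.2 + p.1 ⊗ₜ[K] q.1))
    (fun p p' q => by
      ext
      · simp
      · simp only [Prod.fst_add, Prod.snd_add, map_add, LinearMap.rTensor_add,
          LinearMap.add_apply, TensorProduct.add_tmul]; abel)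
    (fun c p q => by
      ext
      · simp
      · simp only [Prod.smul_fst, Prod.smul_snd, map_smul, LinearMap.rTensor_smul,
          LinearMap.smul_apply, TensorProduct.smul_tmul', smul_add])
    (fun p q q' => by
      ext
      · simp
      · simp only [Prod.fst_add, Prod.snd_add, map_add, LinearMap.lTensor_add,
          LinearMap.add_apply, TensorProduct.tmul_add]; abel)
    (fun c p q => by
      ext
      · simp
      · simp only [Prod.smul_fst, Prod.smul_snd, map_smul, LinearMap.lTensor_smul,
          LinearMap.smul_apply, TensorProduct.tmul_smul, smul_add])

theorem infExt_apply (μ : A →ₗ[K] A →ₗ[K] A) (p q : A × (A ⊗[K] A)) :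
    infExt μ p q = (μ p.1 q.1,
      (μ p.1).rTensor A q.2 + (μ.flip q.1).lTensor A p.2 + p.1 ⊗ₜ[K] q.1) := rfl

theorem rTensor_lTensor_comm {T : Type*} [AddCommGroup T] [Module K T] (f g : T →ₗ[K] T)
    (t : T ⊗[K] T) : f.rTensor T (g.lTensor T t) = g.lTensor T (f.rTensor T t) := by
  rw [← LinearMap.comp_apply, ← LinearMap.comp_apply, LinearMap.rTensor_comp_lTensor,
    LinearMap.lTensor_comp_rTensor]

/-- A relation `(x *_ν y) *_μ z = x *_ν (y *_μ z)` passes to `A × (A ⊗ A)`; it covers the three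
relations of `P_↗`. -/
theorem infExt_assoc {μ ν : A →ₗ[K] A →ₗ[K] A}
    (h : ∀ x y z, μ (ν x y) z = ν x (μ y z)) (p q r : A × (A ⊗[K] A)) :
    infExt μ (infExt ν p q) r = infExt ν p (infExt μ q r) := by
  have h1 : μ (ν p.1 q.1) = ν p.1 ∘ₗ μ q.1 := LinearMap.ext fun z => h _ _ _
  have h2 : ν.flip (μ q.1 r.1) = μ.flip r.1 ∘ₗ ν.flip q.1 := LinearMap.ext fun z => (h _ _ _).symm
  simp only [infExt_apply, h1, h2, map_add, LinearMap.rTensor_comp, LinearMap.lTensor_comp,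
    LinearMap.comp_apply, rTensor_lTensor_comm, LinearMap.rTensor_tmul, LinearMap.lTensor_tmul,
    LinearMap.flip_apply]
  ext
  · rfl
  · simp only; abel

/-- The elements on which a coproduct compatible with `μ` is coassociative are stable under `μ`. -/
theorem InfCompat.coassoc_mul {μ : A →ₗ[K] A →ₗ[K] A} {δ : A →ₗ[K] A ⊗[K] A}
    (h : InfCompat μ δ) {x y : A}
    (hx : TensorProduct.assoc K A A A (δ.rTensor A (δ x)) = δ.lTensor A (δ x))
    (hy : TensorProduct.assoc K A A A (δ.rTensor A (δ y)) = δ.lTensor A (δ y)) :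
    TensorProduct.assoc K A A A (δ.rTensor A (δ (μ x y))) = δ.lTensor A (δ (μ x y)) := by
  -- `Ψ (c ⊗ d) (a ⊗ b) = a ⊗ (b * c) ⊗ d` collects the terms in which the product is in the middle.
  let Ψ : A ⊗[K] A → A ⊗[K] A →ₗ[K] A ⊗[K] (A ⊗[K] A) := fun t =>
    (((LinearMap.rTensorHom A).flip t) ∘ₗ μ).lTensor A
  have hΨ : ∀ (c d : A) (s : A ⊗[K] A), Ψ (c ⊗ₜ d) s =
      TensorProduct.assoc K A A A ((μ.flip c).lTensor A s ⊗ₜ d) := fun c d s => by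
    induction s with
    | zero => simp
    | tmul a b => simp [Ψ]
    | add s s' hs hs' => rw [map_add, hs, hs', map_add, TensorProduct.add_tmul, map_add]
  have hΨadd : ∀ t t' s, Ψ (t + t') s = Ψ t s + Ψ t' s := fun t t' s => by
    simp only [Ψ, map_add, LinearMap.add_comp, LinearMap.lTensor_add, LinearMap.add_apply]
  have h1 : ∀ t : A ⊗[K] A, TensorProduct.assoc K A A A (δ.rTensor A ((μ x).rTensor A t)) =
      (μ x).rTensor _ (TensorProduct.assoc K A A A (δ.rTensor A t)) + Ψ t (δ x) + x ⊗ₜ t := by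
    intro t
    induction t with
    | zero => simp [Ψ]
    | tmul c d =>
      rw [LinearMap.rTensor_tmul, LinearMap.rTensor_tmul, h, hΨ, TensorProduct.add_tmul,
        TensorProduct.add_tmul, map_add, map_add, LinearMap.rTensor_tmul,
        TensorProduct.assoc_tmul]
      congr 2
      generalize δ c = s
      induction s with
      | zero => simp
      | tmul a b => simp
      | add s s' hs hs' => simp only [map_add, TensorProduct.add_tmul, hs, hs']
    | add t t' ht ht' =>
      simp only [map_add, ht, ht', hΨadd, TensorProduct.tmul_add]; abel
  have h2 : ∀ s : A ⊗[K] A, TensorProduct.assoc K A A A (δ.rTensor A ((μ.flip y).lTensor A s)) =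
      ((μ.flip y).lTensor A).lTensor A (TensorProduct.assoc K A A A (δ.rTensor A s)) := by
    intro s
    induction s with
    | zero => simp
    | tmul a b =>
      rw [LinearMap.lTensor_tmul, LinearMap.rTensor_tmul, LinearMap.rTensor_tmul]
      generalize δ a = t
      induction t with
      | zero => simp
      | tmul c d => simp
      | add t t' ht ht' => simp only [map_add, TensorProduct.add_tmul, ht, ht']
    | add t t' ht ht' => simp only [map_add, ht, ht']
  have h3 : ∀ t : A ⊗[K] A, δ.lTensor A ((μ x).rTensor A t) =
      (μ x).rTensor _ (δ.lTensor A t) := by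
    intro t
    induction t with
    | zero => simp
    | tmul a b => simp
    | add t t' ht ht' => simp only [map_add, ht, ht']
  have h4 : ∀ s : A ⊗[K] A, δ.lTensor A ((μ.flip y).lTensor A s) =
      Ψ (δ y) s + ((μ.flip y).lTensor A).lTensor A (δ.lTensor A s) +
        TensorProduct.assoc K A A A (s ⊗ₜ y) := by
    intro s
    induction s with
    | zero => simp
    | tmul a b =>
      simp only [LinearMap.lTensor_tmul, LinearMap.flip_apply, h b y, TensorProduct.tmul_add,
        TensorProduct.assoc_tmul, Ψ, LinearMap.comp_apply]
      rfl
    | add t t' ht ht' => simp only [map_add, ht, ht', TensorProduct.add_tmul]; abel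
  rw [h x y]
  simp only [map_add, h1, h2, h3, h4, hx, hy, LinearMap.rTensor_tmul, LinearMap.lTensor_tmul]
  abel

theorem SymBialgOne.ext_δ {B B' : SymBialgOne K A} (h : B.alg = B'.alg) (h' : B.δ = B'.δ) :
    B = B' := by
  cases B; cases B'; subst h; subst h'; rfl

/-- On a free algebra there is exactly one structure of bialgebra for which the generators are
primitive. -/
theorem IsFreeAlgebra.existsUnique_bialg {V : Type u} [AddCommGroup V] [Module K V]
    {φ : (symGraft K).Algebra A} {j : V →ₗ[K] A} (hφ : IsFreeAlgebra φ j) :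
    ∃! B : SymBialgOne K A, B.alg = φ ∧ ∀ v, B.δ (j v) = 0 := by
  have hE : IsGraftPair (infExt φ.m) (infExt φ.up) :=
    ⟨infExt_assoc φ.isGraftPair.m_up, infExt_assoc φ.isGraftPair.m_m,
      infExt_assoc φ.isGraftPair.up_up⟩
  -- The morphism with `j v ↦ (j v, 0)`: its first component is the identity, its second one is `δ`.
  obtain ⟨g, ⟨hg, hgj⟩, -⟩ := hφ _ (symAlg hE) (LinearMap.inl K A _ ∘ₗ j)
  have hgm : ∀ x y, g (φ.m x y) = infExt φ.m (g x) (g y) := fun x y => by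
    rw [SymOperad.Algebra.m, hg.bin, symAlg_bin_m]
  have hgup : ∀ x y, g (φ.up x y) = infExt φ.up (g x) (g y) := fun x y => by
    rw [SymOperad.Algebra.up, hg.bin, symAlg_bin_up]
  have hfst : LinearMap.fst K A _ ∘ₗ g = LinearMap.id :=
    (hφ A φ j).unique
      ⟨SymOperad.Algebra.isHom_of_bin (fun x y => congrArg Prod.fst (hgm x y))
        (fun x y => congrArg Prod.fst (hgup x y)),
        by rw [LinearMap.comp_assoc, hgj]; rfl⟩
      ⟨NSOperad.Algebra.isHom_id _, rfl⟩
  have hfst' : ∀ x, (g x).1 = x := fun x => congrArg (fun f => f x) hfst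
  let δ : A →ₗ[K] A ⊗[K] A := LinearMap.snd K A _ ∘ₗ g
  have hm : InfCompat φ.m δ := fun x y => by
    have := congrArg Prod.snd (hgm x y)
    rwa [infExt_apply, hfst', hfst'] at this
  have hup : InfCompat φ.up δ := fun x y => by
    have := congrArg Prod.snd (hgup x y)
    rwa [infExt_apply, hfst', hfst'] at this
  have hδj : ∀ v, δ (j v) = 0 := fun v =>
    congrArg Prod.snd (congrArg (fun f => f v) hgj : g (j v) = LinearMap.inl K A _ (j v))
  have hco : IsCoassoc δ := by
    have := hφ.eq_top (LinearMap.eqLocus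
      ((TensorProduct.assoc K A A A).toLinearMap ∘ₗ δ.rTensor A ∘ₗ δ) (δ.lTensor A ∘ₗ δ))
      (fun v => by simp [LinearMap.mem_eqLocus, hδj])
      (fun x hx y hy => hm.coassoc_mul hx hy) (fun x hx y hy => hup.coassoc_mul hx hy)
    exact LinearMap.eqLocus_eq_top.mp this
  refine ⟨⟨φ, δ, hco, hm, hup⟩, ⟨rfl, hδj⟩, ?_⟩
  rintro B ⟨rfl, hB⟩
  refine SymBialgOne.ext_δ rfl (LinearMap.eqLocus_eq_top.mp (hφ.eq_top _ (fun v => ?_) ?_ ?_))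
  · exact (hB v).trans (hδj v).symm
  · intro x hx y hy
    rw [LinearMap.mem_eqLocus] at hx hy ⊢
    rw [B.compat_m x y, hx, hy]
    exact (hm x y).symm
  · intro x hx y hy
    rw [LinearMap.mem_eqLocus] at hx hy ⊢
    rw [B.compat_up x y, hx, hy]
    exact (hup x y).symm

end FreeCoproduct

/-! ### Connected coalgebras -/

section Connected

variable {K : Type u} [Field K] {C D : Type u} [AddCommGroup C] [Module K C]
  [AddCommGroup D] [Module K D]

/-- The image of `S ⊗ S` in `C ⊗ C`. -/
def tensorSq (S : Submodule K C) : Submodule K (C ⊗[K] C) :=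
  Submodule.span K {t | ∃ a ∈ S, ∃ b ∈ S, a ⊗ₜ b = t}

theorem tensorSq_mono {S T : Submodule K C} (h : S ≤ T) : tensorSq S ≤ tensorSq T :=
  Submodule.span_mono fun _ ⟨a, ha, b, hb, e⟩ => ⟨a, h ha, b, h hb, e⟩

theorem mem_primFiltration_succ {δ : C →ₗ[K] C ⊗[K] C} {r : ℕ} {x : C} :
    x ∈ primFiltration δ (r + 1) ↔ δ x ∈ tensorSq (primFiltration δ r) := by
  rw [primFiltration, Submodule.mem_comap, TensorProduct.range_map_eq_span_tmul, tensorSq]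
  have : {t | ∃ m n, (primFiltration δ r).subtype m ⊗ₜ[K] (primFiltration δ r).subtype n = t} =
      {t | ∃ a ∈ primFiltration δ r, ∃ b ∈ primFiltration δ r, a ⊗ₜ[K] b = t} := by
    ext t
    simp
  rw [this]

theorem primFiltration_mono (δ : C →ₗ[K] C ⊗[K] C) : Monotone (primFiltration δ) := by
  refine monotone_nat_of_le_succ fun r => ?_
  induction r with
  | zero => exact bot_le
  | succ r ih =>
    intro x hx
    rw [mem_primFiltration_succ] at hx ⊢
    exact tensorSq_mono ih hx

theorem tensorSq_induction {S : Submodule K C} {E : Type*} [AddCommGroup E] [Module K E]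
    {f g : C ⊗[K] C →ₗ[K] E} (h : ∀ a ∈ S, ∀ b ∈ S, f (a ⊗ₜ b) = g (a ⊗ₜ b)) {t : C ⊗[K] C}
    (ht : t ∈ tensorSq S) : f t = g t :=
  LinearMap.eqOn_span (s := {t | ∃ a ∈ S, ∃ b ∈ S, a ⊗ₜ b = t})
    (by rintro _ ⟨a, ha, b, hb, rfl⟩; exact h a ha b hb) ht

/-- Induction along the filtration: to prove a property of `x` one may assume it on a step `F_r` with
`δ x ∈ F_r ⊗ F_r`. -/
theorem IsConnectedCoalg.induction {δ : C →ₗ[K] C ⊗[K] C} (hc : IsConnectedCoalg δ)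
    {motive : C → Prop} (h0 : motive 0) (h : ∀ r, (∀ x ∈ primFiltration δ r, motive x) →
      ∀ x, δ x ∈ tensorSq (primFiltration δ r) → motive x) (x : C) : motive x := by
  obtain ⟨r, hr⟩ := hc x
  induction r generalizing x with
  | zero => rwa [(Submodule.mem_bot K).mp hr]
  | succ r ih => exact h r ih x (mem_primFiltration_succ.mp hr)

/-- A self-map of `Hom(C, E)` whose value on `F_{r+1}` depends only on the argument on `F_r` has
a unique fixed point, when `C` is connected. -/
theorem IsConnectedCoalg.existsUnique_fixedPoint {δ : C →ₗ[K] C ⊗[K] C}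
    (hc : IsConnectedCoalg δ) {E : Type u} [AddCommGroup E] [Module K E]
    (T : (C →ₗ[K] E) → (C →ₗ[K] E))
    (hT : ∀ r g g', (∀ x ∈ primFiltration δ r, g x = g' x) →
      ∀ x, δ x ∈ tensorSq (primFiltration δ r) → T g x = T g' x) : ∃! g, T g = g := by
  have hstab : ∀ n k x, x ∈ primFiltration δ n → T^[n + k] 0 x = T^[n] 0 x := by
    intro n
    induction n with
    | zero =>
      intro k x hx
      rw [(Submodule.mem_bot K).mp hx, map_zero, map_zero]
    | succ n ih =>
      intro k x hx
      rw [show n + 1 + k = (n + k) + 1 by omega, Function.iterate_succ_apply',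
        Function.iterate_succ_apply']
      exact hT n _ _ (ih k) x (mem_primFiltration_succ.mp hx)
  choose ρ hρ using hc
  have hval : ∀ n x, x ∈ primFiltration δ n → T^[ρ x] 0 x = T^[n] 0 x := by
    intro n x hx
    rcases le_total n (ρ x) with h | h
    · obtain ⟨k, hk⟩ := Nat.exists_eq_add_of_le h
      rw [hk]; exact hstab n k x hx
    · obtain ⟨k, hk⟩ := Nat.exists_eq_add_of_le h
      conv_rhs => rw [hk]
      exact (hstab _ k x (hρ x)).symm
  let g : C →ₗ[K] E :=
    { toFun := fun x => T^[ρ x] 0 x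
      map_add' := fun x y => by
        have hx := primFiltration_mono δ (le_max_left (ρ x) (ρ y)) (hρ x)
        have hy := primFiltration_mono δ (le_max_right (ρ x) (ρ y)) (hρ y)
        rw [hval _ _ hx, hval _ _ hy, hval _ _ (Submodule.add_mem _ hx hy), map_add]
      map_smul' := fun c x => by
        rw [hval _ _ (Submodule.smul_mem _ c (hρ x)), map_smul]; rfl }
  have hg : ∀ n x, x ∈ primFiltration δ n → g x = T^[n] 0 x := hval
  refine ⟨g, LinearMap.ext fun x => ?_, fun g' hg' => LinearMap.ext fun x => ?_⟩
  · have hx := primFiltration_mono δ (Nat.le_succ (ρ x)) (hρ x)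
    rw [hg _ _ hx, Function.iterate_succ_apply']
    exact hT (ρ x) _ _ (hg _) x (mem_primFiltration_succ.mp hx)
  · have : ∀ n x, x ∈ primFiltration δ n → g' x = g x := by
      intro n
      induction n with
      | zero =>
        intro x hx
        rw [(Submodule.mem_bot K).mp hx, map_zero, map_zero]
      | succ n ih =>
        intro x hx
        rw [hg _ _ hx, Function.iterate_succ_apply', ← hg']
        exact hT n _ _ (fun y hy => (ih y hy).trans (hg n y hy)) x (mem_primFiltration_succ.mp hx)
    exact this _ x (hρ x)

theorem IsCoalgHom.mem_primFiltration {δ : C →ₗ[K] C ⊗[K] C} {δ' : D →ₗ[K] D ⊗[K] D}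
    {f : C →ₗ[K] D} (hf : IsCoalgHom δ δ' f) (r : ℕ) :
    ∀ x ∈ primFiltration δ r, f x ∈ primFiltration δ' r := by
  induction r with
  | zero =>
    intro x hx
    rw [(Submodule.mem_bot K).mp hx, map_zero]; exact Submodule.zero_mem _
  | succ r ih =>
    intro x hx
    rw [mem_primFiltration_succ] at hx ⊢
    rw [show δ' (f x) = TensorProduct.map f f (δ x) from congrArg (fun g => g x) hf]
    generalize δ x = t at hx
    induction hx using Submodule.span_induction with
    | mem t ht =>
      obtain ⟨a, ha, b, hb, rfl⟩ := ht
      exact Submodule.subset_span ⟨f a, ih a ha, f b, ih b hb, rfl⟩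
    | zero => rw [map_zero]; exact Submodule.zero_mem _
    | add t t' _ _ ht ht' => rw [map_add]; exact Submodule.add_mem _ ht ht'
    | smul c t _ ht => rw [map_smul]; exact Submodule.smul_mem _ c ht

/-- The filtration is multiplicative for a compatible product. -/
theorem InfCompat.mul_mem_primFiltration {μ : C →ₗ[K] C →ₗ[K] C} {δ : C →ₗ[K] C ⊗[K] C}
    (h : InfCompat μ δ) : ∀ n r s, r + s = n → ∀ x ∈ primFiltration δ r,
      ∀ y ∈ primFiltration δ s, μ x y ∈ primFiltration δ n := by
  intro n
  induction n with
  | zero =>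
    intro r s hrs x hx y hy
    obtain rfl : r = 0 := by omega
    rw [(Submodule.mem_bot K).mp hx, map_zero]; exact Submodule.zero_mem _
  | succ n ih =>
    intro r s hrs x hx y hy
    rcases r with _ | r
    · rw [(Submodule.mem_bot K).mp hx, map_zero]; exact Submodule.zero_mem _
    rcases s with _ | s
    · rw [(Submodule.mem_bot K).mp hy, map_zero]; exact Submodule.zero_mem _
    rw [mem_primFiltration_succ, h x y]
    refine Submodule.add_mem _ (Submodule.add_mem _ ?_ ?_) (Submodule.subset_span
      ⟨x, primFiltration_mono δ (by omega) hx, y, primFiltration_mono δ (by omega) hy, rfl⟩)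
    · rw [mem_primFiltration_succ] at hy
      refine (Submodule.span_le (p := (tensorSq (primFiltration δ n)).comap _)).mpr ?_ hy
      rintro _ ⟨a, ha, b, hb, rfl⟩
      exact Submodule.subset_span ⟨μ x a, ih (r + 1) s (by omega) x hx a ha, b,
        primFiltration_mono δ (by omega) hb, rfl⟩
    · rw [mem_primFiltration_succ] at hx
      refine (Submodule.span_le (p := (tensorSq (primFiltration δ n)).comap _)).mpr ?_ hx
      rintro _ ⟨a, ha, b, hb, rfl⟩
      exact Submodule.subset_span ⟨a, primFiltration_mono δ (by omega) ha, μ b y,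
        ih r (s + 1) (by omega) b hb y hy, rfl⟩

/-- The union of the filtration. -/
def connectedPart (δ : C →ₗ[K] C ⊗[K] C) : Submodule K C where
  carrier := {x | ∃ r, x ∈ primFiltration δ r}
  zero_mem' := ⟨0, Submodule.zero_mem _⟩
  add_mem' := fun {x y} ⟨r, hr⟩ ⟨s, hs⟩ => ⟨max r s, Submodule.add_mem _
    (primFiltration_mono δ (le_max_left r s) hr) (primFiltration_mono δ (le_max_right r s) hs)⟩
  smul_mem' := fun c x ⟨r, hr⟩ => ⟨r, Submodule.smul_mem _ c hr⟩

end Connected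

/-! ### The projection on the primitive elements -/

section Projection

variable {K : Type u} [Field K] {C : Type u} [AddCommGroup C] [Module K C]
  {μ : C →ₗ[K] C →ₗ[K] C} {δ : C →ₗ[K] C ⊗[K] C}

/-- `e(x) = x - e(x') x''`, the recursive definition of the projection on the primitive
elements. -/
def IsPrimProj (μ : C →ₗ[K] C →ₗ[K] C) (δ : C →ₗ[K] C ⊗[K] C) (e : C →ₗ[K] C) : Prop :=
  ∀ x, e x = x - TensorProduct.lift μ (e.rTensor C (δ x))

theorem exists_isPrimProj (μ : C →ₗ[K] C →ₗ[K] C) (hc : IsConnectedCoalg δ) :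
    ∃ e, IsPrimProj μ δ e := by
  obtain ⟨e, he, -⟩ := hc.existsUnique_fixedPoint
    (fun e => LinearMap.id - TensorProduct.lift μ ∘ₗ e.rTensor C ∘ₗ δ) (by
      intro r g g' h x hx
      have : g.rTensor C (δ x) = g'.rTensor C (δ x) :=
        tensorSq_induction (fun a ha b _ => by
          rw [LinearMap.rTensor_tmul, LinearMap.rTensor_tmul, h a ha]) hx
      simp [this])
  exact ⟨e, fun x => congrArg (fun f => f x) he.symm⟩

theorem IsCoassoc.assoc_symm {δ : C →ₗ[K] C ⊗[K] C} (hco : IsCoassoc δ) (x : C) :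
    (TensorProduct.assoc K C C C).symm (δ.lTensor C (δ x)) = δ.rTensor C (δ x) := by
  rw [LinearEquiv.symm_apply_eq]
  exact (congrArg (fun f => f x) hco).symm

/-- The values of `e` are primitive: as `e(x')` is primitive by induction, coassociativity gives
`δ(e(x') x'') = (x' - e(x')) ⊗ x'' + e(x') ⊗ x'' = δ(x)`. -/
theorem IsPrimProj.δ_eq_zero {e : C →ₗ[K] C} (he : IsPrimProj μ δ e) (h : InfCompat μ δ)
    (hco : IsCoassoc δ) (hc : IsConnectedCoalg δ) (x : C) : δ (e x) = 0 := by
  refine hc.induction (motive := fun x => δ (e x) = 0) (by simp) (fun r ih x hx => ?_) x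
  have key : ∀ t ∈ tensorSq (primFiltration δ r),
      (δ ∘ₗ TensorProduct.lift μ ∘ₗ e.rTensor C) t =
        ((TensorProduct.lift μ ∘ₗ e.rTensor C).rTensor C ∘ₗ
          (TensorProduct.assoc K C C C).symm.toLinearMap ∘ₗ δ.lTensor C + e.rTensor C) t := by
    intro t ht
    refine tensorSq_induction (fun a ha b _ => ?_) ht
    simp only [LinearMap.comp_apply, LinearMap.add_apply, LinearMap.rTensor_tmul,
      LinearMap.lTensor_tmul, TensorProduct.lift.tmul, h (e a) b, ih a ha, map_zero, add_zero]
    congr 1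
    generalize δ b = s
    induction s with
    | zero => simp
    | tmul c d => simp
    | add s s' hs hs' => simp only [map_add, TensorProduct.tmul_add, hs, hs']
  have hx' := key _ hx
  simp only [LinearMap.comp_apply, LinearMap.add_apply, LinearEquiv.coe_coe,
    hco.assoc_symm] at hx'
  rw [he x, map_sub, hx', ← LinearMap.comp_apply (LinearMap.rTensor C _), ← LinearMap.rTensor_comp]
  have : (TensorProduct.lift μ ∘ₗ e.rTensor C) ∘ₗ δ = LinearMap.id - e :=
    LinearMap.ext fun y => by simp [he y]
  rw [this, LinearMap.rTensor_sub]
  simp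

theorem IsPrimProj.apply_prim {e : C →ₗ[K] C} (he : IsPrimProj μ δ e) {p : C} (hp : δ p = 0) :
    e p = p := by
  rw [he p, hp]; simp

/-- `e` kills the products whose first factor is primitive. -/
theorem IsPrimProj.apply_mul {e : C →ₗ[K] C} (he : IsPrimProj μ δ e) (h : InfCompat μ δ)
    (hc : IsConnectedCoalg δ) {p : C} (hp : δ p = 0) (y : C) : e (μ p y) = 0 := by
  refine hc.induction (motive := fun y => e (μ p y) = 0) (by simp) (fun r ih y hy => ?_) y
  have : (e.rTensor C ∘ₗ (μ p).rTensor C) (δ y) = (0 : C ⊗[K] C →ₗ[K] C ⊗[K] C) (δ y) :=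
    tensorSq_induction (fun a ha b _ => by simp [ih a ha]) hy
  rw [LinearMap.comp_apply, LinearMap.zero_apply] at this
  rw [he, h p y, hp]
  simp [this, he.apply_prim hp]

/-- Every element of `F_{r+1}` is the sum of a primitive element and of products of primitive
elements by elements of `F_r`. -/
theorem IsPrimProj.mem_of_primFiltration_succ {e : C →ₗ[K] C} (he : IsPrimProj μ δ e)
    (h : InfCompat μ δ) (hco : IsCoassoc δ) (hc : IsConnectedCoalg δ) {r : ℕ}
    (S : Submodule K C) (hS : ∀ p, δ p = 0 → p ∈ S)
    (hS' : ∀ p, δ p = 0 → ∀ y ∈ primFiltration δ r, μ p y ∈ S) {x : C}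
    (hx : δ x ∈ tensorSq (primFiltration δ r)) : x ∈ S := by
  rw [show x = e x + TensorProduct.lift μ (e.rTensor C (δ x)) by rw [he x]; simp]
  refine Submodule.add_mem _ (hS _ (he.δ_eq_zero h hco hc x)) ?_
  refine (Submodule.span_le (p := S.comap (TensorProduct.lift μ ∘ₗ e.rTensor C))).mpr ?_ hx
  rintro _ ⟨a, ha, b, hb, rfl⟩
  exact hS' _ (he.δ_eq_zero h hco hc a) b hb

/-- A connected bialgebra is generated by its primitive elements. -/
theorem InfCompat.mem_of_prim (h : InfCompat μ δ) (hco : IsCoassoc δ) (hc : IsConnectedCoalg δ)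
    (S : Submodule K C) (hS : ∀ p, δ p = 0 → p ∈ S)
    (hS' : ∀ p, δ p = 0 → ∀ y ∈ S, μ p y ∈ S) (x : C) : x ∈ S := by
  obtain ⟨e, he⟩ := exists_isPrimProj μ hc
  exact hc.induction (motive := (· ∈ S)) S.zero_mem (fun r ih x hx =>
    he.mem_of_primFiltration_succ h hco hc S hS (fun p hp y hy => hS' p hp y (ih y hy)) hx) x

/-- A connected coalgebra with a compatible product is cofree over its primitive elements. -/
theorem InfCompat.exists_isCofreeConnected (h : InfCompat μ δ) (hco : IsCoassoc δ)
    (hc : IsConnectedCoalg δ) : ∃ π : C →ₗ[K] LinearMap.ker δ, IsCofreeConnected δ π := by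
  obtain ⟨e, he⟩ := exists_isPrimProj μ hc
  let π : C →ₗ[K] LinearMap.ker δ := e.codRestrict _ (he.δ_eq_zero h hco hc)
  refine ⟨π, hco, hc, ?_⟩
  intro D _ _ δ' hco' hc' f
  -- The morphism of coalgebras is the solution of `g(d) = f(d) + f(d') g(d'')`.
  let f' : D →ₗ[K] C := (LinearMap.ker δ).subtype ∘ₗ f
  have hf' : ∀ d, δ (f' d) = 0 := fun d => (f d).2
  obtain ⟨g, hg, huniq⟩ := hc'.existsUnique_fixedPoint
    (fun g : D →ₗ[K] C => f' + TensorProduct.lift μ ∘ₗ TensorProduct.map f' g ∘ₗ δ') (by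
      intro r g g' h x hx
      have : TensorProduct.map f' g (δ' x) = TensorProduct.map f' g' (δ' x) :=
        tensorSq_induction (fun a _ b hb => by
          rw [TensorProduct.map_tmul, TensorProduct.map_tmul, h b hb]) hx
      simp [this])
  have hg' : ∀ d, g d = f' d + TensorProduct.lift μ (TensorProduct.map f' g (δ' d)) :=
    fun d => congrArg (fun f => f d) hg.symm
  refine ⟨g, ⟨?_, ?_⟩, ?_⟩
  · refine LinearMap.ext fun d => ?_
    refine hc'.induction (motive := fun d => δ (g d) = TensorProduct.map g g (δ' d))
      (by simp) (fun r ih x hx => ?_) d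
    have key : ∀ t ∈ tensorSq (primFiltration δ' r),
        (δ ∘ₗ TensorProduct.lift μ ∘ₗ TensorProduct.map f' g) t =
          (TensorProduct.map (TensorProduct.lift μ ∘ₗ TensorProduct.map f' g) g ∘ₗ
            (TensorProduct.assoc K D D D).symm.toLinearMap ∘ₗ δ'.lTensor D +
              TensorProduct.map f' g) t := by
      intro t ht
      refine tensorSq_induction (fun a _ b hb => ?_) ht
      simp only [LinearMap.comp_apply, LinearMap.add_apply, TensorProduct.map_tmul,
        LinearMap.lTensor_tmul, TensorProduct.lift.tmul, h (f' a) (g b), hf', map_zero, add_zero,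
        ih b hb]
      congr 1
      generalize δ' b = s
      induction s with
      | zero => simp
      | tmul c d => simp
      | add s s' hs hs' => simp only [map_add, TensorProduct.tmul_add, hs, hs']
    have hx' := key _ hx
    simp only [LinearMap.comp_apply, LinearMap.add_apply, LinearEquiv.coe_coe,
      hco'.assoc_symm] at hx'
    rw [hg' x, map_add, hf', zero_add, hx', ← LinearMap.comp_apply (TensorProduct.map _ _),
      LinearMap.map_comp_rTensor]
    have : (TensorProduct.lift μ ∘ₗ TensorProduct.map f' g) ∘ₗ δ' = g - f' :=
      LinearMap.ext fun y => by simp [hg' y]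
    rw [this, ← LinearMap.add_apply, ← TensorProduct.map_add_left, sub_add_cancel]
  · refine LinearMap.ext fun d => Subtype.ext ?_
    change e (g d) = f' d
    rw [hg' d, map_add, he.apply_prim (hf' d), add_eq_left]
    generalize δ' d = t
    induction t with
    | zero => simp
    | tmul a b => exact he.apply_mul h hc (hf' a) _
    | add t t' ht ht' => simp only [map_add, ht, ht', add_zero]
  · rintro g' ⟨hco', hπ⟩
    refine huniq g' (LinearMap.ext fun d => ?_)
    have h1 : e ∘ₗ g' = f' := LinearMap.ext fun d =>
      congrArg Subtype.val (congrArg (fun f => f d) hπ)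
    have h2 : δ (g' d) = TensorProduct.map g' g' (δ' d) := congrArg (fun f => f d) hco'
    have h3 : g' d = e (g' d) + TensorProduct.lift μ (e.rTensor C (δ (g' d))) := by
      rw [he (g' d)]; simp
    rw [h3, h2, ← LinearMap.comp_apply (e.rTensor C), LinearMap.rTensor_comp_map, h1,
      ← h1]
    rfl

end Projection

/-! ### Extension of morphisms from the primitive elements -/

section Extension

variable {K : Type u} [Field K] {A E : Type u} [AddCommGroup A] [Module K A]
  [AddCommGroup E] [Module K E]

/-- A linear map `f` defined on the primitive elements of a connected bialgebra, with values in an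
associative algebra, extends to a morphism for the product: `g(x) = f(e(x)) + f(e(x')) g(x'')`. -/
theorem InfCompat.exists_extension {μ : A →ₗ[K] A →ₗ[K] A} {δ : A →ₗ[K] A ⊗[K] A}
    (h : InfCompat μ δ) (hμ : ∀ x y z, μ (μ x y) z = μ x (μ y z))
    (hco : IsCoassoc δ) (hc : IsConnectedCoalg δ)
    {ν : E →ₗ[K] E →ₗ[K] E} (hν : ∀ x y z, ν (ν x y) z = ν x (ν y z))
    (f : LinearMap.ker δ →ₗ[K] E) :
    ∃ g : A →ₗ[K] E, (∀ p, g p.1 = f p) ∧ ∀ x y, g (μ x y) = ν (g x) (g y) := by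
  obtain ⟨e, he⟩ := exists_isPrimProj μ hc
  let f' : A →ₗ[K] E := f ∘ₗ e.codRestrict _ (he.δ_eq_zero h hco hc)
  have hf' : ∀ p : LinearMap.ker δ, f' p = f p := fun p =>
    congrArg f (Subtype.ext (he.apply_prim p.2))
  have hf'μ : ∀ p, δ p = 0 → ∀ y, f' (μ p y) = 0 := fun p hp y =>
    (congrArg f (Subtype.ext (he.apply_mul h hc hp y))).trans (map_zero f)
  obtain ⟨g, hg, -⟩ := hc.existsUnique_fixedPoint
    (fun g : A →ₗ[K] E => f' + TensorProduct.lift ν ∘ₗ TensorProduct.map f' g ∘ₗ δ) (by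
      intro r g g' h x hx
      have : TensorProduct.map f' g (δ x) = TensorProduct.map f' g' (δ x) :=
        tensorSq_induction (fun a _ b hb => by
          rw [TensorProduct.map_tmul, TensorProduct.map_tmul, h b hb]) hx
      simp [this])
  have hg' : ∀ d, g d = f' d + TensorProduct.lift ν (TensorProduct.map f' g (δ d)) :=
    fun d => congrArg (fun f => f d) hg.symm
  have hgp : ∀ p : LinearMap.ker δ, g p = f p := fun p => by
    rw [hg', hf', LinearMap.mem_ker.mp p.2]; simp
  have hgμ : ∀ p : A, δ p = 0 → ∀ y, g (μ p y) = ν (g p) (g y) := fun p hp y => by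
    rw [hg', hf'μ p hp, h p y, hp]
    have : TensorProduct.map f' g ∘ₗ (μ p).rTensor A = 0 := TensorProduct.ext' fun a b => by
      simp [hf'μ p hp]
    simp only [map_add, map_zero, ← LinearMap.comp_apply (TensorProduct.map f' g), this,
      LinearMap.zero_apply, zero_add, add_zero, TensorProduct.map_tmul,
      TensorProduct.lift.tmul]
    rw [hf' ⟨p, hp⟩, hgp ⟨p, hp⟩]
  refine ⟨g, hgp, fun x y => ?_⟩
  let S : Submodule K A :=
    { carrier := {x | ∀ y, g (μ x y) = ν (g x) (g y)}
      zero_mem' := fun y => by simp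
      add_mem' := fun {x x'} hx hx' y => by simp [hx y, hx' y]
      smul_mem' := fun c x hx y => by simp [hx y] }
  exact h.mem_of_prim hco hc S hgμ (fun p hp x hx y => by
    rw [hμ, hgμ p hp, hgμ p hp, hx y, hν]) x y

/-- On a connected bialgebra, a morphism for the product `m` which respects `p ↗ q` for primitive
elements `p`, `q` respects `↗`. For primitive `p`, and for `w` in a step of the filtration, the
element `p ↗ w - p w` is in the same step, and `(p w) ↗ y = p ↗ (w ↗ y) - (p ↗ w - p w) ↗ y`. -/
theorem IsGraftPair.map_up {μ up : A →ₗ[K] A →ₗ[K] A} {δ : A →ₗ[K] A ⊗[K] A}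
    (hA : IsGraftPair μ up) (hm : InfCompat μ δ) (hup : InfCompat up δ)
    (hco : IsCoassoc δ) (hc : IsConnectedCoalg δ)
    {ν up' : E →ₗ[K] E →ₗ[K] E} (hE : IsGraftPair ν up') {g : A →ₗ[K] E}
    (hg : ∀ x y, g (μ x y) = ν (g x) (g y))
    (hgp : ∀ p q, δ p = 0 → δ q = 0 → g (up p q) = up' (g p) (g q)) (x y : A) :
    g (up x y) = up' (g x) (g y) := by
  have hprim : ∀ p, δ p = 0 → ∀ y, g (up p y) = up' (g p) (g y) := fun p hp y => by
    refine hm.mem_of_prim hco hc (LinearMap.eqLocus (g ∘ₗ up p) (up' (g p) ∘ₗ g))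
      (fun q hq => hgp p q hp hq) (fun q hq z hz => ?_) y
    rw [LinearMap.mem_eqLocus]
    simp only [LinearMap.comp_apply, hg, ← hA.m_up, ← hE.m_up, hgp p q hp hq]
  have hcirc : ∀ p, δ p = 0 → ∀ r, ∀ w ∈ primFiltration δ r,
      up p w - μ p w ∈ primFiltration δ r := fun p hp r => by
    induction r with
    | zero =>
      intro w hw
      rw [(Submodule.mem_bot K).mp hw, map_zero, map_zero, sub_zero]; exact Submodule.zero_mem _
    | succ r ih =>
      intro w hw
      rw [mem_primFiltration_succ] at hw ⊢
      have : δ (up p w - μ p w) = (up p - μ p).rTensor A (δ w) := by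
        rw [map_sub, hm p w, hup p w, hp, LinearMap.rTensor_sub]; simp
      rw [this]
      refine (Submodule.span_le (p := (tensorSq (primFiltration δ r)).comap _)).mpr ?_ hw
      rintro _ ⟨a, ha, b, hb, rfl⟩
      exact Submodule.subset_span ⟨_, ih a ha, b, hb, rfl⟩
  let S : Submodule K A :=
    { carrier := {x | ∀ y, g (up x y) = up' (g x) (g y)}
      zero_mem' := fun y => by simp
      add_mem' := fun {x x'} hx hx' y => by simp [hx y, hx' y]
      smul_mem' := fun c x hx y => by simp [hx y] }
  obtain ⟨e, he⟩ := exists_isPrimProj μ hc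
  suffices ∀ r, primFiltration δ r ≤ S by
    obtain ⟨r, hr⟩ := hc x
    exact this r hr y
  intro r
  induction r with
  | zero => exact bot_le
  | succ r ih =>
    intro x hx
    refine he.mem_of_primFiltration_succ hm hco hc S hprim (fun p hp w hw y => ?_)
      (mem_primFiltration_succ.mp hx)
    have h1 : up (μ p w) y = up p (up w y) - up (up p w - μ p w) y := by
      rw [map_sub, LinearMap.sub_apply, hA.up_up]; abel
    rw [h1, map_sub, hprim p hp, ih hw y, ih (hcirc p hp r w hw) y, map_sub, hprim p hp, hg,
      map_sub, LinearMap.sub_apply, hE.up_up]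
    abel

end Extension

/-! ### The structure theorem -/

section Structure

variable {K : Type u} [Field K] {A : Type u} [AddCommGroup A] [Module K A]

/-- `↗ - m` preserves the primitive elements, since `δ(p * q) = p ⊗ q` for both products. -/
theorem toSymmetrisation_sub_mem :
    toSymmetrisation _ (opUp K) - toSymmetrisation _ (opM K) ∈ (symPRIM K).carrier 2 := by
  intro A _ _ B a ha
  have h1 := B.compat_up (a 0) (a 1)
  have h2 := B.compat_m (a 0) (a 1)
  rw [NSOperad.Algebra.bin_apply, ← eq_pair] at h1 h2
  rw [LinearMap.mem_ker.mp (ha 0), LinearMap.mem_ker.mp (ha 1), map_zero, map_zero] at h1 h2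
  have h3 : B.alg.act (toSymmetrisation _ (opUp K) - toSymmetrisation _ (opM K)) a =
      B.alg.act (toSymmetrisation _ (opUp K)) a - B.alg.act (toSymmetrisation _ (opM K)) a := by
    rw [eq_sub_iff_add_eq, ← B.alg.act_add, sub_add_cancel]
  rw [LinearMap.mem_ker, h3, map_sub, h1, h2, sub_self]

theorem SymOperad.Algebra.act_up_sub_m (α : (symGraft K).Algebra A) (x y : A) :
    α.act (toSymmetrisation _ (opUp K) - toSymmetrisation _ (opM K)) ![x, y] =
      α.up x y - α.m x y := by
  rw [eq_sub_iff_add_eq]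
  exact (α.act_add _ _ _).symm.trans (by rw [sub_add_cancel]; rfl)

/-- A connected bialgebra is the enveloping algebra of its primitive elements. -/
theorem SymBialgOne.isEnveloping (B : SymBialgOne K A) (hc : IsConnectedCoalg B.δ) :
    IsEnveloping B.primAlg B.alg B.prim.subtype := by
  refine ⟨fun _ _ => rfl, fun E _ _ ε f hf => ?_⟩
  obtain ⟨g, hgp, hg⟩ := B.compat_m.exists_extension B.alg.isGraftPair.m_m B.coassoc hc
    ε.isGraftPair.m_m f
  have hgup := B.alg.isGraftPair.map_up B.compat_m B.compat_up B.coassoc hc ε.isGraftPair hg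
    (fun p q hp hq => by
      have h1 := hf ⟨_, toSymmetrisation_sub_mem⟩ ![⟨p, hp⟩, ⟨q, hq⟩]
      have h2 : (B.primAlg.act ⟨_, toSymmetrisation_sub_mem⟩ ![⟨p, hp⟩, ⟨q, hq⟩] : B.prim).1 =
          B.alg.up p q - B.alg.m p q := by
        rw [← B.alg.act_up_sub_m]
        exact congrArg (B.alg.act _) (by funext i; fin_cases i <;> rfl)
      have h3 : (ε.toAlgebra.restrict (symPRIM K).toSuboperad).act
          ⟨_, toSymmetrisation_sub_mem⟩ (fun i => f (![⟨p, hp⟩, ⟨q, hq⟩] i)) =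
            ε.up (g p) (g q) - ε.m (g p) (g q) := by
        rw [← ε.act_up_sub_m, hgp ⟨p, hp⟩, hgp ⟨q, hq⟩]
        exact congrArg (ε.act _) (by funext i; fin_cases i <;> rfl)
      have h4 : g (B.alg.up p q - B.alg.m p q) = ε.up (g p) (g q) - ε.m (g p) (g q) := by
        rw [← h2]
        exact (hgp _).trans (h1.trans h3)
      rw [map_sub, hg] at h4
      exact sub_left_injective h4)
  refine ⟨g, ⟨SymOperad.Algebra.isHom_of_bin hg hgup, LinearMap.ext hgp⟩, ?_⟩
  rintro g' ⟨hg', hj⟩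
  refine LinearMap.ext fun x => ?_
  refine B.compat_m.mem_of_prim B.coassoc hc (LinearMap.eqLocus g' g) (fun p hp => ?_)
    (fun p hp y hy => ?_) x
  · exact (congrArg (fun f => f ⟨p, hp⟩) hj : g' p = f ⟨p, hp⟩).trans (hgp ⟨p, hp⟩).symm
  · rw [LinearMap.mem_eqLocus] at hy ⊢
    rw [hg, hg'.bin, hy]
    congr 2
    exact (congrArg (fun f => f ⟨p, hp⟩) hj : g' p = f ⟨p, hp⟩).trans (hgp ⟨p, hp⟩).symm

/-- The connected part of `U(L)` is a subalgebra which contains `L`, hence is everything. -/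
theorem IsEnvelopingOfPrim.isConnectedCoalg {B : SymBialgOne K A} (h : IsEnvelopingOfPrim B) :
    IsConnectedCoalg B.δ := by
  obtain ⟨U, _, _, BU, j, hj, hj0, e, -, he⟩ := h
  have htop := hj.eq_top (connectedPart BU.δ)
    (fun v => ⟨1, mem_primFiltration_succ.mpr (by rw [hj0]; exact Submodule.zero_mem _)⟩)
    (fun x ⟨r, hr⟩ y ⟨s, hs⟩ => ⟨_, BU.compat_m.mul_mem_primFiltration _ r s rfl x hr y hs⟩)
    (fun x ⟨r, hr⟩ y ⟨s, hs⟩ => ⟨_, BU.compat_up.mul_mem_primFiltration _ r s rfl x hr y hs⟩)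
  have hsymm : IsCoalgHom BU.δ B.δ e.symm.toLinearMap := by
    refine LinearMap.ext fun u => ?_
    obtain ⟨a, rfl⟩ := e.surjective u
    have h1 : BU.δ (e a) = TensorProduct.map e.toLinearMap e.toLinearMap (B.δ a) :=
      congrArg (fun f => f a) he
    have h2 : e.symm.toLinearMap ∘ₗ e.toLinearMap = LinearMap.id :=
      LinearMap.ext fun x => e.symm_apply_apply x
    simp only [LinearMap.comp_apply, LinearEquiv.coe_coe, e.symm_apply_apply, h1]
    rw [← LinearMap.comp_apply, ← TensorProduct.map_comp, h2, TensorProduct.map_id]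
    rfl
  intro x
  obtain ⟨r, hr⟩ : e x ∈ connectedPart BU.δ := htop ▸ Submodule.mem_top
  refine ⟨r, ?_⟩
  rw [← e.symm_apply_apply x]
  exact hsymm.mem_primFiltration r _ hr

/-- The three characterisations of the connected bialgebras. -/
theorem SymBialgOne.structure_tfae (B : SymBialgOne K A) :
    [IsConnectedCoalg B.δ, IsEnvelopingOfPrim B,
      ∃ π : A →ₗ[K] B.prim, IsCofreeConnected B.δ π].TFAE := by
  tfae_have 1 → 2 := fun hc =>
    ⟨A, _, _, B, B.prim.subtype, B.isEnveloping hc, fun x => x.2, LinearEquiv.refl K A,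
      fun _ _ => rfl, by
        refine LinearMap.ext fun x => ?_
        simp⟩
  tfae_have 2 → 1 := fun h => h.isConnectedCoalg
  tfae_have 1 → 3 := fun hc => B.compat_m.exists_isCofreeConnected B.coassoc hc
  tfae_have 3 → 1 := fun ⟨_, h⟩ => h.2.1
  tfae_finish

end Structure

/-! ### Unital compatibility -/

section Unital

variable {K : Type u} [Field K] {T : Type*} [AddCommGroup T] [Module K T]

/-- `Δ(x * y) = (x * y') ⊗ y'' + x' ⊗ (x'' * y) - x ⊗ y`, the compatibility of a product with a
counitary coproduct. -/
def UnitalCompat (μ : T →ₗ[K] T →ₗ[K] T) (Δ : T →ₗ[K] T ⊗[K] T) (x y : T) : Prop :=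
  Δ (μ x y) = (μ x).rTensor T (Δ y) + (μ.flip y).lTensor T (Δ x) - x ⊗ₜ[K] y

/-- The compatibility passes to products in the first argument, so that it need only be checked on
generators there. -/
theorem UnitalCompat.mul {μ : T →ₗ[K] T →ₗ[K] T} {Δ : T →ₗ[K] T ⊗[K] T}
    (hμ : ∀ x y z, μ (μ x y) z = μ x (μ y z)) {x x' : T} (hx : ∀ y, UnitalCompat μ Δ x y)
    (hx' : ∀ y, UnitalCompat μ Δ x' y) (y : T) : UnitalCompat μ Δ (μ x x') y := by
  have h1 : μ (μ x x') = μ x ∘ₗ μ x' := LinearMap.ext fun z => hμ _ _ _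
  have h2 : μ.flip (μ x' y) = μ.flip y ∘ₗ μ.flip x' := LinearMap.ext fun z => (hμ _ _ _).symm
  have e1 := hx (μ x' y)
  have e2 := hx' y
  have e3 := hx x'
  unfold UnitalCompat at *
  rw [hμ, e1, e2, e3, h1, h2]
  simp only [map_add, map_sub, LinearMap.rTensor_comp, LinearMap.lTensor_comp,
    LinearMap.comp_apply, rTensor_lTensor_comm, LinearMap.rTensor_tmul, LinearMap.lTensor_tmul,
    LinearMap.flip_apply]
  abel

theorem UnitalCompat.sub {μ : T →ₗ[K] T →ₗ[K] T} {Δ : T →ₗ[K] T ⊗[K] T} {x x' : T} {y : T}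
    (hx : UnitalCompat μ Δ x y) (hx' : UnitalCompat μ Δ x' y) :
    UnitalCompat μ Δ (x - x') y := by
  unfold UnitalCompat at *
  simp only [map_sub, LinearMap.sub_apply, hx, hx', LinearMap.rTensor_sub, TensorProduct.sub_tmul]
  abel

/-- Removing the unit and the counit: the compatibility with a reduced coproduct. -/
theorem UnitalCompat.infCompat {W : Type u} [AddCommGroup W] [Module K W] {ι : W →ₗ[K] T}
    {ρ : T →ₗ[K] W} (hρ : ρ ∘ₗ ι = LinearMap.id) {Δ : T →ₗ[K] T ⊗[K] T} {δ : W →ₗ[K] W ⊗[K] W}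
    {u : T} (hδ : ∀ x, Δ (ι x) = ι x ⊗ₜ u + u ⊗ₜ ι x + TensorProduct.map ι ι (δ x))
    {μ : T →ₗ[K] T →ₗ[K] T} {μ' : W →ₗ[K] W →ₗ[K] W} (hι : ∀ x y, ι (μ' x y) = μ (ι x) (ι y))
    (h1 : ∀ x, μ x u = x) (h2 : ∀ x, μ u x = x) (h : ∀ x y, UnitalCompat μ Δ x y) :
    InfCompat μ' δ := by
  intro x y
  have hinj : Function.Injective (TensorProduct.map ι ι) :=
    Function.LeftInverse.injective (g := TensorProduct.map ρ ρ) fun t => by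
      rw [← LinearMap.comp_apply, ← TensorProduct.map_comp, hρ, TensorProduct.map_id]; rfl
  apply hinj
  have e1 := hδ (μ' x y)
  have e2 := h (ι x) (ι y)
  unfold UnitalCompat at e2
  rw [hι, e2, hδ, hδ] at e1
  have n1 : ∀ t, TensorProduct.map ι ι ((μ' x).rTensor W t) =
      (μ (ι x)).rTensor T (TensorProduct.map ι ι t) := fun t => by
    rw [← LinearMap.comp_apply, ← LinearMap.comp_apply, LinearMap.map_comp_rTensor,
      LinearMap.rTensor_comp_map]
    congr 2
    exact LinearMap.ext fun z => hι x z
  have n2 : ∀ t, TensorProduct.map ι ι ((μ'.flip y).lTensor W t) =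
      (μ.flip (ι y)).lTensor T (TensorProduct.map ι ι t) := fun t => by
    rw [← LinearMap.comp_apply, ← LinearMap.comp_apply, LinearMap.map_comp_lTensor,
      LinearMap.lTensor_comp_map]
    congr 2
    exact LinearMap.ext fun z => hι z y
  rw [map_add, map_add, n1, n2, TensorProduct.map_tmul]
  simp only [map_add, LinearMap.rTensor_tmul, LinearMap.lTensor_tmul, LinearMap.flip_apply,
    h1, h2] at e1
  have := eq_sub_of_add_eq' e1.symm
  rw [this]
  abel

end Unital

/-! ### The enveloping algebra of a free magmatic algebra -/

section Words

variable (K : Type u) [Field K] (X : Type)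

/-- The space with basis the words in `X`. For a magma `X` it is the tensor algebra of the magmatic
algebra `K[X]`. -/
abbrev WordSpace := List X →₀ K

variable {K X}

/-- The basis element given by a word. -/
def word (w : List X) : WordSpace K X := Finsupp.single w 1

theorem wordSpace_induction {motive : WordSpace K X → Prop} (x : WordSpace K X)
    (zero : motive 0) (add : ∀ x y, motive x → motive y → motive (x + y))
    (smul : ∀ (c : K) x, motive x → motive (c • x)) (word : ∀ w, motive (word w)) : motive x := by
  induction x using Finsupp.induction_linear with
  | zero => exact zero
  | add x y hx hy => exact add x y hx hy
  | single w c =>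
    rw [show Finsupp.single w c = c • (ForestOperads.word w : WordSpace K X) by
      simp [ForestOperads.word]]
    exact smul c _ (word w)

theorem wordSpace_ext {E : Type*} [AddCommMonoid E] [Module K E] {f g : WordSpace K X →ₗ[K] E}
    (h : ∀ w, f (word w) = g (word w)) : f = g :=
  Finsupp.lhom_ext' fun w => LinearMap.ext_ring (h w)

/-- The linear map with given values on words. -/
def wordLift {E : Type*} [AddCommMonoid E] [Module K E] (f : List X → E) : WordSpace K X →ₗ[K] E :=
  Finsupp.linearCombination K f

@[simp] theorem wordLift_word {E : Type*} [AddCommMonoid E] [Module K E] (f : List X → E)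
    (w : List X) : wordLift f (word w : WordSpace K X) = f w := by
  simp [word, wordLift]

/-- Concatenation. -/
def wordMul : WordSpace K X →ₗ[K] WordSpace K X →ₗ[K] WordSpace K X :=
  wordLift fun u => wordLift fun v => word (u ++ v)

@[simp] theorem wordMul_word (u v : List X) :
    wordMul (word u) (word v) = (word (u ++ v) : WordSpace K X) := by
  simp [wordMul]

theorem wordMul_assoc (x y z : WordSpace K X) :
    wordMul (wordMul x y) z = wordMul x (wordMul y z) := by
  induction x using wordSpace_induction with
  | zero => simp
  | add x x' hx hx' => simp [hx, hx']
  | smul c x hx => simp [hx]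
  | word u =>
    induction y using wordSpace_induction with
    | zero => simp
    | add x x' hx hx' => simp [hx, hx']
    | smul c x hx => simp [hx]
    | word v =>
      induction z using wordSpace_induction with
      | zero => simp
      | add x x' hx hx' => simp only [map_add, hx, hx']
      | smul c x hx => simp only [map_smul, hx]
      | word w => simp

theorem nil_wordMul (x : WordSpace K X) : wordMul (word []) x = x :=
  congrArg (fun f => f x) (wordSpace_ext (f := wordMul (word [])) (g := LinearMap.id) (by simp))

theorem wordMul_nil (x : WordSpace K X) : wordMul x (word []) = x :=
  congrArg (fun f => f x) (wordSpace_ext (f := wordMul.flip (word [])) (g := LinearMap.id) (by simp))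

/-- The span of the nonempty words. -/
def augmentation (K : Type u) [Field K] (X : Type) : Submodule K (WordSpace K X) :=
  Submodule.span K (Set.range fun p : X × List X => word (p.1 :: p.2))

theorem word_cons_mem (a : X) (w : List X) : word (a :: w) ∈ augmentation K X :=
  Submodule.subset_span ⟨(a, w), rfl⟩

theorem augmentation_le {S : Submodule K (WordSpace K X)} (h : ∀ a w, word (a :: w) ∈ S) :
    augmentation K X ≤ S := by
  refine Submodule.span_le.mpr ?_
  rintro _ ⟨p, rfl⟩
  exact h _ _

theorem wordMul_mem {x : WordSpace K X} (hx : x ∈ augmentation K X) (y : WordSpace K X) :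
    wordMul x y ∈ augmentation K X := by
  refine augmentation_le (S := (augmentation K X).comap (wordMul.flip y)) (fun a w => ?_) hx
  rw [Submodule.mem_comap, LinearMap.flip_apply]
  induction y using wordSpace_induction with
  | zero => simp
  | add x x' hx hx' => rw [map_add]; exact Submodule.add_mem _ hx hx'
  | smul c x hx => rw [map_smul]; exact Submodule.smul_mem _ c hx
  | word v => rw [wordMul_word]; exact word_cons_mem a (w ++ v)

/-- Deconcatenation. -/
def deconcatWord : List X → WordSpace K X ⊗[K] WordSpace K X
  | [] => word [] ⊗ₜ word []
  | a :: w => (wordMul (word [a])).rTensor _ (deconcatWord w) + word [] ⊗ₜ word (a :: w)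

/-- The deconcatenation coproduct. -/
def deconcat : WordSpace K X →ₗ[K] WordSpace K X ⊗[K] WordSpace K X := wordLift deconcatWord

theorem deconcat_nil : deconcat (word [] : WordSpace K X) = word [] ⊗ₜ word [] := by
  simp [deconcat, deconcatWord]

theorem deconcat_cons (a : X) (w : List X) : deconcat (word (a :: w) : WordSpace K X) =
    (wordMul (word [a])).rTensor _ (deconcat (word w)) + word [] ⊗ₜ word (a :: w) := by
  simp [deconcat, deconcatWord]

theorem deconcat_single (a : X) : deconcat (word [a] : WordSpace K X) =
    word [a] ⊗ₜ word [] + word [] ⊗ₜ word [a] := by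
  rw [deconcat_cons, deconcat_nil]; simp

theorem unitalCompat_nil_left {μ : WordSpace K X →ₗ[K] WordSpace K X →ₗ[K] WordSpace K X}
    (h : ∀ x, μ (word []) x = x) (y : WordSpace K X) : UnitalCompat μ deconcat (word []) y := by
  have : μ (word []) = LinearMap.id := LinearMap.ext h
  rw [UnitalCompat, this, deconcat_nil]
  simp only [LinearMap.id_apply, LinearMap.rTensor_id, LinearMap.lTensor_tmul,
    LinearMap.flip_apply, h]
  abel

theorem unitalCompat_wordMul (x y : WordSpace K X) : UnitalCompat wordMul deconcat x y := by
  have h1 : ∀ (a : X) (y : WordSpace K X), UnitalCompat wordMul deconcat (word [a]) y := by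
    intro a y
    induction y using wordSpace_induction with
    | zero => simp [UnitalCompat]
    | add x x' hx hx' =>
      unfold UnitalCompat at *
      simp only [map_add, hx, hx', LinearMap.lTensor_add, LinearMap.add_apply,
        TensorProduct.tmul_add]; abel
    | smul c x hx =>
      unfold UnitalCompat at *
      simp only [map_smul, hx, LinearMap.lTensor_smul, LinearMap.smul_apply,
        TensorProduct.tmul_smul, smul_sub, smul_add]
    | word w =>
      rw [UnitalCompat, wordMul_word, List.singleton_append, deconcat_cons, deconcat_single]
      simp only [map_add, LinearMap.lTensor_tmul, LinearMap.flip_apply, wordMul_word,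
        List.nil_append, List.singleton_append]
      abel
  induction x using wordSpace_induction with
  | zero => simp [UnitalCompat]
  | add x x' hx hx' =>
    unfold UnitalCompat at *
    simp only [map_add, LinearMap.add_apply, hx, hx', LinearMap.rTensor_add,
      TensorProduct.add_tmul]; abel
  | smul c x hx =>
    unfold UnitalCompat at *
    simp only [map_smul, LinearMap.smul_apply, hx, LinearMap.rTensor_smul,
      ← TensorProduct.smul_tmul', smul_sub, smul_add]
  | word w =>
    induction w generalizing y with
    | nil => exact unitalCompat_nil_left nil_wordMul y
    | cons a w ih =>
      have := UnitalCompat.mul wordMul_assoc (h1 a) ih y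
      rwa [wordMul_word] at this

/-- The coefficient of `u ⊗ v`. -/
def coeff₂ (u v : List X) : WordSpace K X ⊗[K] WordSpace K X →ₗ[K] K :=
  TensorProduct.lift ((LinearMap.lsmul K K).compl₁₂ (Finsupp.lapply u) (Finsupp.lapply v))

@[simp] theorem coeff₂_tmul (u v : List X) (x y : WordSpace K X) :
    coeff₂ u v (x ⊗ₜ y) = x u * y v := rfl

theorem coeff₂_rTensor_nil (a : X) (v : List X) (t : WordSpace K X ⊗[K] WordSpace K X) :
    coeff₂ [] v ((wordMul (word [a])).rTensor _ t) = 0 := by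
  have : ∀ x : WordSpace K X, wordMul (word [a]) x [] = 0 := fun x => by
    induction x using wordSpace_induction with
    | zero => simp
    | add x x' hx hx' => simp [hx, hx']
    | smul c x hx => simp [hx]
    | word w => rw [wordMul_word]; simp [word]
  induction t with
  | zero => simp
  | tmul x y => simp [this]
  | add t t' ht ht' => simp [ht, ht']

open scoped Classical in
theorem coeff₂_rTensor_cons (a b : X) (u v : List X) (t : WordSpace K X ⊗[K] WordSpace K X) :
    coeff₂ (b :: u) v ((wordMul (word [a])).rTensor _ t) = if a = b then coeff₂ u v t else 0 := by
  have : ∀ x : WordSpace K X, wordMul (word [a]) x (b :: u) = if a = b then x u else 0 := fun x => by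
    induction x using wordSpace_induction with
    | zero => simp
    | add x x' hx hx' => simp only [map_add, Finsupp.add_apply, hx, hx']; split_ifs <;> simp
    | smul c x hx => simp only [map_smul, Finsupp.smul_apply, hx]; split_ifs <;> simp
    | word w =>
      rw [wordMul_word, word, word, Finsupp.single_apply, Finsupp.single_apply]
      by_cases h : a = b <;> simp [h]
  induction t with
  | zero => simp
  | tmul x y => simp only [LinearMap.rTensor_tmul, coeff₂_tmul, this]; split_ifs <;> simp
  | add t t' ht ht' => simp only [map_add, ht, ht']; split_ifs <;> simp

/-- The coefficient of `u ⊗ v` in `Δ(z)` is that of the word `u v` in `z`. -/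
theorem coeff₂_deconcat (z : WordSpace K X) (u v : List X) :
    coeff₂ u v (deconcat z) = z (u ++ v) := by
  classical
  induction z using wordSpace_induction with
  | zero => simp
  | add x x' hx hx' => rw [map_add, map_add, hx, hx']; rfl
  | smul c x hx => rw [map_smul, map_smul, hx]; rfl
  | word w =>
    induction w generalizing u with
    | nil =>
      rw [deconcat_nil]
      rcases u with _ | ⟨b, u⟩ <;> rcases v with _ | ⟨c, v⟩ <;> simp [word]
    | cons a w ih =>
      rw [deconcat_cons, map_add]
      rcases u with _ | ⟨b, u⟩
      · rw [coeff₂_rTensor_nil]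
        simp [word]
      · rw [coeff₂_rTensor_cons, ih]
        simp only [word, coeff₂_tmul, Finsupp.single_apply, List.cons_append, List.cons.injEq]
        by_cases h : a = b <;> simp [h]

/-- The primitive elements for the deconcatenation are the combinations of words with one letter. -/
theorem apply_eq_zero_of_primitive {z : WordSpace K X}
    (hz : deconcat z = z ⊗ₜ word [] + word [] ⊗ₜ z) {w : List X} (hw : w.length ≠ 1) : z w = 0 := by
  rcases w with _ | ⟨a, _ | ⟨b, w⟩⟩
  · have := coeff₂_deconcat z [] []
    rw [hz] at this
    simpa [word] using this
  · exact absurd rfl hw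
  · have := coeff₂_deconcat z [a] (b :: w)
    rw [hz] at this
    simpa [word, eq_comm] using this

end Words

/-! ### The product `↗` on words in a magma -/

section WordUp

variable {K : Type u} [Field K] {X : Type} [Mul X]

/-- `a ↗ -` for a letter `a`: `a ↗ (b w) = (a b) w + a b w`. -/
def letterUp (a : X) : WordSpace K X →ₗ[K] WordSpace K X :=
  wordLift fun v => match v with
    | [] => word [a]
    | b :: w => word ((a * b) :: w) + word (a :: b :: w)

/-- `(a w) ↗ -`, by `(a b w) ↗ y = a ↗ ((b w) ↗ y) - ((a b) w) ↗ y`, where `(a b) w` starts with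
the product of `a` and `b` in the magma. -/
def consUp : List X → X → WordSpace K X →ₗ[K] WordSpace K X
  | [], a => letterUp a
  | b :: w, a => letterUp a ∘ₗ consUp w b - consUp w (a * b)

/-- The product `↗`. -/
def wordUp : WordSpace K X →ₗ[K] WordSpace K X →ₗ[K] WordSpace K X :=
  wordLift fun u => match u with
    | [] => LinearMap.id
    | a :: w => consUp w a

theorem nil_wordUp (x : WordSpace K X) : wordUp (word []) x = x := by simp [wordUp]

theorem wordUp_cons (a : X) (w : List X) : wordUp (word (a :: w)) = consUp (K := K) w a := by
  simp [wordUp]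

theorem wordUp_cons_cons (a b : X) (w : List X) (y : WordSpace K X) :
    wordUp (word (a :: b :: w)) y =
      letterUp a (wordUp (word (b :: w)) y) - wordUp (word ((a * b) :: w)) y := by
  simp [wordUp, consUp]

theorem letterUp_nil (a : X) : letterUp a (word [] : WordSpace K X) = word [a] := by
  simp [letterUp]

theorem letterUp_cons (a b : X) (w : List X) : letterUp a (word (b :: w) : WordSpace K X) =
    word ((a * b) :: w) + word (a :: b :: w) := by
  simp [letterUp]

theorem wordUp_nil (x : WordSpace K X) : wordUp x (word []) = x := by
  induction x using wordSpace_induction with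
  | zero => simp
  | add x y hx hy => simp [hx, hy]
  | smul c x hx => simp [hx]
  | word u =>
    rcases u with _ | ⟨a, w⟩
    · exact nil_wordUp _
    · induction w generalizing a with
      | nil => rw [wordUp_cons, consUp, letterUp_nil]
      | cons b w ih => rw [wordUp_cons_cons, ih, ih, letterUp_cons]; abel

/-- `(a ↗ v) ↗ y = a ↗ (v ↗ y)` for a letter `a`: the definition of `↗` on words is made for this. -/
theorem wordUp_letterUp (a : X) (v y : WordSpace K X) :
    wordUp (letterUp a v) y = letterUp a (wordUp v y) := by
  induction v using wordSpace_induction with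
  | zero => simp
  | add x x' hx hx' => simp [hx, hx']
  | smul c x hx => simp [hx]
  | word u =>
    rcases u with _ | ⟨b, w⟩
    · rw [letterUp_nil, wordUp_cons, nil_wordUp, consUp]
    · rw [letterUp_cons, map_add, LinearMap.add_apply, wordUp_cons_cons]; abel

theorem wordUp_assoc (x y z : WordSpace K X) : wordUp (wordUp x y) z = wordUp x (wordUp y z) := by
  induction x using wordSpace_induction with
  | zero => simp
  | add x x' hx hx' => simp [hx, hx']
  | smul c x hx => simp [hx]
  | word u =>
    rcases u with _ | ⟨a, w⟩
    · rw [nil_wordUp, nil_wordUp]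
    · induction w generalizing a with
      | nil => rw [wordUp_cons, consUp, wordUp_letterUp]
      | cons b w ih =>
        rw [wordUp_cons_cons, wordUp_cons_cons, map_sub, LinearMap.sub_apply, wordUp_letterUp, ih,
          ih]

theorem letterUp_mem (a : X) (y : WordSpace K X) : letterUp a y ∈ augmentation K X := by
  induction y using wordSpace_induction with
  | zero => simp
  | add x x' hx hx' => rw [map_add]; exact Submodule.add_mem _ hx hx'
  | smul c x hx => rw [map_smul]; exact Submodule.smul_mem _ c hx
  | word u =>
    rcases u with _ | ⟨b, w⟩
    · rw [letterUp_nil]; exact word_cons_mem _ _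
    · rw [letterUp_cons]; exact Submodule.add_mem _ (word_cons_mem _ _) (word_cons_mem _ _)

theorem consUp_mem (w : List X) (a : X) (y : WordSpace K X) : consUp w a y ∈ augmentation K X := by
  induction w generalizing a with
  | nil => exact letterUp_mem a y
  | cons b w ih => exact Submodule.sub_mem _ (letterUp_mem a _) (ih _)

theorem wordUp_mem (x : WordSpace K X) {y : WordSpace K X} (hy : y ∈ augmentation K X) :
    wordUp x y ∈ augmentation K X := by
  induction x using wordSpace_induction with
  | zero => simp
  | add x x' hx hx' => rw [map_add]; exact Submodule.add_mem _ hx hx'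
  | smul c x hx => rw [map_smul]; exact Submodule.smul_mem _ c hx
  | word u =>
    rcases u with _ | ⟨a, w⟩
    · rwa [nil_wordUp]
    · rw [wordUp_cons]; exact consUp_mem w a y

theorem letterUp_wordMul (a : X) {y : WordSpace K X} (hy : y ∈ augmentation K X)
    (z : WordSpace K X) : letterUp a (wordMul y z) = wordMul (letterUp a y) z := by
  refine augmentation_le (S := LinearMap.eqLocus (letterUp a ∘ₗ wordMul.flip z)
    (wordMul.flip z ∘ₗ letterUp a)) (fun b w => ?_) hy
  rw [LinearMap.mem_eqLocus]
  simp only [LinearMap.comp_apply, LinearMap.flip_apply]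
  induction z using wordSpace_induction with
  | zero => simp
  | add x x' hx hx' => rw [map_add, map_add, hx, hx', map_add]
  | smul c x hx => rw [map_smul, map_smul, hx, map_smul]
  | word v =>
    rw [wordMul_word, List.cons_append, letterUp_cons, letterUp_cons, map_add,
      LinearMap.add_apply, wordMul_word, wordMul_word]
    rfl

/-- The relation `x ↗ (y z) = (x ↗ y) z`. It fails for the empty word `y`, for which the right-hand
side is `x z`. -/
theorem wordUp_wordMul (x : WordSpace K X) {y : WordSpace K X} (hy : y ∈ augmentation K X)
    (z : WordSpace K X) : wordUp x (wordMul y z) = wordMul (wordUp x y) z := by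
  induction x using wordSpace_induction with
  | zero => simp
  | add x x' hx hx' => simp [hx, hx']
  | smul c x hx => simp [hx]
  | word u =>
    rcases u with _ | ⟨a, w⟩
    · rw [nil_wordUp, nil_wordUp]
    · induction w generalizing a with
      | nil => rw [wordUp_cons, consUp, letterUp_wordMul a hy]
      | cons b w ih =>
        rw [wordUp_cons_cons, wordUp_cons_cons, map_sub, LinearMap.sub_apply, ih, ih,
          letterUp_wordMul a (wordUp_mem _ hy)]

theorem unitalCompat_letter (a : X) (y : WordSpace K X) :
    UnitalCompat wordUp deconcat (word [a]) y := by
  induction y using wordSpace_induction with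
  | zero => simp [UnitalCompat]
  | add x x' hx hx' =>
    unfold UnitalCompat at *
    simp only [map_add, hx, hx', LinearMap.lTensor_add, LinearMap.add_apply,
      TensorProduct.tmul_add]; abel
  | smul c x hx =>
    unfold UnitalCompat at *
    simp only [map_smul, hx, LinearMap.lTensor_smul, LinearMap.smul_apply,
      TensorProduct.tmul_smul, smul_sub, smul_add]
  | word w =>
    have hu : wordUp (word [a]) = letterUp (K := K) a := wordUp_cons a []
    rcases w with _ | ⟨b, w⟩
    · rw [UnitalCompat, hu, letterUp_nil, deconcat_single, deconcat_nil]
      simp only [map_add, LinearMap.rTensor_tmul, LinearMap.lTensor_tmul, LinearMap.flip_apply,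
        wordUp_nil, letterUp_nil]
      abel
    · have h1 : letterUp a ∘ₗ wordMul (word [b]) = wordMul (word [a * b]) +
          wordMul (word [a]) ∘ₗ wordMul (word [b] : WordSpace K X) :=
        wordSpace_ext fun v => by simp [letterUp_cons]
      have h3 : ∀ t, (letterUp (K := K) a).rTensor (WordSpace K X) ((wordMul (word [b])).rTensor _ t) =
          (wordMul (word [a * b])).rTensor _ t +
            (wordMul (word [a])).rTensor _ ((wordMul (word [b])).rTensor _ t) := fun t => by
        rw [← LinearMap.comp_apply, ← LinearMap.rTensor_comp, h1, LinearMap.rTensor_add,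
          LinearMap.rTensor_comp]
        rfl
      have h2 : letterUp a (word (b :: w) : WordSpace K X) =
          word ((a * b) :: w) + word (a :: b :: w) := letterUp_cons a b w
      rw [UnitalCompat, hu, h2, map_add, deconcat_cons (a * b), deconcat_cons a, deconcat_cons b,
        deconcat_single]
      simp only [map_add, LinearMap.rTensor_tmul, LinearMap.lTensor_tmul, LinearMap.flip_apply,
        nil_wordUp, hu, letterUp_nil, wordMul_word, h2, h3, TensorProduct.tmul_add,
        List.append_nil]
      abel

theorem unitalCompat_wordUp (x y : WordSpace K X) : UnitalCompat wordUp deconcat x y := by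
  induction x using wordSpace_induction generalizing y with
  | zero => simp [UnitalCompat]
  | add x x' hx hx' =>
    have h1 := hx y
    have h2 := hx' y
    unfold UnitalCompat at *
    simp only [map_add, LinearMap.add_apply, h1, h2, LinearMap.rTensor_add,
      TensorProduct.add_tmul]; abel
  | smul c x hx =>
    have h1 := hx y
    unfold UnitalCompat at *
    simp only [map_smul, LinearMap.smul_apply, h1, LinearMap.rTensor_smul,
      ← TensorProduct.smul_tmul', smul_sub, smul_add]
  | word u =>
    rcases u with _ | ⟨a, w⟩
    · exact unitalCompat_nil_left nil_wordUp y
    · induction w generalizing a y with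
      | nil => exact unitalCompat_letter a y
      | cons b w ih =>
        -- `a b w = a ↗ (b w) - (a b) w`, where `a b` is a product in the magma in the last word.
        have h : (word (a :: b :: w) : WordSpace K X) =
            wordUp (word [a]) (word (b :: w)) - word ((a * b) :: w) := by
          rw [wordUp_cons, consUp, letterUp_cons, add_sub_cancel_left]
        rw [h]
        exact (UnitalCompat.mul wordUp_assoc (unitalCompat_letter a) (fun y => ih y b) y).sub
          (ih y _)

end WordUp

/-! ### The bialgebra of nonempty words -/

section NWord

variable (K : Type u) [Field K] (X : Type)

/-- The space with basis the nonempty words `a w`. -/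
abbrev NWordSpace := (X × List X) →₀ K

variable {K X}

/-- The basis element given by a nonempty word. -/
def nword (a : X) (w : List X) : NWordSpace K X := Finsupp.single (a, w) 1

theorem nwordSpace_ext {E : Type*} [AddCommMonoid E] [Module K E] {f g : NWordSpace K X →ₗ[K] E}
    (h : ∀ a w, f (nword a w) = g (nword a w)) : f = g :=
  Finsupp.lhom_ext' fun p => LinearMap.ext_ring (h p.1 p.2)

/-- The inclusion of the span of the nonempty words. -/
def nwordIncl : NWordSpace K X →ₗ[K] WordSpace K X :=
  Finsupp.linearCombination K fun p => word (p.1 :: p.2)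

/-- The projection on the span of the nonempty words. -/
def nwordProj : WordSpace K X →ₗ[K] NWordSpace K X :=
  wordLift fun w => match w with
    | [] => 0
    | a :: w => nword a w

@[simp] theorem nwordIncl_nword (a : X) (w : List X) :
    nwordIncl (nword a w : NWordSpace K X) = word (a :: w) := by
  simp [nwordIncl, nword]

theorem nwordProj_cons (a : X) (w : List X) :
    nwordProj (word (a :: w) : WordSpace K X) = nword a w := by
  simp [nwordProj]

theorem nwordProj_comp_nwordIncl :
    nwordProj ∘ₗ nwordIncl = (LinearMap.id : NWordSpace K X →ₗ[K] NWordSpace K X) :=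
  nwordSpace_ext fun a w => by simp [nwordProj_cons]

theorem nwordProj_nwordIncl (x : NWordSpace K X) : nwordProj (nwordIncl x) = x :=
  congrArg (fun f => f x) nwordProj_comp_nwordIncl

theorem nwordIncl_mem (x : NWordSpace K X) : nwordIncl x ∈ augmentation K X := by
  induction x using Finsupp.induction_linear with
  | zero => simp
  | add x y hx hy => rw [map_add]; exact Submodule.add_mem _ hx hy
  | single p c =>
    rw [nwordIncl, Finsupp.linearCombination_single]
    exact Submodule.smul_mem _ c (word_cons_mem _ _)

theorem nwordIncl_nwordProj {z : WordSpace K X} (hz : z ∈ augmentation K X) :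
    nwordIncl (nwordProj z) = z :=
  augmentation_le (S := LinearMap.eqLocus (nwordIncl ∘ₗ nwordProj) LinearMap.id)
    (fun a w => by simp [LinearMap.mem_eqLocus, nwordProj_cons]) hz

/-- The product on the span of the nonempty words induced by a product on all words. -/
def reduceMul (μ : WordSpace K X →ₗ[K] WordSpace K X →ₗ[K] WordSpace K X) :
    NWordSpace K X →ₗ[K] NWordSpace K X →ₗ[K] NWordSpace K X :=
  (μ.compl₁₂ nwordIncl nwordIncl).compr₂ nwordProj

theorem nwordIncl_reduceMul {μ : WordSpace K X →ₗ[K] WordSpace K X →ₗ[K] WordSpace K X}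
    (h : ∀ x ∈ augmentation K X, ∀ y ∈ augmentation K X, μ x y ∈ augmentation K X)
    (x y : NWordSpace K X) :
    nwordIncl (reduceMul μ x y) = μ (nwordIncl x) (nwordIncl y) :=
  nwordIncl_nwordProj (h _ (nwordIncl_mem x) _ (nwordIncl_mem y))

theorem nwordIncl_injective : Function.Injective (nwordIncl (K := K) (X := X)) :=
  Function.LeftInverse.injective nwordProj_nwordIncl

/-- The reduced deconcatenation. -/
def reducedDeconcat : NWordSpace K X →ₗ[K] NWordSpace K X ⊗[K] NWordSpace K X :=
  TensorProduct.map nwordProj nwordProj ∘ₗ deconcat ∘ₗ nwordIncl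

theorem deconcat_nwordIncl (x : NWordSpace K X) : deconcat (nwordIncl x) =
    nwordIncl x ⊗ₜ word [] + word [] ⊗ₜ nwordIncl x +
      TensorProduct.map nwordIncl nwordIncl (reducedDeconcat x) := by
  -- The counit, followed by the unit. The claim is the expansion of `(1 - ε) ⊗ (1 - ε)` on `Δ`.
  let ε : WordSpace K X →ₗ[K] WordSpace K X := wordLift fun w => match w with
    | [] => word []
    | _ :: _ => 0
  have hε0 : ε (word []) = word [] := by simp [ε]
  have hε1 : ∀ a w, ε (word (a :: w)) = 0 := fun a w => by simp [ε]
  have hεm : ∀ a, ε ∘ₗ wordMul (word [a]) = 0 := fun a => wordSpace_ext fun w => by simp [hε1]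
  have hιρ : nwordIncl ∘ₗ nwordProj = LinearMap.id - ε := wordSpace_ext fun w => by
    rcases w with _ | ⟨a, w⟩
    · simp [nwordProj, hε0]
    · simp [nwordProj_cons, hε1]
  have hr : ∀ w, ε.rTensor _ (deconcat (word w)) = word [] ⊗ₜ word w := fun w => by
    rcases w with _ | ⟨a, w⟩
    · simp [deconcat_nil, hε0]
    · rw [deconcat_cons, map_add, ← LinearMap.comp_apply, ← LinearMap.rTensor_comp, hεm]
      simp [hε0]
  have hl : ∀ w, ε.lTensor _ (deconcat (word w)) = word w ⊗ₜ word [] := fun w => by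
    induction w with
    | nil => simp [deconcat_nil, hε0]
    | cons a w ih =>
      rw [deconcat_cons, map_add, ← LinearMap.comp_apply, LinearMap.lTensor_comp_rTensor,
        ← LinearMap.rTensor_comp_lTensor, LinearMap.comp_apply, ih]
      simp [hε1]
  refine congrArg (fun f => f x) (nwordSpace_ext (f := deconcat ∘ₗ nwordIncl)
    (g := (TensorProduct.mk K _ _).flip (word []) ∘ₗ nwordIncl +
      TensorProduct.mk K _ _ (word []) ∘ₗ nwordIncl +
      TensorProduct.map nwordIncl nwordIncl ∘ₗ reducedDeconcat) fun a w => ?_)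
  have hsub : ∀ t, TensorProduct.map (LinearMap.id - ε) (LinearMap.id - ε) t =
      t - ε.rTensor _ t - ε.lTensor _ t + ε.lTensor _ (ε.rTensor _ t) := fun t => by
    induction t with
    | zero => simp
    | tmul y z =>
      simp only [TensorProduct.map_tmul, LinearMap.sub_apply, LinearMap.id_apply,
        TensorProduct.sub_tmul, TensorProduct.tmul_sub, LinearMap.rTensor_tmul,
        LinearMap.lTensor_tmul]
      abel
    | add t t' ht ht' => simp only [map_add, ht, ht']; abel
  simp only [LinearMap.comp_apply, LinearMap.add_apply, nwordIncl_nword, LinearMap.flip_apply,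
    TensorProduct.mk_apply, reducedDeconcat]
  rw [← LinearMap.comp_apply (TensorProduct.map _ _), ← TensorProduct.map_comp, hιρ, hsub, hr, hl,
    LinearMap.lTensor_tmul, hε1, TensorProduct.tmul_zero]
  abel

theorem reduceMul_nword (a b : X) (v w : List X) :
    reduceMul wordMul (nword a v : NWordSpace K X) (nword b w) = nword a (v ++ b :: w) := by
  simp [reduceMul, nwordProj_cons]

theorem infCompat_reduceMul : InfCompat (reduceMul (K := K) (X := X) wordMul) reducedDeconcat :=
  UnitalCompat.infCompat nwordProj_comp_nwordIncl deconcat_nwordIncl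
    (nwordIncl_reduceMul fun x hx y _ => wordMul_mem hx y) wordMul_nil nil_wordMul
    unitalCompat_wordMul

theorem reducedDeconcat_letter (a : X) : reducedDeconcat (nword a [] : NWordSpace K X) = 0 := by
  rw [reducedDeconcat, LinearMap.comp_apply, LinearMap.comp_apply, nwordIncl_nword,
    deconcat_single]
  simp [nwordProj]

theorem isCoassoc_reducedDeconcat : IsCoassoc (reducedDeconcat (K := K) (X := X)) := by
  refine nwordSpace_ext fun a w => ?_
  induction w generalizing a with
  | nil => simp [reducedDeconcat_letter]
  | cons b w ih =>
    have := infCompat_reduceMul.coassoc_mul (x := (nword a [] : NWordSpace K X)) (y := nword b w)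
      (by simp [reducedDeconcat_letter]) (ih b)
    rwa [reduceMul_nword] at this

/-- A primitive combination of nonempty words is a combination of words with one letter. -/
theorem apply_eq_zero_of_reducedDeconcat {x : NWordSpace K X} (hx : reducedDeconcat x = 0)
    {a b : X} {w : List X} : x (a, b :: w) = 0 := by
  have h := deconcat_nwordIncl x
  rw [hx, map_zero, add_zero] at h
  have h1 := apply_eq_zero_of_primitive h (w := a :: b :: w) (by simp)
  have h2 : ∀ y : NWordSpace K X, nwordIncl y (a :: b :: w) = y (a, b :: w) := fun y => by
    classical
    induction y using Finsupp.induction_linear with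
    | zero => simp
    | add x y hx hy => simp [hx, hy]
    | single p c =>
      obtain ⟨p, q⟩ := p
      simp [nwordIncl, word, Finsupp.single_apply]
  rw [← h2, h1]

variable [Mul X]

/-- Concatenation and `↗` satisfy the relations of `P_↗` on nonempty words. -/
theorem wordPair : IsGraftPair (reduceMul (K := K) (X := X) wordMul) (reduceMul wordUp) := by
  have hm : ∀ x ∈ augmentation K X, ∀ y ∈ augmentation K X, wordMul x y ∈ augmentation K X :=
    fun x hx y _ => wordMul_mem hx y
  have hu : ∀ x ∈ augmentation K X, ∀ y ∈ augmentation K X, wordUp x y ∈ augmentation K X :=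
    fun x _ y hy => wordUp_mem x hy
  constructor <;> intro x y z <;> apply nwordIncl_injective
  · simp only [nwordIncl_reduceMul hm, nwordIncl_reduceMul hu,
      wordUp_wordMul _ (nwordIncl_mem y)]
  · simp only [nwordIncl_reduceMul hm, wordMul_assoc]
  · simp only [nwordIncl_reduceMul hu, wordUp_assoc]

theorem reduceUp_nword (a b : X) (w : List X) :
    reduceMul wordUp (nword a [] : NWordSpace K X) (nword b w) =
      nword (a * b) w + nword a (b :: w) := by
  simp [reduceMul, wordUp_cons, consUp, letterUp_cons, nwordProj_cons]

theorem infCompat_reduceUp : InfCompat (reduceMul (K := K) (X := X) wordUp) reducedDeconcat :=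
  UnitalCompat.infCompat nwordProj_comp_nwordIncl deconcat_nwordIncl
    (nwordIncl_reduceMul fun x _ y hy => wordUp_mem x hy) wordUp_nil nil_wordUp
    unitalCompat_wordUp

variable (K X) in
/-- The bialgebra of nonempty words in a magma. -/
def wordBialg : SymBialgOne K (NWordSpace K X) where
  alg := symAlg wordPair
  δ := reducedDeconcat
  coassoc := isCoassoc_reducedDeconcat
  compat_m := by rw [symAlg_bin_m]; exact infCompat_reduceMul
  compat_up := by rw [symAlg_bin_up]; exact infCompat_reduceUp

end NWord

/-! ### Left-admissible cuts -/

namespace PForest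

theorem append_nil (F : PForest) : append F nil = F := by
  induction F with
  | nil => rfl
  | cons G F _ ih => rw [append, ih]

theorem append_assoc (F G H : PForest) : append (append F G) H = append F (append G H) := by
  induction F with
  | nil => rfl
  | cons A B _ ih => simp only [append, ih]

theorem nil_graft (G : PForest) : graft nil G = G := by
  induction G with
  | nil => rfl
  | cons A B ih _ => simp only [graft, ih]

theorem graft_assoc (F G H : PForest) : graft (graft F G) H = graft F (graft G H) := by
  induction H with
  | nil => rfl
  | cons A B ih _ => simp only [graft, ih]

/-- The set of vertices of `B⁺(G) F` given by a set of vertices of `G`. -/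
def cutBelow (G F : PForest) (S : Set (Vert G)) : Set (Vert (cons G F)) :=
  {x : Option (Vert G) ⊕ Vert F | ∃ g ∈ S, x = .inl (some g)}

/-- The set of vertices of `B⁺(G) F` given by a set of vertices of `F` and by the whole of the
first tree. -/
def cutAfter (G F : PForest) (S : Set (Vert F)) : Set (Vert (cons G F)) :=
  {x : Option (Vert G) ⊕ Vert F | ∀ f, x = .inr f → f ∈ S}

/-- The root of the first tree. -/
def firstRoot (G F : PForest) : Vert (cons G F) := (.inl none : Option (Vert G) ⊕ Vert F)

theorem sub_cons_of_mem {G F : PForest} {S : Set (Vert (cons G F))} (h : firstRoot G F ∈ S) :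
    sub (cons G F) S = cons (sub G {v | (Sum.inl (some v) : Option (Vert G) ⊕ Vert F) ∈ S})
      (sub F {v | (Sum.inr v : Option (Vert G) ⊕ Vert F) ∈ S}) :=
  if_pos h

theorem sub_cons_of_notMem {G F : PForest} {S : Set (Vert (cons G F))} (h : firstRoot G F ∉ S) :
    sub (cons G F) S = append (sub G {v | (Sum.inl (some v) : Option (Vert G) ⊕ Vert F) ∈ S})
      (sub F {v | (Sum.inr v : Option (Vert G) ⊕ Vert F) ∈ S}) :=
  if_neg h

theorem sub_univ (F : PForest) : sub F Set.univ = F := by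
  induction F with
  | nil => rfl
  | cons G F ihG ihF =>
    rw [sub_cons_of_mem (Set.mem_univ _)]
    exact congrArg₂ cons ihG ihF

theorem sub_empty (F : PForest) : sub F ∅ = nil := by
  induction F with
  | nil => rfl
  | cons G F ihG ihF =>
    rw [sub_cons_of_notMem (Set.notMem_empty _)]
    exact (congrArg₂ append ihG ihF)

variable {G F : PForest}

theorem isLeftAdm_cutBelow {S : Set (Vert G)} (h : IsLeftAdm G S) :
    IsLeftAdm (cons G F) (cutBelow G F S) := by
  rintro _ ⟨a, ha, rfl⟩ y hy
  rcases y with (_ | b) | b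
  · rcases hy with hy | hy <;> exact hy.elim
  · exact ⟨b, h a ha b hy, rfl⟩
  · rcases hy with hy | hy <;> exact hy.elim

theorem isLeftAdm_cutAfter {S : Set (Vert F)} (h : IsLeftAdm F S) :
    IsLeftAdm (cons G F) (cutAfter G F S) := by
  rintro x hx y hy f rfl
  rcases x with (_ | a) | a
  · rcases hy with hy | hy <;> exact hy.elim
  · rcases hy with hy | hy <;> exact hy.elim
  · exact h a (hx a rfl) f hy

theorem IsLeftAdm.eq_cutBelow {S : Set (Vert (cons G F))} (h : IsLeftAdm (cons G F) S)
    (hr : firstRoot G F ∉ S) :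
    IsLeftAdm G {v | (Sum.inl (some v) : Option (Vert G) ⊕ Vert F) ∈ S} ∧
      cutBelow G F {v | (Sum.inl (some v) : Option (Vert G) ⊕ Vert F) ∈ S} = S := by
  refine ⟨fun x hx y hy => h _ hx (Sum.inl (some y) : Option (Vert G) ⊕ Vert F) hy, ?_⟩
  ext x
  constructor
  · rintro ⟨g, hg, rfl⟩; exact hg
  · intro hx
    rcases x with (_ | a) | a
    · exact absurd hx hr
    · exact ⟨a, hx, rfl⟩
    · exact absurd (h _ hx (firstRoot G F) (Or.inr trivial)) hr

theorem IsLeftAdm.eq_cutAfter {S : Set (Vert (cons G F))} (h : IsLeftAdm (cons G F) S)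
    (hr : firstRoot G F ∈ S) :
    IsLeftAdm F {v | (Sum.inr v : Option (Vert G) ⊕ Vert F) ∈ S} ∧
      cutAfter G F {v | (Sum.inr v : Option (Vert G) ⊕ Vert F) ∈ S} = S := by
  refine ⟨fun x hx y hy => h _ hx (Sum.inr y : Option (Vert G) ⊕ Vert F) hy, ?_⟩
  ext x
  constructor
  · intro hx
    rcases x with (_ | a) | a
    · exact hr
    · exact h _ hr (Sum.inl (some a) : Option (Vert G) ⊕ Vert F) (Or.inl trivial)
    · exact hx a rfl
  · rintro hx f rfl
    exact hx

theorem firstRoot_notMem_cutBelow (S : Set (Vert G)) : firstRoot G F ∉ cutBelow G F S := by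
  rintro ⟨g, _, h⟩
  exact Option.some_ne_none g (Sum.inl_injective h).symm

theorem firstRoot_mem_cutAfter (S : Set (Vert F)) : firstRoot G F ∈ cutAfter G F S :=
  fun _ h => Sum.noConfusion rfl rfl (heq_of_eq h)

theorem cutBelow_preimage (S : Set (Vert G)) :
    {v | (Sum.inl (some v) : Option (Vert G) ⊕ Vert F) ∈ cutBelow G F S} = S := by
  ext v
  constructor
  · rintro ⟨g, hg, h⟩
    cases h; exact hg
  · intro hv; exact ⟨v, hv, rfl⟩

theorem cutAfter_preimage (S : Set (Vert F)) :
    {v | (Sum.inr v : Option (Vert G) ⊕ Vert F) ∈ cutAfter G F S} = S := by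
  ext v
  constructor
  · intro h; exact h v rfl
  · rintro hv f h
    cases h; exact hv

theorem sub_cutBelow (S : Set (Vert G)) : sub (cons G F) (cutBelow G F S) = sub G S := by
  rw [sub_cons_of_notMem (firstRoot_notMem_cutBelow S), cutBelow_preimage]
  have : {v | (Sum.inr v : Option (Vert G) ⊕ Vert F) ∈ cutBelow G F S} = ∅ := by
    ext v
    simp only [Set.mem_ofPred_eq, Set.mem_empty_iff_false, iff_false]
    rintro ⟨g, _, h⟩
    cases h
  rw [this, sub_empty, append_nil]

theorem sub_cutBelow_compl (S : Set (Vert G)) :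
    sub (cons G F) (cutBelow G F S)ᶜ = cons (sub G Sᶜ) F := by
  rw [sub_cons_of_mem (firstRoot_notMem_cutBelow S)]
  have h1 : {v | (Sum.inl (some v) : Option (Vert G) ⊕ Vert F) ∈ (cutBelow G F S)ᶜ} = Sᶜ :=
    congrArg compl (cutBelow_preimage (F := F) S)
  have h2 : {v | (Sum.inr v : Option (Vert G) ⊕ Vert F) ∈ (cutBelow G F S)ᶜ} = Set.univ := by
    ext v
    simp only [Set.mem_ofPred_eq, Set.mem_univ, iff_true]
    rintro ⟨g, _, h⟩
    cases h
  rw [h1, h2, sub_univ]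

theorem sub_cutAfter (S : Set (Vert F)) :
    sub (cons G F) (cutAfter G F S) = cons G (sub F S) := by
  rw [sub_cons_of_mem (firstRoot_mem_cutAfter S), cutAfter_preimage]
  have : {v | (Sum.inl (some v) : Option (Vert G) ⊕ Vert F) ∈ cutAfter G F S} = Set.univ := by
    ext v
    simp only [Set.mem_ofPred_eq, Set.mem_univ, iff_true]
    rintro f h
    cases h
  rw [this, sub_univ]

theorem sub_cutAfter_compl (S : Set (Vert F)) :
    sub (cons G F) (cutAfter G F S)ᶜ = sub F Sᶜ := by
  rw [sub_cons_of_notMem (S := (cutAfter G F S)ᶜ) (not_not_intro (firstRoot_mem_cutAfter S))]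
  have h1 : {v | (Sum.inr v : Option (Vert G) ⊕ Vert F) ∈ (cutAfter G F S)ᶜ} = Sᶜ :=
    congrArg compl (cutAfter_preimage (G := G) S)
  have h2 : {v | (Sum.inl (some v) : Option (Vert G) ⊕ Vert F) ∈ (cutAfter G F S)ᶜ} = ∅ := by
    ext v
    simp only [Set.mem_ofPred_eq, Set.mem_empty_iff_false, iff_false]
    intro h
    exact h fun f h => by cases h
  rw [h1, h2, sub_empty]
  rfl

end PForest

/-! ### The infinitesimal bialgebra of forests -/

section Forests

variable {K : Type u} [Field K]

theorem hForest_induction {motive : HForest K → Prop} (x : HForest K)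
    (zero : motive 0) (add : ∀ x y, motive x → motive y → motive (x + y))
    (smul : ∀ (c : K) x, motive x → motive (c • x)) (forest : ∀ F, motive (ofForest F)) :
    motive x := by
  induction x using Finsupp.induction_linear with
  | zero => exact zero
  | add x y hx hy => exact add x y hx hy
  | single w c =>
    rw [show Finsupp.single w c = c • (ofForest w : HForest K) by simp [ofForest]]
    exact smul c _ (forest w)

theorem hForest_ext {E : Type*} [AddCommMonoid E] [Module K E] {f g : HForest K →ₗ[K] E}
    (h : ∀ F, f (ofForest F) = g (ofForest F)) : f = g :=
  Finsupp.lhom_ext' fun w => LinearMap.ext_ring (h w)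

theorem bilinExt_ofForest (f : PForest → PForest → PForest) (F G : PForest) :
    bilinExt (K := K) f (ofForest F) (ofForest G) = ofForest (f F G) := by
  simp [bilinExt, ofForest]

/-- The bilinear extension of `(G, F) ↦ B⁺(G) F`. -/
def consH : HForest K →ₗ[K] HForest K →ₗ[K] HForest K := bilinExt PForest.cons

theorem mulH_consH (a b y : HForest K) : mulH (consH a b) y = consH a (mulH b y) := by
  induction a using hForest_induction with
  | zero => simp
  | add x x' hx hx' => simp only [map_add, LinearMap.add_apply, hx, hx']
  | smul c x hx => simp only [map_smul, LinearMap.smul_apply, hx]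
  | forest A =>
    induction b using hForest_induction with
    | zero => simp
    | add x x' hx hx' => simp only [map_add, LinearMap.add_apply, hx, hx']
    | smul c x hx => simp only [map_smul, LinearMap.smul_apply, hx]
    | forest B =>
      induction y using hForest_induction with
      | zero => simp
      | add x x' hx hx' => simp only [map_add, hx, hx']
      | smul c x hx => simp only [map_smul, hx]
      | forest F => simp only [mulH, consH, bilinExt_ofForest, PForest.append]

theorem graftH_consH (x a b : HForest K) : graftH x (consH a b) = consH (graftH x a) b := by
  induction a using hForest_induction with
  | zero => simp
  | add x x' hx hx' => simp only [map_add, LinearMap.add_apply, hx, hx']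
  | smul c x hx => simp only [map_smul, LinearMap.smul_apply, hx]
  | forest A =>
    induction b using hForest_induction with
    | zero => simp
    | add x x' hx hx' => simp only [map_add, hx, hx']
    | smul c x hx => simp only [map_smul, hx]
    | forest B =>
      induction x using hForest_induction with
      | zero => simp
      | add x x' hx hx' => simp only [map_add, LinearMap.add_apply, hx, hx']
      | smul c x hx => simp only [map_smul, LinearMap.smul_apply, hx]
      | forest F => simp only [graftH, consH, bilinExt_ofForest, PForest.graft]

theorem nil_mulH (x : HForest K) : mulH (ofForest .nil) x = x :=
  congrArg (fun f => f x) (hForest_ext (f := mulH (ofForest .nil)) (g := LinearMap.id)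
    fun F => by rw [mulH, bilinExt_ofForest]; rfl)

theorem mulH_nil (x : HForest K) : mulH x (ofForest .nil) = x :=
  congrArg (fun f => f x) (hForest_ext (f := mulH.flip (ofForest .nil)) (g := LinearMap.id)
    fun F => by rw [LinearMap.flip_apply, mulH, bilinExt_ofForest, PForest.append_nil]; rfl)

theorem nil_graftH (x : HForest K) : graftH (ofForest .nil) x = x :=
  congrArg (fun f => f x) (hForest_ext (f := graftH (ofForest .nil)) (g := LinearMap.id)
    fun F => by rw [graftH, bilinExt_ofForest, PForest.nil_graft]; rfl)

theorem graftH_nil (x : HForest K) : graftH x (ofForest .nil) = x :=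
  congrArg (fun f => f x) (hForest_ext (f := graftH.flip (ofForest .nil)) (g := LinearMap.id)
    fun F => by rw [LinearMap.flip_apply, graftH, bilinExt_ofForest]; rfl)

theorem bilinExt_assoc {f : PForest → PForest → PForest} (h : ∀ F G H, f (f F G) H = f F (f G H))
    (x y z : HForest K) :
    bilinExt f (bilinExt f x y) z = bilinExt f x (bilinExt f y z) := by
  induction x using hForest_induction with
  | zero => simp
  | add x x' hx hx' => simp only [map_add, LinearMap.add_apply, hx, hx']
  | smul c x hx => simp only [map_smul, LinearMap.smul_apply, hx]
  | forest A =>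
    induction y using hForest_induction with
    | zero => simp
    | add x x' hx hx' => simp only [map_add, LinearMap.add_apply, hx, hx']
    | smul c x hx => simp only [map_smul, LinearMap.smul_apply, hx]
    | forest B =>
      induction z using hForest_induction with
      | zero => simp
      | add x x' hx hx' => simp only [map_add, hx, hx']
      | smul c x hx => simp only [map_smul, hx]
      | forest F => simp only [bilinExt_ofForest, h]

theorem mulH_assoc (x y z : HForest K) : mulH (mulH x y) z = mulH x (mulH y z) :=
  bilinExt_assoc PForest.append_assoc x y z

theorem graftH_assoc (x y z : HForest K) : graftH (graftH x y) z = graftH x (graftH y z) :=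
  bilinExt_assoc PForest.graft_assoc x y z

open scoped Classical in
theorem coprodH_ofForest (F : PForest) : coprodH (ofForest F : HForest K) =
    ∑ S : Set (PForest.Vert F) with PForest.IsLeftAdm F S,
      ofForest (PForest.sub F S) ⊗ₜ[K] ofForest (PForest.sub F Sᶜ) := by
  rw [coprodH, ofForest, Finsupp.linearCombination_single, one_smul]

theorem coprodH_nil : coprodH (ofForest .nil : HForest K) =
    ofForest .nil ⊗ₜ ofForest .nil := by
  classical
  rw [coprodH_ofForest]
  have h : ∀ S : Set (PForest.Vert .nil), S = ∅ := fun S =>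
    Set.eq_empty_of_forall_notMem fun x => x.elim
  rw [Finset.sum_eq_single ∅]
  · rfl
  · intro S _ hS; exact absurd (h S) hS
  · intro hS
    simp only [Finset.mem_filter, Finset.mem_univ, true_and] at hS
    exact absurd (fun x hx => hx.elim) hS

/-- A left-admissible cut of `B⁺(G) F` either leaves the first root below it, and then it is a cut
of `G`, or contains the root, hence the whole first tree, and then it is a cut of `F`. -/
theorem coprodH_cons_forest (G F : PForest) : coprodH (ofForest (.cons G F) : HForest K) =
    (consH.flip (ofForest F)).lTensor _ (coprodH (ofForest G)) +
      (consH (ofForest G)).rTensor _ (coprodH (ofForest F)) := by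
  classical
  rw [coprodH_ofForest, ← Finset.sum_filter_not_add_sum_filter _
    (fun S => PForest.firstRoot G F ∈ S)]
  congr 1
  · rw [coprodH_ofForest, map_sum]
    refine (Finset.sum_bij' (fun S _ => PForest.cutBelow G F S)
      (fun S _ => {v | (Sum.inl (some v) : Option (PForest.Vert G) ⊕ PForest.Vert F) ∈ S})
      ?_ ?_ ?_ ?_ ?_).symm
    · intro S hS
      simp only [Finset.mem_filter, Finset.mem_univ, true_and] at hS ⊢
      exact ⟨PForest.isLeftAdm_cutBelow hS, PForest.firstRoot_notMem_cutBelow S⟩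
    · intro S hS
      simp only [Finset.mem_filter, Finset.mem_univ, true_and] at hS ⊢
      exact (hS.1.eq_cutBelow hS.2).1
    · intro S _; exact PForest.cutBelow_preimage S
    · intro S hS
      simp only [Finset.mem_filter, Finset.mem_univ, true_and] at hS
      exact (hS.1.eq_cutBelow hS.2).2
    · intro S _
      rw [PForest.sub_cutBelow, PForest.sub_cutBelow_compl, LinearMap.lTensor_tmul,
        LinearMap.flip_apply, consH, bilinExt_ofForest]
  · rw [coprodH_ofForest, map_sum]
    refine (Finset.sum_bij' (fun S _ => PForest.cutAfter G F S)
      (fun S _ => {v | (Sum.inr v : Option (PForest.Vert G) ⊕ PForest.Vert F) ∈ S})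
      ?_ ?_ ?_ ?_ ?_).symm
    · intro S hS
      simp only [Finset.mem_filter, Finset.mem_univ, true_and] at hS ⊢
      exact ⟨PForest.isLeftAdm_cutAfter hS, PForest.firstRoot_mem_cutAfter S⟩
    · intro S hS
      simp only [Finset.mem_filter, Finset.mem_univ, true_and] at hS ⊢
      exact (hS.1.eq_cutAfter hS.2).1
    · intro S _; exact PForest.cutAfter_preimage S
    · intro S hS
      simp only [Finset.mem_filter, Finset.mem_univ, true_and] at hS
      exact (hS.1.eq_cutAfter hS.2).2
    · intro S _
      rw [PForest.sub_cutAfter, PForest.sub_cutAfter_compl, LinearMap.rTensor_tmul,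
        consH, bilinExt_ofForest]

theorem coprodH_consH (a b : HForest K) : coprodH (consH a b) =
    (consH.flip b).lTensor _ (coprodH a) + (consH a).rTensor _ (coprodH b) := by
  induction a using hForest_induction with
  | zero => simp
  | add x x' hx hx' =>
    simp only [map_add, LinearMap.add_apply, hx, hx', LinearMap.rTensor_add]; abel
  | smul c x hx =>
    simp only [map_smul, LinearMap.smul_apply, hx, LinearMap.rTensor_smul, smul_add]
  | forest A =>
    induction b using hForest_induction with
    | zero => simp
    | add x x' hx hx' =>
      simp only [map_add, LinearMap.add_apply, hx, hx', LinearMap.lTensor_add]; abel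
    | smul c x hx =>
      simp only [map_smul, LinearMap.smul_apply, hx, LinearMap.lTensor_smul, smul_add]
    | forest B =>
      rw [consH, bilinExt_ofForest]
      exact coprodH_cons_forest A B

theorem unitalCompat_mulH (x y : HForest K) : UnitalCompat mulH coprodH x y := by
  induction x using hForest_induction with
  | zero => simp [UnitalCompat]
  | add x x' hx hx' =>
    unfold UnitalCompat at *
    simp only [map_add, LinearMap.add_apply, hx, hx', LinearMap.rTensor_add,
      TensorProduct.add_tmul]; abel
  | smul c x hx =>
    unfold UnitalCompat at *
    simp only [map_smul, LinearMap.smul_apply, hx, LinearMap.rTensor_smul,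
      ← TensorProduct.smul_tmul', smul_sub, smul_add]
  | forest F =>
    induction F with
    | nil =>
      have : mulH (K := K) (ofForest .nil) = LinearMap.id := LinearMap.ext nil_mulH
      rw [UnitalCompat, this, coprodH_nil]
      simp only [LinearMap.id_apply, LinearMap.rTensor_id, LinearMap.lTensor_tmul,
        LinearMap.flip_apply, nil_mulH]
      abel
    | cons A B _ ih =>
      have h : (ofForest (.cons A B) : HForest K) = consH (ofForest A) (ofForest B) := by
        rw [consH, bilinExt_ofForest]
      generalize (ofForest A : HForest K) = a at h
      generalize (ofForest B : HForest K) = b at h ih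
      rw [h]
      have h1 : mulH (consH a b) = consH a ∘ₗ mulH b := LinearMap.ext fun z => mulH_consH a b z
      have h2 : consH.flip (mulH b y) = mulH.flip y ∘ₗ consH.flip b :=
        LinearMap.ext fun z => (mulH_consH z b y).symm
      unfold UnitalCompat at *
      rw [mulH_consH, coprodH_consH, coprodH_consH, ih, h1, h2]
      simp only [map_add, map_sub, LinearMap.rTensor_comp, LinearMap.lTensor_comp,
        LinearMap.comp_apply, rTensor_lTensor_comm, LinearMap.rTensor_tmul]
      abel

theorem unitalCompat_graftH (x y : HForest K) : UnitalCompat graftH coprodH x y := by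
  induction y using hForest_induction with
  | zero => simp [UnitalCompat]
  | add y y' hy hy' =>
    unfold UnitalCompat at *
    simp only [map_add, hy, hy', LinearMap.lTensor_add, LinearMap.add_apply,
      TensorProduct.tmul_add]; abel
  | smul c y hy =>
    unfold UnitalCompat at *
    simp only [map_smul, hy, LinearMap.lTensor_smul, LinearMap.smul_apply,
      TensorProduct.tmul_smul, smul_sub, smul_add]
  | forest F =>
    induction F with
    | nil =>
      have : (graftH (K := K)).flip (ofForest .nil) = LinearMap.id := LinearMap.ext graftH_nil
      rw [UnitalCompat, this, coprodH_nil, graftH_nil]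
      simp only [LinearMap.id_apply, LinearMap.lTensor_id, LinearMap.rTensor_tmul, graftH_nil]
      abel
    | cons A B ih _ =>
      have h : (ofForest (.cons A B) : HForest K) = consH (ofForest A) (ofForest B) := by
        rw [consH, bilinExt_ofForest]
      generalize (ofForest A : HForest K) = a at h ih
      generalize (ofForest B : HForest K) = b at h
      rw [h]
      have h1 : consH (graftH x a) = graftH x ∘ₗ consH a :=
        LinearMap.ext fun z => (graftH_consH x a z).symm
      have h2 : graftH.flip (consH a b) = consH.flip b ∘ₗ graftH.flip a :=
        LinearMap.ext fun z => graftH_consH z a b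
      unfold UnitalCompat at *
      rw [graftH_consH, coprodH_consH, coprodH_consH, ih, h1, h2]
      simp only [map_add, map_sub, LinearMap.rTensor_comp, LinearMap.lTensor_comp,
        LinearMap.comp_apply, rTensor_lTensor_comm, LinearMap.lTensor_tmul, LinearMap.flip_apply]
      abel

/-! ### The primitive forests -/

/-- The binary trees are the free magma on one generator. -/
instance : Mul BinTree := ⟨.node⟩

/-- The elements `q_{t₁ ∨ t₂} = q_{t₁} ↗ q_{t₂} - q_{t₁} q_{t₂}`, equal to the `p_t` up to sign. -/
def qElem : BinTree → HForest K
  | .leaf => ofForest (.cons .nil .nil)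
  | .node t₁ t₂ => graftH (qElem t₁) (qElem t₂) - mulH (qElem t₁) (qElem t₂)

/-- The sign `(-1)^k`, where `k` is the number of internal vertices. -/
def treeSign (K : Type u) [Field K] : BinTree → Kˣ
  | .leaf => 1
  | .node t₁ t₂ => -(treeSign K t₁ * treeSign K t₂)

theorem qElem_eq (t : BinTree) : (qElem t : HForest K) = treeSign K t • pElem t := by
  induction t with
  | leaf => simp [qElem, pElem, treeSign]
  | node t₁ t₂ h₁ h₂ =>
    rw [qElem, pElem, treeSign, h₁, h₂]
    simp only [Units.smul_def, map_smul, LinearMap.smul_apply, Units.val_neg, Units.val_mul,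
      neg_smul, smul_sub, smul_smul]
    rw [mul_comm]
    abel

/-- Products of the `q_t`. -/
def qWord : List BinTree → HForest K
  | [] => ofForest .nil
  | t :: w => mulH (qElem t) (qWord w)

/-- The map from words in binary trees to forests. -/
def wordToForest : WordSpace K BinTree →ₗ[K] HForest K := wordLift qWord

theorem wordToForest_nil : wordToForest (word [] : WordSpace K BinTree) = ofForest .nil := by
  simp [wordToForest, qWord]

theorem wordToForest_cons (t : BinTree) (w : List BinTree) :
    wordToForest (word (t :: w) : WordSpace K BinTree) = mulH (qElem t) (wordToForest (word w)) := by
  simp [wordToForest, qWord]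

/-- `q_t` has no constant term: it is a combination of nonempty forests. -/
theorem qElem_mem_range (t : BinTree) :
    (qElem t : HForest K) ∈ Submodule.span K {x | ∃ a b : HForest K, x = consH a b} := by
  induction t with
  | leaf =>
    refine Submodule.subset_span ⟨ofForest .nil, ofForest .nil, ?_⟩
    rw [consH, bilinExt_ofForest, qElem]
  | node t₁ t₂ h₁ h₂ =>
    rw [qElem]
    refine Submodule.sub_mem _ ?_ ?_
    · generalize (qElem t₂ : HForest K) = y at h₂
      induction h₂ using Submodule.span_induction with
      | mem x hx =>
        obtain ⟨a, b, rfl⟩ := hx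
        rw [graftH_consH]
        exact Submodule.subset_span ⟨_, _, rfl⟩
      | zero => rw [map_zero]; exact Submodule.zero_mem _
      | add x y _ _ hx hy => rw [map_add]; exact Submodule.add_mem _ hx hy
      | smul c x _ hx => rw [map_smul]; exact Submodule.smul_mem _ _ hx
    · generalize (qElem t₁ : HForest K) = y at h₁
      induction h₁ using Submodule.span_induction with
      | mem x hx =>
        obtain ⟨a, b, rfl⟩ := hx
        rw [mulH_consH]
        exact Submodule.subset_span ⟨_, _, rfl⟩
      | zero => rw [map_zero]; exact Submodule.zero_mem _
      | add x y _ _ hx hy => rw [map_add]; exact Submodule.add_mem _ hx hy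
      | smul c x _ hx => rw [map_smul]; exact Submodule.smul_mem _ _ hx

/-- The relation `x ↗ (y z) = (x ↗ y) z` holds when `y` has no constant term. -/
theorem graftH_qElem_mulH (x : HForest K) (t : BinTree) (z : HForest K) :
    graftH x (mulH (qElem t) z) = mulH (graftH x (qElem t)) z := by
  refine (Submodule.span_le (p := LinearMap.eqLocus (graftH x ∘ₗ mulH.flip z)
    (mulH.flip z ∘ₗ graftH x))).mpr ?_ (qElem_mem_range t)
  rintro _ ⟨a, b, rfl⟩
  change graftH x (mulH (consH a b) z) = mulH (graftH x (consH a b)) z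
  rw [mulH_consH, graftH_consH, graftH_consH, mulH_consH]

theorem wordToForest_mul (x y : WordSpace K BinTree) :
    wordToForest (wordMul x y) = mulH (wordToForest x) (wordToForest y) := by
  induction x using wordSpace_induction with
  | zero => simp
  | add x x' hx hx' => simp only [map_add, LinearMap.add_apply, hx, hx']
  | smul c x hx => simp only [map_smul, LinearMap.smul_apply, hx]
  | word u =>
    induction y using wordSpace_induction with
    | zero => simp
    | add x x' hx hx' => simp only [map_add, hx, hx']
    | smul c x hx => simp only [map_smul, hx]
    | word v =>
      rw [wordMul_word]
      induction u with
      | nil => rw [List.nil_append, wordToForest_nil, nil_mulH]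
      | cons t u ih => rw [List.cons_append, wordToForest_cons, wordToForest_cons, ih, mulH_assoc]

theorem wordToForest_letterUp (t : BinTree) (y : WordSpace K BinTree) :
    wordToForest (letterUp t y) = graftH (qElem t) (wordToForest y) := by
  induction y using wordSpace_induction with
  | zero => simp
  | add x x' hx hx' => simp only [map_add, hx, hx']
  | smul c x hx => simp only [map_smul, hx]
  | word v =>
    rcases v with _ | ⟨s, v⟩
    · rw [letterUp_nil, wordToForest_cons, wordToForest_nil, mulH_nil, graftH_nil]
    · rw [letterUp_cons, map_add, wordToForest_cons, wordToForest_cons, wordToForest_cons,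
        graftH_qElem_mulH, ← mulH_assoc, show (qElem (t * s) : HForest K) =
          graftH (qElem t) (qElem s) - mulH (qElem t) (qElem s) from rfl, map_sub,
        LinearMap.sub_apply, sub_add_cancel]

theorem wordToForest_up (x y : WordSpace K BinTree) :
    wordToForest (wordUp x y) = graftH (wordToForest x) (wordToForest y) := by
  induction x using wordSpace_induction with
  | zero => simp
  | add x x' hx hx' => simp only [map_add, LinearMap.add_apply, hx, hx']
  | smul c x hx => simp only [map_smul, LinearMap.smul_apply, hx]
  | word u =>
    rcases u with _ | ⟨t, w⟩
    · rw [nil_wordUp, wordToForest_nil, nil_graftH]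
    · induction w generalizing t with
      | nil =>
        rw [wordUp_cons, consUp, wordToForest_letterUp, wordToForest_cons, wordToForest_nil,
          mulH_nil]
      | cons s w ih =>
        have h : (word (t :: s :: w) : WordSpace K BinTree) =
            letterUp t (word (s :: w)) - word ((t * s) :: w) := by
          rw [letterUp_cons, add_sub_cancel_left]
        rw [wordUp_cons_cons, map_sub, wordToForest_letterUp, ih, ih, h, map_sub,
          wordToForest_letterUp, map_sub, LinearMap.sub_apply, graftH_assoc]

/-- The combination of words in binary trees given by a forest, by `B⁺(G) F = (G ↗ •) F`. -/
def forestWord : PForest → WordSpace K BinTree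
  | .nil => word []
  | .cons G F => wordMul (wordUp (forestWord G) (word [.leaf])) (forestWord F)

/-- The inverse of the map from words in binary trees to forests. -/
def forestToWord : HForest K →ₗ[K] WordSpace K BinTree := Finsupp.linearCombination K forestWord

theorem forestToWord_ofForest (F : PForest) :
    forestToWord (ofForest F : HForest K) = forestWord F := by
  simp [forestToWord, ofForest]

theorem forestToWord_mul (x y : HForest K) :
    forestToWord (mulH x y) = wordMul (forestToWord x) (forestToWord y) := by
  induction x using hForest_induction with
  | zero => simp
  | add x x' hx hx' => simp only [map_add, LinearMap.add_apply, hx, hx']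
  | smul c x hx => simp only [map_smul, LinearMap.smul_apply, hx]
  | forest F =>
    induction y using hForest_induction with
    | zero => simp
    | add x x' hx hx' => simp only [map_add, hx, hx']
    | smul c x hx => simp only [map_smul, hx]
    | forest G =>
      rw [mulH, bilinExt_ofForest, forestToWord_ofForest, forestToWord_ofForest,
        forestToWord_ofForest]
      induction F with
      | nil => rw [PForest.append, forestWord, nil_wordMul]
      | cons A B _ ih => rw [PForest.append, forestWord, forestWord, ih, wordMul_assoc]

theorem forestToWord_graft (x y : HForest K) :
    forestToWord (graftH x y) = wordUp (forestToWord x) (forestToWord y) := by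
  induction x using hForest_induction with
  | zero => simp
  | add x x' hx hx' => simp only [map_add, LinearMap.add_apply, hx, hx']
  | smul c x hx => simp only [map_smul, LinearMap.smul_apply, hx]
  | forest F =>
    induction y using hForest_induction with
    | zero => simp
    | add x x' hx hx' => simp only [map_add, hx, hx']
    | smul c x hx => simp only [map_smul, hx]
    | forest G =>
      rw [graftH, bilinExt_ofForest, forestToWord_ofForest, forestToWord_ofForest,
        forestToWord_ofForest]
      induction G with
      | nil => rw [PForest.graft, forestWord, wordUp_nil]
      | cons A B ih _ =>
        rw [PForest.graft, forestWord, forestWord, ih, wordUp_assoc,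
          wordUp_wordMul _ (wordUp_mem _ (word_cons_mem _ _))]

theorem forestToWord_qElem (t : BinTree) : forestToWord (qElem t : HForest K) = word [t] := by
  induction t with
  | leaf =>
    rw [qElem, forestToWord_ofForest, forestWord, forestWord, nil_wordUp, wordMul_nil]
  | node t₁ t₂ h₁ h₂ =>
    rw [qElem, map_sub, forestToWord_graft, forestToWord_mul, h₁, h₂, wordUp_cons, consUp,
      letterUp_cons, wordMul_word]
    exact add_sub_cancel_right _ _

theorem forestToWord_wordToForest (x : WordSpace K BinTree) :
    forestToWord (wordToForest x) = x := by
  refine congrArg (fun f => f x) (wordSpace_ext (f := forestToWord ∘ₗ wordToForest)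
    (g := LinearMap.id) fun w => ?_)
  simp only [LinearMap.comp_apply, LinearMap.id_apply]
  induction w with
  | nil => rw [wordToForest_nil, forestToWord_ofForest, forestWord]
  | cons t w ih =>
    rw [wordToForest_cons, forestToWord_mul, ih, forestToWord_qElem, wordMul_word]; rfl

theorem wordToForest_forestToWord (x : HForest K) : wordToForest (forestToWord x) = x := by
  refine congrArg (fun f => f x) (hForest_ext (f := wordToForest ∘ₗ forestToWord)
    (g := LinearMap.id) fun F => ?_)
  simp only [LinearMap.comp_apply, LinearMap.id_apply, forestToWord_ofForest]
  induction F with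
  | nil => rw [forestWord, wordToForest_nil]
  | cons A B hA hB =>
    rw [forestWord, wordToForest_mul, wordToForest_up, hA, hB, wordToForest_cons,
      wordToForest_nil, mulH_nil, qElem, graftH, bilinExt_ofForest, mulH, bilinExt_ofForest]
    rfl

theorem coprodH_qElem (t : BinTree) : coprodH (qElem t : HForest K) =
    qElem t ⊗ₜ ofForest .nil + ofForest .nil ⊗ₜ qElem t := by
  induction t with
  | leaf =>
    rw [qElem, coprodH_cons_forest, coprodH_nil]
    simp only [LinearMap.lTensor_tmul, LinearMap.rTensor_tmul, LinearMap.flip_apply, consH,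
      bilinExt_ofForest]
    abel
  | node t₁ t₂ h₁ h₂ =>
    have e1 := unitalCompat_mulH (qElem t₁ : HForest K) (qElem t₂)
    have e2 := unitalCompat_graftH (qElem t₁ : HForest K) (qElem t₂)
    unfold UnitalCompat at e1 e2
    rw [qElem, map_sub, e1, e2, h₁, h₂]
    simp only [map_add, LinearMap.rTensor_tmul, LinearMap.lTensor_tmul, LinearMap.flip_apply,
      nil_mulH, mulH_nil, nil_graftH, graftH_nil, TensorProduct.sub_tmul, TensorProduct.tmul_sub]
    abel

/-- Deconcatenation of words in binary trees is the coproduct of forests. -/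
theorem coprodH_wordToForest (x : WordSpace K BinTree) : coprodH (wordToForest x) =
    TensorProduct.map wordToForest wordToForest (deconcat x) := by
  refine congrArg (fun f => f x) (wordSpace_ext (f := coprodH ∘ₗ wordToForest)
    (g := TensorProduct.map wordToForest wordToForest ∘ₗ deconcat) fun w => ?_)
  simp only [LinearMap.comp_apply]
  induction w with
  | nil => rw [wordToForest_nil, coprodH_nil, deconcat_nil, TensorProduct.map_tmul,
      wordToForest_nil]
  | cons t w ih =>
    have e := unitalCompat_mulH (qElem t : HForest K) (wordToForest (word w))
    unfold UnitalCompat at e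
    have h : ∀ s, TensorProduct.map wordToForest wordToForest
        ((wordMul (word [t] : WordSpace K BinTree)).rTensor _ s) =
          (mulH (qElem t)).rTensor _ (TensorProduct.map wordToForest wordToForest s) := fun s => by
      rw [← LinearMap.comp_apply, ← LinearMap.comp_apply, LinearMap.map_comp_rTensor,
        LinearMap.rTensor_comp_map]
      congr 2
      refine LinearMap.ext fun z => ?_
      rw [LinearMap.comp_apply, wordToForest_mul, wordToForest_cons, wordToForest_nil, mulH_nil]
      rfl
    rw [wordToForest_cons, e, ih, deconcat_cons, map_add, h, coprodH_qElem,
      TensorProduct.map_tmul, wordToForest_nil, wordToForest_cons]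
    simp only [map_add, LinearMap.lTensor_tmul, LinearMap.flip_apply, nil_mulH]
    abel

theorem mem_primH {x : HForest K} :
    x ∈ primH K ↔ coprodH x = x ⊗ₜ ofForest .nil + ofForest .nil ⊗ₜ x := Iff.rfl

theorem span_qElem : Submodule.span K (Set.range (qElem (K := K))) = primH K := by
  apply le_antisymm
  · rw [Submodule.span_le]
    rintro _ ⟨t, rfl⟩
    exact mem_primH.mpr (coprodH_qElem t)
  · intro x hx
    rw [mem_primH] at hx
    obtain ⟨z, rfl⟩ : ∃ z, wordToForest z = x := ⟨_, wordToForest_forestToWord x⟩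
    have hz : deconcat z = z ⊗ₜ word [] + word [] ⊗ₜ z := by
      have hinj : Function.Injective (TensorProduct.map (wordToForest (K := K)) wordToForest) :=
        Function.LeftInverse.injective (g := TensorProduct.map forestToWord forestToWord)
          fun t => by
            rw [← LinearMap.comp_apply, ← TensorProduct.map_comp,
              show forestToWord ∘ₗ wordToForest = (LinearMap.id : WordSpace K BinTree →ₗ[K] _)
                from LinearMap.ext forestToWord_wordToForest, TensorProduct.map_id]
            rfl
      apply hinj
      rw [← coprodH_wordToForest, hx, map_add, TensorProduct.map_tmul, TensorProduct.map_tmul,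
        wordToForest_nil]
    rw [wordToForest, wordLift, Finsupp.linearCombination_apply]
    refine Submodule.finsuppSum_mem _ _ _ _ fun w hw => Submodule.smul_mem _ _ ?_
    have hlen : w.length = 1 := by
      by_contra h
      exact hw (apply_eq_zero_of_primitive hz h)
    obtain ⟨t, rfl⟩ := List.length_eq_one_iff.mp hlen
    rw [qWord, qWord, mulH_nil]
    exact Submodule.subset_span ⟨t, rfl⟩

theorem linearIndependent_qElem : LinearIndependent K (qElem (K := K)) := by
  refine LinearIndependent.of_comp forestToWord ?_
  have h : (forestToWord ∘ qElem : BinTree → WordSpace K BinTree) =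
      (fun w => Finsupp.single w (1 : K)) ∘ fun t => [t] :=
    funext fun t => forestToWord_qElem t
  rw [h]
  exact (Finsupp.linearIndependent_single_one K (List BinTree)).comp _
    fun s t h => by simpa using h

/-- The `p_t` are a basis of the space of primitive elements of `H`. -/
theorem pElem_basis : LinearIndependent K (pElem (K := K)) ∧
    Submodule.span K (Set.range (pElem (K := K))) = primH K := by
  have hq : (qElem (K := K)) = treeSign K • pElem := funext qElem_eq
  constructor
  · have h := linearIndependent_qElem (K := K)
    rwa [hq, LinearIndependent.units_smul_iff] at h
  · rw [← span_qElem, hq]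
    apply le_antisymm <;> rw [Submodule.span_le]
    · rintro _ ⟨t, rfl⟩
      have : pElem t = ((treeSign K t)⁻¹ : Kˣ) • (treeSign K • pElem (K := K)) t := by
        simp
      rw [this]
      exact Submodule.smul_mem _ _ (Submodule.subset_span ⟨t, rfl⟩)
    · rintro _ ⟨t, rfl⟩
      exact Submodule.smul_mem _ _ (Submodule.subset_span ⟨t, rfl⟩)

end Forests

/-! ### Binary compositions -/

namespace NSOperad

variable {K : Type u} [Field K] {P : NSOperad K}

theorem comp_congr {n : ℕ} {k k' : Fin n → ℕ} (hk : ∀ i, k i = k' i) {N : ℕ} (h : ∑ i, k i = N)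
    (h' : ∑ i, k' i = N) (p : P.obj n) {r : ∀ i, P.obj (k i)} {r' : ∀ i, P.obj (k' i)}
    (hr : ∀ i, HEq (r i) (r' i)) : P.comp k h p r = P.comp k' h' p r' := by
  obtain rfl : k = k' := funext hk
  obtain rfl : r = r' := funext fun i => eq_of_heq (hr i)
  rfl

/-- `1 ∘ r = r`, for an arity function on `Fin 1` which need not be syntactically constant. -/
theorem one_comp' {k : Fin 1 → ℕ} {N : ℕ} (h : ∑ i, k i = N) (r : ∀ i, P.obj (k i)) :
    ∃ e : k 0 = N, P.comp k h P.one r = e ▸ r 0 := by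
  obtain rfl : k 0 = N := by rw [← h, Fin.sum_univ_one]
  refine ⟨rfl, (comp_congr (k' := fun _ => k 0) (fun i => ?_) h (by simp) P.one
    (r' := fun _ => r 0) fun i => ?_).trans (P.one_comp _ _)⟩
  · rw [Subsingleton.elim i 0]
  · obtain rfl := Subsingleton.elim i 0; rfl

/-- A relation `p ∘ (q, 1) = r ∘ (1, s)` between binary operations holds for all arguments. -/
theorem comp₂_comp₂ {p q r s : P.obj 2}
    (rel : P.comp₂ (b := 1) (N := 3) rfl p q P.one = P.comp₂ (a := 1) (N := 3) rfl r P.one s)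
    {a b c ab bc N : ℕ} (h₁ : a + b = ab) (h₂ : ab + c = N) (h₃ : b + c = bc) (h₄ : a + bc = N)
    (x : P.obj a) (y : P.obj b) (z : P.obj c) :
    P.comp₂ h₂ p (P.comp₂ h₁ q x y) z = P.comp₂ h₄ r x (P.comp₂ h₃ s y z) := by
  subst h₁ h₃ h₂
  let l : Fin 3 → ℕ := Fin.cases a (arities b c)
  have hl : ∑ i, l i = a + b + c := by
    rw [Fin.sum_univ_three]; rfl
  let w : ∀ i, P.obj (l i) := fun i => Fin.cases (motive := fun i => P.obj (l i)) x
    (fun i => Fin.cases (motive := fun i => P.obj (arities b c i)) y (fun _ => z) i) i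
  have b00 : block (arities 2 1) (sum_arities rfl) ⟨0, (0 : Fin 2)⟩ = (0 : Fin 3) :=
    block_arities_zero (a := 2) (b := 1) rfl 0
  have b01 : block (arities 2 1) (sum_arities rfl) ⟨0, (1 : Fin 2)⟩ = (1 : Fin 3) :=
    block_arities_zero (a := 2) (b := 1) rfl 1
  have b10 : block (arities 2 1) (sum_arities rfl) ⟨1, (0 : Fin 1)⟩ = (2 : Fin 3) :=
    block_arities_one (a := 2) (b := 1) rfl 0
  have c00 : block (arities 1 2) (sum_arities rfl) ⟨0, (0 : Fin 1)⟩ = (0 : Fin 3) :=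
    block_arities_zero (a := 1) (b := 2) rfl 0
  have c10 : block (arities 1 2) (sum_arities rfl) ⟨1, (0 : Fin 2)⟩ = (1 : Fin 3) :=
    block_arities_one (a := 1) (b := 2) rfl 0
  have c11 : block (arities 1 2) (sum_arities rfl) ⟨1, (1 : Fin 2)⟩ = (2 : Fin 3) :=
    block_arities_one (a := 1) (b := 2) rfl 1
  have hw : ∀ {i j : Fin 3}, i = j → HEq (w i) (w j) := fun h => by rw [h]
  have key := congrArg (fun t => P.comp l hl t w) rel
  have hl2 : ∀ i, ∑ j, l (block (arities 2 1) (sum_arities rfl) ⟨i, j⟩) = arities (a + b) c i := by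
    intro i
    fin_cases i
    · refine (Fin.sum_univ_two _).trans ?_
      exact congrArg₂ (· + ·) (congrArg l b00) (congrArg l b01)
    · refine (Fin.sum_univ_one _).trans ?_
      exact congrArg l b10
  have hl1 : ∀ i, ∑ j, l (block (arities 1 2) (sum_arities rfl) ⟨i, j⟩) = arities a (b + c) i := by
    intro i
    fin_cases i
    · refine (Fin.sum_univ_one _).trans ?_
      exact congrArg l c00
    · refine (Fin.sum_univ_two _).trans ?_
      exact congrArg₂ (· + ·) (congrArg l c10) (congrArg l c11)
  have e1 := P.assoc (arities 2 1) (sum_arities rfl) l hl (arities (a + b) c) hl2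
    (sum_arities rfl) p (fun i => Fin.cases (motive := fun i => P.obj (arities 2 1 i)) q
      (fun _ => P.one) i) w
  have e2 := P.assoc (arities 1 2) (sum_arities rfl) l hl (arities a (b + c)) hl1
    (sum_arities h₄) r (fun i => Fin.cases (motive := fun i => P.obj (arities 1 2 i)) P.one
      (fun _ => s) i) w
  refine Eq.trans ?_ ((e1.symm.trans key).trans (e2.trans ?_))
  · refine congrArg (P.comp _ _ p) (funext fun i => ?_)
    fin_cases i
    · refine comp_congr (fun j => ?_) _ _ q fun j => ?_
      · fin_cases j
        · exact (congrArg l b00).symm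
        · exact (congrArg l b01).symm
      · fin_cases j
        · exact (hw b00).symm
        · exact (hw b01).symm
    · refine Eq.trans (P.one_comp (by simp) z).symm ?_
      refine comp_congr (fun j => ?_) _ _ P.one fun j => ?_
      · obtain rfl := Subsingleton.elim j 0; exact (congrArg l b10).symm
      · obtain rfl := Subsingleton.elim j 0; exact (hw b10).symm
  · refine congrArg (P.comp _ _ r) (funext fun i => ?_)
    fin_cases i
    · refine Eq.trans ?_ (P.one_comp (by simp) x)
      refine comp_congr (fun j => ?_) _ _ P.one fun j => ?_
      · obtain rfl := Subsingleton.elim j 0; exact (congrArg l c00)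
      · obtain rfl := Subsingleton.elim j 0; exact (hw c00)
    · refine comp_congr (fun j => ?_) _ _ s fun j => ?_
      · fin_cases j
        · exact (congrArg l c10)
        · exact (congrArg l c11)
      · fin_cases j
        · exact (hw c10)
        · exact (hw c11)

theorem comp_eq_comp₂ {k : Fin 2 → ℕ} {N : ℕ} (h : ∑ i, k i = N) (p : P.obj 2)
    (r : ∀ i, P.obj (k i)) :
    P.comp k h p r = P.comp₂ ((Fin.sum_univ_two k).symm.trans h) p (r 0) (r 1) := by
  refine comp_congr (fun i => ?_) _ _ p fun i => ?_ <;> fin_cases i <;> rfl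

theorem comp₂_pair {a b N : ℕ} (h : a + b = N) (p : P.obj 2) (r : ∀ i, P.obj (arities a b i)) :
    P.comp (arities a b) (sum_arities h) p r = P.comp₂ h p (r 0) (r 1) := by
  refine congrArg (P.comp _ _ p) (funext fun i => ?_)
  fin_cases i <;> rfl

theorem Hom.map_comp₂ {Q : NSOperad K} (φ : Hom P Q) {a b N : ℕ} (h : a + b = N) (p : P.obj 2)
    (x : P.obj a) (y : P.obj b) :
    φ.map N (P.comp₂ h p x y) = Q.comp₂ h (φ.map 2 p) (φ.map a x) (φ.map b y) :=
  (φ.map_comp _ _ _ _).trans (comp₂_pair h _ _)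

variable (P) in
/-- The bilinear map `(x, y) ↦ p ∘ (x, y)`. -/
def comp₂Lin {a b N : ℕ} (h : a + b = N) (p : P.obj 2) :
    P.obj a →ₗ[K] P.obj b →ₗ[K] P.obj N :=
  have key₀ : ∀ (x x' : P.obj a) (y : P.obj b),
      (fun i => Fin.cases (motive := fun i => P.obj (arities a b i)) x (fun _ => y) i) =
        Function.update (fun i => Fin.cases (motive := fun i => P.obj (arities a b i)) x'
          (fun _ => y) i) 0 x := fun x x' y => by
    funext i; fin_cases i <;> rfl
  have key₁ : ∀ (x : P.obj a) (y y' : P.obj b),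
      (fun i => Fin.cases (motive := fun i => P.obj (arities a b i)) x (fun _ => y) i) =
        Function.update (fun i => Fin.cases (motive := fun i => P.obj (arities a b i)) x
          (fun _ => y') i) 1 y := fun x y y' => by
    funext i; fin_cases i <;> rfl
  LinearMap.mk₂ K (fun x y => P.comp₂ h p x y)
    (fun x x' y => by
      unfold comp₂
      rw [key₀ (x + x') 0, key₀ x 0, key₀ x' 0]
      exact P.comp_update_add _ _ _ _ _ _ _)
    (fun c x y => by
      unfold comp₂
      rw [key₀ (c • x) 0, key₀ x 0]
      exact P.comp_update_smul _ _ _ _ _ _ _)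
    (fun x y y' => by
      unfold comp₂
      rw [key₁ x (y + y') 0, key₁ x y 0, key₁ x y' 0]
      exact P.comp_update_add _ _ _ _ _ _ _)
    (fun c x y => by
      unfold comp₂
      rw [key₁ x (c • y) 0, key₁ x y 0]
      exact P.comp_update_smul _ _ _ _ _ _ _)

theorem comp₂Lin_apply {a b N : ℕ} (h : a + b = N) (p : P.obj 2) (x : P.obj a) (y : P.obj b) :
    P.comp₂Lin h p x y = P.comp₂ h p x y := rfl

theorem comp₂_add_op {a b N : ℕ} (h : a + b = N) (p q : P.obj 2) (x : P.obj a) (y : P.obj b) :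
    P.comp₂ h (p + q) x y = P.comp₂ h p x y + P.comp₂ h q x y := P.comp_add _ _ _ _ _

/-! ### Generation of operads -/

variable (S : ∀ n, Submodule K (P.obj n))

/-- `p` sends all tuples of operations in `S` into `S`. -/
def Preserves {n : ℕ} (p : P.obj n) : Prop :=
  ∀ (k : Fin n → ℕ) {N : ℕ} (h : ∑ i, k i = N) (r : ∀ i, P.obj (k i)), (∀ i, r i ∈ S (k i)) →
    P.comp k h p r ∈ S N

variable {S}

theorem preserves_one : Preserves S P.one := fun k N h r hr => by
  obtain ⟨rfl, e⟩ := one_comp' h r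
  rw [e]; exact hr 0

theorem preserves_zero {n : ℕ} : Preserves S (0 : P.obj n) := fun k N h r _ => by
  have := P.comp_smul k h 0 0 r
  rw [zero_smul, zero_smul] at this
  rw [this]; exact Submodule.zero_mem _

theorem Preserves.add {n : ℕ} {p q : P.obj n} (hp : Preserves S p) (hq : Preserves S q) :
    Preserves S (p + q) := fun k N h r hr => by
  rw [P.comp_add]; exact Submodule.add_mem _ (hp k h r hr) (hq k h r hr)

theorem Preserves.smul {n : ℕ} (c : K) {p : P.obj n} (hp : Preserves S p) :
    Preserves S (c • p) := fun k N h r hr => by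
  rw [P.comp_smul]; exact Submodule.smul_mem _ _ (hp k h r hr)

/-- The operations which preserve `S` are stable under composition, by associativity. -/
theorem Preserves.comp {n : ℕ} (k : Fin n → ℕ) {N : ℕ} (h : ∑ i, k i = N) {p : P.obj n}
    {q : ∀ i, P.obj (k i)} (hp : Preserves S p) (hq : ∀ i, Preserves S (q i)) :
    Preserves S (P.comp k h p q) := fun l T hl r hr => by
  have hT : ∑ i, ∑ j, l (block k h ⟨i, j⟩) = T := by
    rw [← hl, ← (block k h).sum_comp, Fintype.sum_sigma]
  rw [P.assoc k h l hl _ (fun _ => rfl) hT]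
  exact hp _ _ _ fun i => hq i _ _ _ fun j => hr _

theorem Preserves.mem {n : ℕ} {p : P.obj n} (hp : Preserves S p) (h1 : P.one ∈ S 1) :
    p ∈ S n := by
  rw [← P.comp_one (by simp) p]
  exact hp _ _ _ fun _ => h1

theorem preserves_of_comp₂ {p : P.obj 2} (hp : ∀ {a b N : ℕ} (h : a + b = N) (x : P.obj a)
    (y : P.obj b), x ∈ S a → y ∈ S b → P.comp₂ h p x y ∈ S N) : Preserves S p :=
  fun k N h r hr => by
    rw [comp_eq_comp₂]
    exact hp _ _ _ (hr 0) (hr 1)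

/-- A presented operad is the closure of the unit under the operations `r ↦ x ∘ r`, for the
generators `x`. -/
theorem presented_mem {G : ℕ → Type u} (R : ∀ n, Pre K G n → Pre K G n → Prop)
    {S : ∀ n, Submodule K ((presented R).obj n)} (one : (presented R).one ∈ S 1)
    (gen : ∀ n (x : G n), Preserves S (PreQuot.mk R (.gen x) : (presented R).obj n))
    {n : ℕ} (p : (presented R).obj n) : p ∈ S n := by
  suffices Preserves S p from this.mem one
  induction p using presented_induction with
  | gen x => exact gen _ x
  | one => exact preserves_one
  | zero => exact preserves_zero
  | add x y hx hy => exact hx.add hy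
  | smul c x hx => exact hx.smul c
  | comp k h p r hp hr => exact hp.comp k h hr

end NSOperad

namespace SymOperad

open NSOperad

variable {K : Type u} [Field K] {P : SymOperad K} {S : ∀ n, Submodule K (P.obj n)}

/-- If `S` is stable under permutations, so are the operations which preserve `S`, by equivariance. -/
theorem preserves_perm (hS : ∀ {n : ℕ} (σ : Equiv.Perm (Fin n)) (p : P.obj n), p ∈ S n →
    P.perm σ p ∈ S n) {n : ℕ} (σ : Equiv.Perm (Fin n)) {p : P.obj n}
    (hp : Preserves (P := P.toNSOperad) S p) :
    Preserves (P := P.toNSOperad) S (P.perm σ p) := by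
  intro k N h r hr
  obtain ⟨k, rfl⟩ : ∃ k', k = fun i => k' (σ i) := ⟨fun i => k (σ.symm i), by simp⟩
  obtain ⟨r, rfl⟩ : ∃ r' : ∀ i, P.obj (k i), r = fun i => r' (σ i) :=
    ⟨Equiv.piCongrLeft (fun i => P.obj (k i)) σ r,
      funext fun i => (Equiv.piCongrLeft_apply_apply (fun i => P.obj (k i)) σ r i).symm⟩
  have h' : ∑ i, k i = N := (Equiv.sum_comp σ k).symm.trans h
  rw [P.perm_comp σ k h h']
  refine hS _ _ (hp k h' r fun i => ?_)
  obtain ⟨i, rfl⟩ := σ.surjective i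
  exact hr i

/-- A presented symmetric operad is the closure of the unit under the operations `r ↦ x ∘ r`, for
the generators `x`, and under the permutations. -/
theorem presented_mem {G : ℕ → Type u} (R : ∀ n, SPre K G n → SPre K G n → Prop)
    {S : ∀ n, Submodule K ((presented R).obj n)} (one : (presented R).one ∈ S 1)
    (perm : ∀ {n : ℕ} (σ : Equiv.Perm (Fin n)) (p : (presented R).obj n), p ∈ S n →
      (presented R).perm σ p ∈ S n)
    (gen : ∀ n (x : G n), Preserves (P := (presented R).toNSOperad) S
      (SPreQuot.mk R (.gen x) : (presented R).obj n))
    {n : ℕ} (p : (presented R).obj n) : p ∈ S n := by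
  suffices Preserves (P := (presented R).toNSOperad) S p from this.mem one
  induction p using SymOperad.presented_induction with
  | gen x => exact gen _ x
  | one => exact preserves_one
  | zero => exact preserves_zero
  | add x y hx hy => exact hx.add hy
  | smul c x hx => exact hx.smul c
  | comp k h p r hp hr => exact hp.comp k h hr
  | perm σ x hx => exact preserves_perm perm σ hx

/-- Permutations of the inputs of `x` and of `y` amount to a permutation of those of `p ∘ (x, y)`. -/
theorem comp₂_perm {a b N : ℕ} (h : a + b = N) (p : P.obj 2) (σ : Equiv.Perm (Fin a))
    (τ : Equiv.Perm (Fin b)) (x : P.obj a) (y : P.obj b) :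
    ∃ ρ : Equiv.Perm (Fin N), P.comp₂ h p (P.perm σ x) (P.perm τ y) =
      P.perm ρ (P.comp₂ h p x y) := by
  let π : ∀ i, Equiv.Perm (Fin (arities a b i)) :=
    fun i => Fin.cases (motive := fun i => Equiv.Perm (Fin (arities a b i))) σ (fun _ => τ) i
  refine ⟨blockSum (arities a b) (sum_arities h) π, ?_⟩
  refine Eq.trans ?_ (P.comp_perm (arities a b) (sum_arities h) p π _)
  refine congrArg (P.comp _ _ p) (funext fun i => ?_)
  fin_cases i <;> rfl

end SymOperad

/-! ### Monomials in the operad of grafting -/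

/-- The number of leaves. -/
def BinTree.leaves : BinTree → ℕ
  | .leaf => 1
  | .node t s => t.leaves + s.leaves

/-- The total number of leaves of the nonempty word `t :: w`. -/
def wordLeaves : BinTree → List BinTree → ℕ
  | t, [] => t.leaves
  | t, s :: w => t.leaves + wordLeaves s w

theorem BinTree.leaves_node (t s : BinTree) : (t.node s).leaves = t.leaves + s.leaves := rfl

theorem wordLeaves_nil (t : BinTree) : wordLeaves t [] = t.leaves := by rw [wordLeaves]

theorem wordLeaves_cons (t s : BinTree) (w : List BinTree) :
    wordLeaves t (s :: w) = t.leaves + wordLeaves s w := by rw [wordLeaves]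

section Monomials

variable {K : Type u} [Field K]

/-- The operation obtained by putting the binary operation `y` at the internal vertices of a binary
tree. The arity is a variable `n` with a proof that it is the number of leaves, so that operations of
equal arities can be compared without transport; for a single leaf this transports the unit. -/
def treeOp (P : NSOperad K) (y : P.obj 2) : ∀ (t : BinTree) {n : ℕ}, t.leaves = n → P.obj n
  | .leaf, _, h => h ▸ P.one
  | .node t s, _, h => P.comp₂ ((BinTree.leaves_node t s).symm.trans h) y
      (treeOp P y t rfl) (treeOp P y s rfl)

theorem NSOperad.Hom.map_treeOp {P Q : NSOperad K} (φ : NSOperad.Hom P Q) (y : P.obj 2)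
    (t : BinTree) {n : ℕ} (h : t.leaves = n) :
    φ.map n (treeOp P y t h) = treeOp Q (φ.map 2 y) t h := by
  induction t generalizing n with
  | leaf => subst h; exact φ.map_one
  | node t s iht ihs => rw [treeOp, treeOp, φ.map_comp₂, iht, ihs]

/-- The product `t₁ ⋯ t_r` of the operations given by binary trees, for `m` as product and
`↗ - m` at the internal vertices of the trees. -/
def wordOp (K : Type u) [Field K] :
    ∀ (t : BinTree) (w : List BinTree) {n : ℕ}, wordLeaves t w = n → (graftOperad K).obj n
  | t, [], _, h => treeOp _ (opUp K - opM K) t ((wordLeaves_nil t).symm.trans h)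
  | t, s :: w, _, h =>
    (graftOperad K).comp₂ ((wordLeaves_cons t s w).symm.trans h) (opM K)
      (treeOp _ (opUp K - opM K) t rfl) (wordOp K s w rfl)

theorem wordOp_nil {t : BinTree} {n : ℕ} (h : wordLeaves t [] = n) (h' : t.leaves = n) :
    wordOp K t [] h = treeOp _ (opUp K - opM K) t h' := rfl

theorem wordOp_cons {t s : BinTree} {w : List BinTree} {a b N : ℕ} (hN : wordLeaves t (s :: w) = N)
    (h : a + b = N) (ha : t.leaves = a) (hb : wordLeaves s w = b) :
    wordOp K t (s :: w) hN = (graftOperad K).comp₂ h (opM K) (treeOp _ (opUp K - opM K) t ha)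
      (wordOp K s w hb) := by
  subst ha hb; rfl

theorem treeOp_node {P : NSOperad K} {y : P.obj 2} {t s : BinTree} {a b N : ℕ}
    (hN : (t.node s).leaves = N) (h : a + b = N) (ha : t.leaves = a) (hb : s.leaves = b) :
    treeOp P y (t.node s) hN = P.comp₂ h y (treeOp P y t ha) (treeOp P y s hb) := by
  subst ha hb; rfl

/-- The product of two products of trees is given by the concatenation of the words. -/
theorem comp₂_m_wordOp {t s : BinTree} {w v : List BinTree} {a b N : ℕ} (h : a + b = N)
    (ha : wordLeaves t w = a) (hb : wordLeaves s v = b) :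
    ∃ hN, (graftOperad K).comp₂ h (opM K) (wordOp K t w ha) (wordOp K s v hb) =
      wordOp K t (w ++ s :: v) hN := by
  induction w generalizing t a N with
  | nil => exact ⟨by rw [← h, ← ha, ← hb]; rfl, (wordOp_cons _ h ha hb).symm⟩
  | cons t' w ih =>
    obtain ⟨hN, e⟩ := ih (t := t') rfl rfl
    have ha' := (wordLeaves_cons t t' w).symm.trans ha
    have hN' : t.leaves + (wordLeaves t' w + b) = N := by omega
    refine ⟨by rw [List.cons_append, wordLeaves_cons, hN, hN'], ?_⟩
    rw [wordOp_cons ha ha' rfl rfl, NSOperad.comp₂_comp₂ graft_m_m ha' h rfl hN', e]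
    exact (wordOp_cons _ _ _ _).symm

/-- In the operad, `t ↗ (s v) = (t ∘ s) v + t s v` for `∘ = ↗ - m`. -/
theorem comp₂_up_treeOp {t s : BinTree} {v : List BinTree} {a b N : ℕ} (h : a + b = N)
    (ha : t.leaves = a) (hb : wordLeaves s v = b) :
    ∃ h₁ h₂, (graftOperad K).comp₂ h (opUp K) (treeOp _ (opUp K - opM K) t ha)
      (wordOp K s v hb) = wordOp K (t.node s) v h₁ + wordOp K t (s :: v) h₂ := by
  have h₂ : wordLeaves t (s :: v) = N := by rw [wordLeaves_cons, ha, hb, h]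
  cases v with
  | nil =>
    have h₁ : (t.node s).leaves = N := by rw [BinTree.leaves_node, ha, ← h, ← hb, wordLeaves]
    refine ⟨(wordLeaves_nil _).trans h₁, h₂, ?_⟩
    have hs := (wordLeaves_nil s).symm.trans hb
    rw [wordOp_cons h₂ h ha hb, wordOp_nil _ h₁, wordOp_nil _ hs, treeOp_node h₁ h ha hs,
      ← NSOperad.comp₂_add_op, sub_add_cancel]
  | cons s' v =>
    have hb' := (wordLeaves_cons s s' v).symm.trans hb
    have h₃ : (t.node s).leaves + wordLeaves s' v = N := by rw [BinTree.leaves_node]; omega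
    have h₁ : wordLeaves (t.node s) (s' :: v) = N := by rw [wordLeaves_cons, h₃]
    have h₄ : a + s.leaves = (t.node s).leaves := by rw [BinTree.leaves_node, ha]
    refine ⟨h₁, h₂, ?_⟩
    rw [wordOp_cons h₂ h ha hb, wordOp_cons h₁ h₃ rfl rfl, wordOp_cons hb hb' rfl rfl,
      treeOp_node rfl h₄ ha rfl, ← NSOperad.comp₂_comp₂ graft_m_up h₄ h₃ hb' h,
      ← NSOperad.comp₂_comp₂ graft_m_m h₄ h₃ hb' h]
    simp only [← NSOperad.comp₂Lin_apply]
    rw [← LinearMap.add_apply, ← map_add]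
    simp only [NSOperad.comp₂Lin_apply]
    rw [← NSOperad.comp₂_add_op, sub_add_cancel]

/-- The span of the operations `wordOp`. -/
def wordOpSpan (K : Type u) [Field K] (n : ℕ) : Submodule K ((graftOperad K).obj n) :=
  Submodule.span K {p | ∃ t w, ∃ h : wordLeaves t w = n, p = wordOp K t w h}

theorem wordOp_mem {t : BinTree} {w : List BinTree} {n : ℕ} (h : wordLeaves t w = n) :
    wordOp K t w h ∈ wordOpSpan K n := Submodule.subset_span ⟨t, w, h, rfl⟩

theorem NSOperad.comp₂_mem_of_span {P : NSOperad K} {a b N : ℕ} (h : a + b = N) (p : P.obj 2)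
    {U : Set (P.obj a)} {V : Set (P.obj b)} {S : Submodule K (P.obj N)}
    (hS : ∀ x ∈ U, ∀ y ∈ V, P.comp₂ h p x y ∈ S) {x : P.obj a} {y : P.obj b}
    (hx : x ∈ Submodule.span K U) (hy : y ∈ Submodule.span K V) : P.comp₂ h p x y ∈ S := by
  have : Submodule.map₂ (P.comp₂Lin h p) (Submodule.span K U) (Submodule.span K V) ≤ S := by
    rw [Submodule.map₂_span_span, Submodule.span_le]
    rintro _ ⟨x, hx, y, hy, rfl⟩
    exact hS x hx y hy
  exact Submodule.map₂_le.mp this x hx y hy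

theorem comp₂_up_treeOp_mem {t : BinTree} {a b N : ℕ} (h : a + b = N) (ha : t.leaves = a)
    {z : (graftOperad K).obj b} (hz : z ∈ wordOpSpan K b) :
    (graftOperad K).comp₂ h (opUp K) (treeOp _ (opUp K - opM K) t ha) z ∈ wordOpSpan K N := by
  refine NSOperad.comp₂_mem_of_span h _ ?_ (Submodule.mem_span_singleton_self _) hz
  rintro _ rfl _ ⟨s, v, hb, rfl⟩
  obtain ⟨h₁, h₂, e⟩ := comp₂_up_treeOp (K := K) h ha hb
  rw [e]
  exact Submodule.add_mem _ (wordOp_mem _) (wordOp_mem _)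

/-- Closure under `↗`, by the formula `(t u) ↗ z = t ↗ (u ↗ z) - ((t ∘ s) v) ↗ z` for a word
`u = s v`. -/
theorem comp₂_up_wordOp_mem {w : List BinTree} {t : BinTree} {a b N : ℕ} (h : a + b = N)
    (ha : wordLeaves t w = a) {z : (graftOperad K).obj b} (hz : z ∈ wordOpSpan K b) :
    (graftOperad K).comp₂ h (opUp K) (wordOp K t w ha) z ∈ wordOpSpan K N := by
  induction w generalizing t a b N with
  | nil => exact comp₂_up_treeOp_mem h ha hz
  | cons s v ih =>
    have ha' := (wordLeaves_cons t s v).symm.trans ha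
    have hN : t.leaves + (wordLeaves s v + b) = N := by omega
    obtain ⟨h₁, h₂, e⟩ := comp₂_up_treeOp (K := K) (t := t) ha' rfl rfl
    have e' := congrArg (fun x => (graftOperad K).comp₂Lin h (opUp K) x z) e
    simp only [map_add, LinearMap.add_apply, NSOperad.comp₂Lin_apply] at e'
    rw [NSOperad.comp₂_comp₂ graft_up_up ha' h rfl hN] at e'
    rw [eq_sub_of_add_eq' e'.symm]
    exact Submodule.sub_mem _ (comp₂_up_treeOp_mem _ rfl (ih rfl rfl hz)) (ih h h₁ hz)

/-- The operad `P_↗` is spanned by the products of trees. -/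
theorem mem_wordOpSpan {n : ℕ} (p : (graftOperad K).obj n) : p ∈ wordOpSpan K n := by
  refine NSOperad.presented_mem (GraftRel K) (S := wordOpSpan K) ?_ ?_ p
  · exact wordOp_mem (t := .leaf) (w := []) rfl
  · rintro _ (_ | _)
    · refine NSOperad.preserves_of_comp₂ fun h x y hx hy => ?_
      refine NSOperad.comp₂_mem_of_span (P := graftOperad K) h _ ?_ hx hy
      rintro _ ⟨t, w, ha, rfl⟩ _ ⟨s, v, hb, rfl⟩
      obtain ⟨hN, e⟩ := comp₂_m_wordOp (K := K) h ha hb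
      exact (congrArg (· ∈ wordOpSpan K _) e).mpr (wordOp_mem hN)
    · refine NSOperad.preserves_of_comp₂ fun h x y hx hy => ?_
      refine NSOperad.comp₂_mem_of_span (P := graftOperad K) h _ ?_ hx
        (Submodule.mem_span_singleton_self _)
      rintro _ ⟨t, w, ha, rfl⟩ _ rfl
      exact comp₂_up_wordOp_mem h ha hy

theorem SymOperad.perm_mem_span {P : SymOperad K} {n : ℕ} (σ : Equiv.Perm (Fin n))
    {U : Set (P.obj n)} (hU : ∀ x ∈ U, P.perm σ x ∈ U) {x : P.obj n}
    (hx : x ∈ Submodule.span K U) : P.perm σ x ∈ Submodule.span K U := by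
  induction hx using Submodule.span_induction with
  | mem x hx => exact Submodule.subset_span (hU x hx)
  | zero =>
    have := P.perm_smul σ 0 0
    rw [zero_smul, zero_smul] at this
    rw [this]; exact Submodule.zero_mem _
  | add x y _ _ hx hy => rw [P.perm_add]; exact Submodule.add_mem _ hx hy
  | smul c x _ hx => rw [P.perm_smul]; exact Submodule.smul_mem _ _ hx

/-- The span of the operations `wordOp` with permuted inputs. -/
def symWordOpSpan (K : Type u) [Field K] (n : ℕ) : Submodule K ((symGraft K).obj n) :=
  Submodule.span K {q | ∃ (σ : Equiv.Perm (Fin n)) (t : BinTree) (w : List BinTree),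
    ∃ h : wordLeaves t w = n, q = (symGraft K).perm σ (toSymmetrisation _ (wordOp K t w h))}

theorem perm_mem_symWordOpSpan {n : ℕ} (σ : Equiv.Perm (Fin n)) {x : (symGraft K).obj n}
    (hx : x ∈ symWordOpSpan K n) : (symGraft K).perm σ x ∈ symWordOpSpan K n := by
  refine SymOperad.perm_mem_span σ ?_ hx
  rintro _ ⟨τ, t, w, h, rfl⟩
  exact ⟨τ * σ, t, w, h, ((symGraft K).perm_mul τ σ _).symm⟩

theorem toSymmetrisation_mem_symWordOpSpan {n : ℕ} (p : (graftOperad K).obj n) :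
    toSymmetrisation _ p ∈ symWordOpSpan K n := by
  have : wordOpSpan K n ≤
      (symWordOpSpan K n).comap ((symmetrisationHom (graftOperad K)).map n) := by
    rw [wordOpSpan, Submodule.span_le]
    rintro _ ⟨t, w, h, rfl⟩
    exact Submodule.subset_span ⟨1, t, w, h, ((symGraft K).perm_one _).symm⟩
  exact this (mem_wordOpSpan p)

/-- The symmetrisation of `P_↗` is spanned by the products of trees with permuted inputs. -/
theorem mem_symWordOpSpan {n : ℕ} (p : (symGraft K).obj n) : p ∈ symWordOpSpan K n := by
  let φ := symmetrisationHom (graftOperad K)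
  have bin : ∀ g : (graftOperad K).obj 2, NSOperad.Preserves (P := (symGraft K).toNSOperad)
      (symWordOpSpan K) (toSymmetrisation _ g) := fun g => by
    refine NSOperad.preserves_of_comp₂ fun h x y hx hy => ?_
    refine NSOperad.comp₂_mem_of_span (P := (symGraft K).toNSOperad) h _ ?_ hx hy
    rintro _ ⟨σ, t, w, ha, rfl⟩ _ ⟨τ, s, v, hb, rfl⟩
    obtain ⟨ρ, e⟩ := SymOperad.comp₂_perm (P := symGraft K) h (toSymmetrisation _ g) σ τ
      (toSymmetrisation _ (wordOp K t w ha)) (toSymmetrisation _ (wordOp K s v hb))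
    rw [e]
    refine perm_mem_symWordOpSpan ρ ?_
    exact (φ.map_comp₂ h g _ _) ▸ toSymmetrisation_mem_symWordOpSpan _
  refine SymOperad.presented_mem (SymmRel (graftOperad K)) (S := symWordOpSpan K) ?_
    (fun σ p hp => perm_mem_symWordOpSpan σ hp) (fun n x => ?_) p
  · exact φ.map_one ▸ toSymmetrisation_mem_symWordOpSpan (graftOperad K).one
  · change NSOperad.Preserves (P := (symGraft K).toNSOperad) (symWordOpSpan K) (φ.map n x)
    induction x using NSOperad.presented_induction with
    | gen x => cases x <;> exact bin _
    | one => exact φ.map_one ▸ NSOperad.preserves_one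
    | zero => exact (map_zero (φ.map _)) ▸ NSOperad.preserves_zero
    | add x y hx hy => exact (map_add (φ.map _) x y) ▸ hx.add hy
    | smul c x hx => exact (map_smul (φ.map _) c x) ▸ hx.smul c
    | comp k h p r hp hr => exact (φ.map_comp k h p r) ▸ hp.comp k h hr

/-! ### The free operads on one binary operation -/

/-- The free non-symmetric operad generated by one element of arity `2`. -/
def freeNS₂ (K : Type u) [Field K] : NSOperad K :=
  NSOperad.presented (K := K) (G := OneBinary) (fun _ _ _ => False)

/-- The generator. -/
def freeNS₂Star (K : Type u) [Field K] : (freeNS₂ K).obj 2 :=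
  PreQuot.mk _ (.gen .star)

/-- The generator. -/
def free₂Star (K : Type u) [Field K] : (free₂ K).obj 2 :=
  SPreQuot.mk _ (.gen .star)

/-- The span of the operations `treeOp`. -/
def treeOpSpan (K : Type u) [Field K] (n : ℕ) : Submodule K ((freeNS₂ K).obj n) :=
  Submodule.span K {q | ∃ (t : BinTree) (h : t.leaves = n), q = treeOp _ (freeNS₂Star K) t h}

theorem treeOp_mem {t : BinTree} {n : ℕ} (h : t.leaves = n) :
    treeOp _ (freeNS₂Star K) t h ∈ treeOpSpan K n := Submodule.subset_span ⟨t, h, rfl⟩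

/-- The free operad on one binary operation is spanned by the binary trees. -/
theorem mem_treeOpSpan {n : ℕ} (p : (freeNS₂ K).obj n) : p ∈ treeOpSpan K n := by
  refine NSOperad.presented_mem (K := K) (G := OneBinary) (fun _ _ _ => False)
    (S := treeOpSpan K) (treeOp_mem (t := .leaf) rfl) ?_ p
  rintro _ ⟨⟩
  refine NSOperad.preserves_of_comp₂ fun h x y hx hy => ?_
  refine NSOperad.comp₂_mem_of_span (P := freeNS₂ K) h _ ?_ hx hy
  rintro _ ⟨t, ha, rfl⟩ _ ⟨s, hb, rfl⟩
  have hN : (t.node s).leaves = _ := (congrArg₂ (· + ·) ha hb).trans h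
  exact (treeOp_node (P := freeNS₂ K) (y := freeNS₂Star K) hN h ha hb) ▸ treeOp_mem hN

/-- The span of the operations `treeOp` with permuted inputs. -/
def symTreeOpSpan (K : Type u) [Field K] (n : ℕ) : Submodule K ((free₂ K).obj n) :=
  Submodule.span K {q | ∃ (σ : Equiv.Perm (Fin n)) (t : BinTree) (h : t.leaves = n),
    q = (free₂ K).perm σ (treeOp (free₂ K).toNSOperad (free₂Star K) t h)}

theorem perm_treeOp_mem {n : ℕ} (σ : Equiv.Perm (Fin n)) {t : BinTree} (h : t.leaves = n) :
    (free₂ K).perm σ (treeOp (free₂ K).toNSOperad (free₂Star K) t h) ∈ symTreeOpSpan K n :=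
  Submodule.subset_span ⟨σ, t, h, rfl⟩

/-- The free symmetric operad on one binary operation is spanned by the binary trees with permuted
inputs. -/
theorem mem_symTreeOpSpan {n : ℕ} (p : (free₂ K).obj n) : p ∈ symTreeOpSpan K n := by
  refine SymOperad.presented_mem (K := K) (G := OneBinary) (fun _ _ _ => False)
    (S := symTreeOpSpan K) ?_ ?_ ?_ p
  · exact (free₂ K).perm_one (free₂ K).one ▸ perm_treeOp_mem 1 (t := .leaf) rfl
  · intro n σ p hp
    refine SymOperad.perm_mem_span (P := free₂ K) σ ?_ hp
    rintro _ ⟨τ, t, h, rfl⟩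
    exact ⟨τ * σ, t, h, ((free₂ K).perm_mul τ σ _).symm⟩
  · rintro _ ⟨⟩
    refine NSOperad.preserves_of_comp₂ fun h x y hx hy => ?_
    refine NSOperad.comp₂_mem_of_span (P := (free₂ K).toNSOperad) h _ ?_ hx hy
    rintro _ ⟨σ, t, ha, rfl⟩ _ ⟨τ, s, hb, rfl⟩
    obtain ⟨ρ, e⟩ := SymOperad.comp₂_perm (P := free₂ K) h (free₂Star K) σ τ
      (treeOp (free₂ K).toNSOperad (free₂Star K) t ha)
      (treeOp (free₂ K).toNSOperad (free₂Star K) s hb)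
    have hN : (t.node s).leaves = _ := (congrArg₂ (· + ·) ha hb).trans h
    rw [← treeOp_node hN h ha hb] at e
    exact e ▸ perm_treeOp_mem ρ hN

end Monomials

/-! ### Evaluation of the monomials in the bialgebra of words -/

section Labels

variable {X : Type} [Mul X]

/-- The product in the magma `X`, bracketed according to a binary tree, of the labels
`ℓ 0, ℓ 1, …` of the leaves. -/
def treeLabel : BinTree → (ℕ → X) → X
  | .leaf, ℓ => ℓ 0
  | .node t s, ℓ => treeLabel t ℓ * treeLabel s fun k => ℓ (t.leaves + k)

/-- The nonempty word of the products given by the trees of a nonempty word of trees. -/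
def wordLabel : BinTree → List BinTree → (ℕ → X) → X × List X
  | t, [], ℓ => (treeLabel t ℓ, [])
  | t, s :: w, ℓ => (treeLabel t ℓ, (wordLabel s w fun k => ℓ (t.leaves + k)).1 ::
      (wordLabel s w fun k => ℓ (t.leaves + k)).2)

/-- In a free magma a bracketed product determines the bracketing and the letters. -/
theorem treeLabel_inj {t t' : BinTree} {e e' : ℕ → ℕ}
    (h : treeLabel t (fun k => FreeMagma.of (e k)) = treeLabel t' fun k => FreeMagma.of (e' k)) :
    t = t' ∧ ∀ k < t.leaves, e k = e' k := by
  induction t generalizing t' e e' with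
  | leaf =>
    cases t' with
    | leaf =>
      refine ⟨rfl, fun k hk => ?_⟩
      obtain rfl : k = 0 := by rw [BinTree.leaves] at hk; omega
      injection h
    | node => cases h
  | node t s iht ihs =>
    cases t' with
    | leaf => cases h
    | node t' s' =>
      injection h with h1 h2
      obtain ⟨rfl, ht⟩ := iht h1
      obtain ⟨rfl, hs⟩ := ihs h2
      refine ⟨rfl, fun k hk => ?_⟩
      rw [BinTree.leaves_node] at hk
      by_cases hkt : k < t.leaves
      · exact ht k hkt
      · have := hs (k - t.leaves) (by omega)
        rwa [Nat.add_sub_cancel' (by omega)] at this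

/-- A word of bracketed products in a free magma determines the trees and the letters. -/
theorem wordLabel_inj {t t' : BinTree} {w w' : List BinTree} {e e' : ℕ → ℕ}
    (h : wordLabel t w (fun k => FreeMagma.of (e k)) =
      wordLabel t' w' fun k => FreeMagma.of (e' k)) :
    t = t' ∧ w = w' ∧ ∀ k < wordLeaves t w, e k = e' k := by
  induction w generalizing t t' w' e e' with
  | nil =>
    cases w' with
    | nil =>
      simp only [wordLabel, Prod.mk.injEq, and_true] at h
      obtain ⟨rfl, ht⟩ := treeLabel_inj h
      exact ⟨rfl, rfl, by rwa [wordLeaves_nil]⟩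
    | cons => simp [wordLabel] at h
  | cons s w ih =>
    cases w' with
    | nil => simp [wordLabel] at h
    | cons s' w' =>
      simp only [wordLabel, Prod.mk.injEq, List.cons.injEq] at h
      obtain ⟨h1, h2, h3⟩ := h
      obtain ⟨rfl, ht⟩ := treeLabel_inj h1
      obtain ⟨rfl, rfl, hs⟩ := ih (Prod.ext h2 h3)
      refine ⟨rfl, rfl, fun k hk => ?_⟩
      rw [wordLeaves_cons] at hk
      by_cases hkt : k < t.leaves
      · exact ht k hkt
      · have := hs (k - t.leaves) (by omega)
        rwa [Nat.add_sub_cancel' (by omega)] at this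

variable {K : Type u} [Field K]

/-- If `y` acts on the elements `g a` as the product of the magma, the tree `t` acts on them as the
product bracketed by `t`. -/
theorem NSOperad.Algebra.act_treeOp {P : NSOperad K} {A : Type u} [AddCommGroup A] [Module K A]
    (α : P.Algebra A) {y : P.obj 2} {g : X → A}
    (hg : ∀ a b, α.bin y (g a) (g b) = g (a * b)) {t : BinTree} {n : ℕ} (h : t.leaves = n)
    (ℓ : ℕ → X) : α.act (treeOp P y t h) (fun i => g (ℓ i)) = g (treeLabel t ℓ) := by
  induction t generalizing n ℓ with
  | leaf => subst h; exact α.act_one _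
  | node t s iht ihs =>
    rw [treeOp_node h ((BinTree.leaves_node t s).symm.trans h) rfl rfl, α.act_comp₂]
    refine Eq.trans (congrArg₂ (fun a b => α.bin y a b) (iht rfl ℓ)
      (ihs rfl fun k => ℓ (t.leaves + k))) (hg _ _)

/-- The `P_↗`-algebra of nonempty words. -/
def wordAlg (K : Type u) [Field K] (X : Type) [Mul X] : (graftOperad K).Algebra (NWordSpace K X) :=
  (wordBialg K X).alg.toNS

theorem wordAlg_bin_m : (wordAlg K X).bin (opM K) = reduceMul wordMul := symAlg_bin_m wordPair

theorem wordAlg_bin_up : (wordAlg K X).bin (opUp K) = reduceMul wordUp := symAlg_bin_up wordPair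

theorem wordAlg_bin_sub (a b : X) : (wordAlg K X).bin (opUp K - opM K) (nword a []) (nword b []) =
    nword (a * b) [] := by
  have h := (wordAlg K X).act_add (opUp K - opM K) (opM K) ![nword a [], nword b []]
  simp only [sub_add_cancel, ← NSOperad.Algebra.bin_apply, wordAlg_bin_m, wordAlg_bin_up,
    reduceUp_nword, reduceMul_nword, List.nil_append] at h
  exact (add_right_cancel h).symm

/-- At letters, the operation `t₁ ⋯ t_r` takes as value a single word with `r` letters. -/
theorem wordAlg_act_wordOp {t : BinTree} {w : List BinTree} {n : ℕ} (h : wordLeaves t w = n)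
    (ℓ : ℕ → X) : (wordAlg K X).act (wordOp K t w h) (fun i => nword (ℓ i) []) =
      Finsupp.single (wordLabel t w ℓ) 1 := by
  induction w generalizing t n ℓ with
  | nil => exact (wordAlg K X).act_treeOp (g := fun a => nword a []) wordAlg_bin_sub _ ℓ
  | cons s w ih =>
    rw [wordOp_cons h ((wordLeaves_cons t s w).symm.trans h) rfl rfl, NSOperad.Algebra.act_comp₂]
    refine Eq.trans (congrArg₂ (fun a b => (wordAlg K X).bin (opM K) a b)
      ((wordAlg K X).act_treeOp (g := fun a => nword a []) wordAlg_bin_sub rfl ℓ)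
      (ih rfl fun k => ℓ (t.leaves + k))) ?_
    rw [wordAlg_bin_m]
    exact reduceMul_nword _ _ [] _

end Labels

/-! ### Primitive operations -/

section LinearAlgebra

variable {K : Type*} [Field K] {M M' I I' J : Type*} [AddCommGroup M] [Module K M]
  [AddCommGroup M'] [Module K M']

/-- A linear map which sends a spanning family into a family detected by distinct coordinates is
injective, and its range contains the elements whose other coordinates vanish. -/
theorem injective_and_le_range {v : I → M} (hv : ∀ x, x ∈ Submodule.span K (Set.range v))
    {v' : I' → M'} (hv' : ∀ x, x ∈ Submodule.span K (Set.range v')) {φ : M' →ₗ[K] M} {ι : I' → I}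
    (hι : Function.Injective ι) (hφ : ∀ i, φ (v' i) = v (ι i)) {f : M →ₗ[K] J →₀ K} {j : I → J}
    (hj : Function.Injective j) (hf : ∀ i, f (v i) = Finsupp.single (j i) 1) {N : Submodule K M}
    (hN : ∀ x ∈ N, ∀ i, i ∉ Set.range ι → f x (j i) = 0) :
    Function.Injective φ ∧ N ≤ LinearMap.range φ := by
  have hli : LinearIndependent K v := by
    refine LinearIndependent.of_comp f ?_
    rw [show f ∘ v = (fun k => Finsupp.single k (1 : K)) ∘ j from funext hf]
    exact (Finsupp.linearIndependent_single_one K J).comp j hj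
  constructor
  · rw [← LinearMap.ker_eq_bot, LinearMap.ker_eq_bot']
    intro x hx
    obtain ⟨c, rfl⟩ := Finsupp.mem_span_range_iff_exists_finsupp.mp (hv' x)
    have h := (hli.comp ι hι)
    rw [linearIndependent_iff] at h
    rw [h c ?_, Finsupp.sum_zero_index]
    rw [Finsupp.linearCombination_apply, ← hx, map_finsuppSum]
    simp [hφ]
  · intro x hx
    obtain ⟨c, rfl⟩ := Finsupp.mem_span_range_iff_exists_finsupp.mp (hv x)
    refine Submodule.finsuppSum_mem _ _ _ _ fun i hi => Submodule.smul_mem _ _ ?_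
    by_contra h
    refine hi ?_
    rw [← hN _ hx i (fun ⟨i', hi'⟩ => h ⟨v' i', by rw [hφ, hi']⟩), map_finsuppSum]
    classical
    simp only [map_smul, hf, Finsupp.smul_single, smul_eq_mul, mul_one, Finsupp.sum,
      Finsupp.finsetSum_apply, Finsupp.single_apply, hj.eq_iff]
    simp

end LinearAlgebra

section Prim

variable {K : Type u} [Field K]

theorem nword_primitive {X : Type} [Mul X] (a : X) :
    (nword a [] : NWordSpace K X) ∈ LinearMap.ker (wordBialg K X).δ :=
  LinearMap.mem_ker.mpr (reducedDeconcat_letter a)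

/-- The inclusion of a suboperad. -/
def NSOperad.Suboperad.incl {P : NSOperad K} (S : P.Suboperad) : NSOperad.Hom S.toOperad P where
  map n := (S.carrier n).subtype
  map_one := rfl
  map_comp _ _ _ _ _ := rfl

/-- The inclusion of a suboperad. -/
def SymOperad.Suboperad.incl {P : SymOperad K} (S : P.Suboperad) :
    SymOperad.Hom S.toSymOperad P where
  toHom := S.toSuboperad.incl
  map_perm _ _ := rfl

/-- Evaluation of the operations at a fixed tuple. -/
def NSOperad.Algebra.evalAt {P : NSOperad K} {A : Type u} [AddCommGroup A] [Module K A]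
    (α : P.Algebra A) {n : ℕ} (a : Fin n → A) : P.obj n →ₗ[K] A where
  toFun p := α.act p a
  map_add' p q := α.act_add p q a
  map_smul' c p := α.act_smul c p a

/-- `↗ - m` preserves the primitive elements, since `δ(p * q) = p ⊗ q` for both products. -/
theorem sub_mem_PRIM : opUp K - opM K ∈ (PRIM K).carrier 2 := by
  intro A _ _ B a ha
  have h1 := B.compat_up (a 0) (a 1)
  have h2 := B.compat_m (a 0) (a 1)
  rw [NSOperad.Algebra.bin_apply, ← eq_pair] at h1 h2
  rw [LinearMap.mem_ker.mp (ha 0), LinearMap.mem_ker.mp (ha 1), map_zero, map_zero] at h1 h2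
  have h3 : B.alg.act (opUp K - opM K) a = B.alg.act (opUp K) a - B.alg.act (opM K) a := by
    rw [eq_sub_iff_add_eq, ← B.alg.act_add, sub_add_cancel]
  rw [LinearMap.mem_ker, h3, map_sub, h1, h2, sub_self]

variable (K) in
/-- The words, as a bialgebra over the non-symmetric operad. -/
def wordBialgNS (X : Type) [Mul X] : BialgOne K (NWordSpace K X) where
  alg := wordAlg K X
  δ := (wordBialg K X).δ
  coassoc := (wordBialg K X).coassoc
  compat_m := (wordBialg K X).compat_m
  compat_up := (wordBialg K X).compat_up

/-- The morphism from the free operad on one binary operation to the primitive operations, which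
sends the generator to `↗ - m`. -/
def toPRIM (K : Type u) [Field K] : NSOperad.Hom (freeNS₂ K) (PRIM K).toOperad :=
  NSOperad.presentedLift _ (PRIM K).toOperad
    (fun n x => match n, x with | _, .star => ⟨opUp K - opM K, sub_mem_PRIM⟩)
    (fun _ _ _ h => h.elim)

theorem toPRIM_star : (toPRIM K).map 2 (freeNS₂Star K) = ⟨opUp K - opM K, sub_mem_PRIM⟩ :=
  NSOperad.presentedLift_mk _ _ _ _ _

/-- The operations are evaluated at the letters `0, …, n - 1` of the free magma on `ℕ`, where
`t₁ ⋯ t_r` takes as value a word of length `r`, and a primitive operation a combination of letters. -/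
theorem toPRIM_bijective (n : ℕ) : Function.Bijective ((toPRIM K).map n) := by
  have key := injective_and_le_range (K := K) (M := (graftOperad K).obj n)
    (I := {x : BinTree × List BinTree // wordLeaves x.1 x.2 = n})
    (I' := {t : BinTree // t.leaves = n})
    (v := fun x => wordOp K x.1.1 x.1.2 x.2) (v' := fun t => treeOp _ (freeNS₂Star K) t.1 t.2)
    (φ := (PRIM K).incl.map n ∘ₗ (toPRIM K).map n)
    (ι := fun t => ⟨(t.1, []), (wordLeaves_nil _).trans t.2⟩)
    (f := (wordAlg K (FreeMagma ℕ)).evalAt fun i : Fin n => nword (FreeMagma.of (i : ℕ)) [])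
    (j := fun x => wordLabel x.1.1 x.1.2 FreeMagma.of) (N := (PRIM K).carrier n)
    (fun p => Submodule.span_mono (by rintro _ ⟨t, w, h, rfl⟩; exact ⟨⟨(t, w), h⟩, rfl⟩)
      (mem_wordOpSpan p))
    (fun p => Submodule.span_mono (by rintro _ ⟨t, h, rfl⟩; exact ⟨⟨t, h⟩, rfl⟩)
      (mem_treeOpSpan p))
    (fun t t' h => by simpa [Subtype.ext_iff] using h)
    (fun t => by
      rw [LinearMap.comp_apply, NSOperad.Hom.map_treeOp, NSOperad.Hom.map_treeOp, toPRIM_star]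
      rfl)
    (fun x x' h => by
      obtain ⟨h1, h2, -⟩ := wordLabel_inj (e := id) (e' := id) h
      exact Subtype.ext (Prod.ext h1 h2))
    (fun x => wordAlg_act_wordOp x.2 FreeMagma.of)
    (by
      intro p hp x hx
      obtain ⟨⟨t, w⟩, h⟩ := x
      cases w with
      | nil => exact absurd ⟨⟨t, (wordLeaves_nil _).symm.trans h⟩, rfl⟩ hx
      | cons s w =>
        exact apply_eq_zero_of_reducedDeconcat
          (hp _ (wordBialgNS K (FreeMagma ℕ)) _ fun i => nword_primitive _))
  refine ⟨fun x y h => key.1 (congrArg ((PRIM K).incl.map n) h), fun p => ?_⟩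
  obtain ⟨x, hx⟩ := key.2 p.2
  exact ⟨x, Subtype.ext hx⟩

variable (K) in
/-- The universal property of the presentation with one generator and no relation. -/
theorem freeNS₂_isFreelyGeneratedBy : (freeNS₂ K).IsFreelyGeneratedBy (freeNS₂Star K) := by
  intro Q y
  let g : ∀ n, OneBinary n → Q.obj n := fun n x => match n, x with | _, .star => y
  have hg : ∀ n (x y : Pre K OneBinary n), False → x.eval Q g = y.eval Q g :=
    fun _ _ _ h => h.elim
  have hstar : (NSOperad.presentedLift (fun _ _ _ => False) Q g hg).map 2 (freeNS₂Star K) = y :=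
    NSOperad.presentedLift_mk _ Q g hg (.gen .star)
  refine ⟨NSOperad.presentedLift _ Q g hg, hstar, fun φ hφ => NSOperad.presented_hom_ext _ ?_⟩
  rintro _ ⟨⟩
  exact hφ.trans hstar.symm

/-- Free generation is transported along a morphism which is bijective in each arity. -/
theorem NSOperad.IsFreelyGeneratedBy.of_bijective {F P : NSOperad K} (φ : NSOperad.Hom F P)
    (hφ : ∀ n, Function.Bijective (φ.map n)) {n : ℕ} {x : F.obj n}
    (hx : F.IsFreelyGeneratedBy x) : P.IsFreelyGeneratedBy (φ.map n x) := by
  intro Q y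
  obtain ⟨ψ, hψ, huniq⟩ := hx Q y
  let e : ∀ n, F.obj n ≃ₗ[K] P.obj n := fun n => LinearEquiv.ofBijective (φ.map n) (hφ n)
  have he : ∀ n x, (e n).symm (φ.map n x) = x := fun n x => (e n).symm_apply_apply x
  have he' : ∀ n x, φ.map n ((e n).symm x) = x := fun n x => (e n).apply_symm_apply x
  refine ⟨⟨fun n => ψ.map n ∘ₗ (e n).symm.toLinearMap, ?_, fun k N h p r => ?_⟩, ?_,
    fun θ hθ => ?_⟩
  · rw [← φ.map_one, ← ψ.map_one]
    exact congrArg _ (he 1 _)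
  · refine Eq.trans (congrArg (ψ.map N) ?_) (ψ.map_comp k h ((e _).symm p) fun i => (e _).symm (r i))
    apply (hφ N).1
    rw [φ.map_comp]
    exact (he' N _).trans (congrArg₂ (P.comp k h) (he' _ _).symm (funext fun i => (he' _ _).symm))
  · exact (congrArg (ψ.map n) (he n x)).trans hψ
  · have := huniq ⟨fun n => θ.map n ∘ₗ φ.map n,
      (congrArg (θ.map 1) φ.map_one).trans θ.map_one,
      fun k N h p r => (congrArg (θ.map N) (φ.map_comp k h p r)).trans (θ.map_comp k h _ _)⟩ hθ
    subst this
    exact NSOperad.Hom.ext_map fun n p => (congrArg (θ.map n) (he' n p)).symm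

/-- The primitive operations are freely generated by `↗ - m`. -/
theorem PRIM_isFreelyGeneratedBy : (PRIM K).toOperad.IsFreelyGeneratedBy (n := 2)
    ⟨opUp K - opM K, sub_mem_PRIM⟩ := by
  rw [← toPRIM_star]
  exact (freeNS₂_isFreelyGeneratedBy K).of_bijective (toPRIM K) toPRIM_bijective

/-- The morphism from the free symmetric operad on one binary operation to the primitive
operations, which sends the generator to `↗ - m`. -/
def toSymPRIM (K : Type u) [Field K] : SymOperad.Hom (free₂ K) (symPRIM K).toSymOperad :=
  SymOperad.presentedLift _ (symPRIM K).toSymOperad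
    (fun n x => match n, x with | _, .star => ⟨_, toSymmetrisation_sub_mem⟩)
    (fun _ _ _ h => h.elim)

theorem toSymPRIM_star : (toSymPRIM K).map 2 (free₂Star K) = ⟨_, toSymmetrisation_sub_mem⟩ :=
  SymOperad.presentedLift_mk _ _ _ _ _

/-- The inverse of a permutation of `Fin n`, as a function on the natural numbers. -/
def permIndex {n : ℕ} (σ : Equiv.Perm (Fin n)) (k : ℕ) : ℕ :=
  if h : k < n then σ.symm ⟨k, h⟩ else 0

theorem permIndex_val {n : ℕ} (σ : Equiv.Perm (Fin n)) (i : Fin n) :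
    permIndex σ i = σ.symm i := by simp [permIndex]

/-- The argument is that of `toPRIM_bijective`. The permutation of the inputs is read off from the
order of the letters in the value. -/
theorem toSymPRIM_bijective (n : ℕ) : Function.Bijective ((toSymPRIM K).map n) := by
  have key := injective_and_le_range (K := K) (M := (symGraft K).obj n)
    (I := Equiv.Perm (Fin n) × {x : BinTree × List BinTree // wordLeaves x.1 x.2 = n})
    (I' := Equiv.Perm (Fin n) × {t : BinTree // t.leaves = n})
    (v := fun x => (symGraft K).perm x.1 (toSymmetrisation _ (wordOp K x.2.1.1 x.2.1.2 x.2.2)))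
    (v' := fun x => (free₂ K).perm x.1
      (treeOp (free₂ K).toNSOperad (free₂Star K) x.2.1 x.2.2))
    (φ := (symPRIM K).incl.map n ∘ₗ (toSymPRIM K).map n)
    (ι := fun x => (x.1, ⟨(x.2.1, []), (wordLeaves_nil _).trans x.2.2⟩))
    (f := (wordBialg K (FreeMagma ℕ)).alg.evalAt
      fun i : Fin n => nword (FreeMagma.of (i : ℕ)) [])
    (j := fun x => wordLabel x.2.1.1 x.2.1.2 fun k => FreeMagma.of (permIndex x.1 k))
    (N := (symPRIM K).carrier n)
    (fun p => Submodule.span_mono (by rintro _ ⟨σ, t, w, h, rfl⟩; exact ⟨(σ, ⟨(t, w), h⟩), rfl⟩)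
      (mem_symWordOpSpan p))
    (fun p => Submodule.span_mono (by rintro _ ⟨σ, t, h, rfl⟩; exact ⟨(σ, ⟨t, h⟩), rfl⟩)
      (mem_symTreeOpSpan p))
    (fun x x' h => by
      simp only [Prod.mk.injEq, Subtype.mk.injEq, and_true] at h
      exact Prod.ext h.1 (Subtype.ext h.2))
    (fun x => by
      rw [LinearMap.comp_apply, (toSymPRIM K).map_perm, (symPRIM K).incl.map_perm,
        NSOperad.Hom.map_treeOp, NSOperad.Hom.map_treeOp, toSymPRIM_star]
      refine congrArg ((symGraft K).perm x.1) (Eq.symm ?_)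
      refine ((symmetrisationHom (graftOperad K)).map_treeOp _ _ _).trans ?_
      rw [map_sub]
      rfl)
    (fun x x' h => by
      obtain ⟨h1, h2, h3⟩ := wordLabel_inj h
      refine Prod.ext ?_ (Subtype.ext (Prod.ext h1 h2))
      apply Equiv.symm_bijective.injective
      ext i
      have := h3 i (x.2.2.symm ▸ i.2)
      rwa [permIndex_val, permIndex_val] at this)
    (fun x => by
      refine ((wordBialg K (FreeMagma ℕ)).alg.act_perm _ _ _).trans ?_
      refine Eq.trans ?_ (wordAlg_act_wordOp x.2.2 fun k => FreeMagma.of (permIndex x.1 k))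
      simp only [permIndex_val]
      rfl)
    (by
      intro p hp x hx
      obtain ⟨σ, ⟨t, w⟩, h⟩ := x
      cases w with
      | nil => exact absurd ⟨(σ, ⟨t, (wordLeaves_nil _).symm.trans h⟩), rfl⟩ hx
      | cons s w =>
        exact apply_eq_zero_of_reducedDeconcat
          (hp _ (wordBialg K (FreeMagma ℕ)) _ fun i => nword_primitive _))
  refine ⟨fun x y h => key.1 (congrArg ((symPRIM K).incl.map n) h), fun p => ?_⟩
  obtain ⟨x, hx⟩ := key.2 p.2
  exact ⟨x, Subtype.ext hx⟩

/-- `P_↗^Σ` gives a good triple. -/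
theorem isGoodTriple_free₂ : IsGoodTriple (free₂ K) :=
  ⟨⟨toSymPRIM K, toSymPRIM_bijective⟩, fun V F _ _ _ _ φ j hφ => hφ.existsUnique_bialg,
    fun A _ _ B => B.structure_tfae⟩

end Prim

end

end ForestOperads

theorem theorem29 (K : Type*) [Field K] :
    (∃ h : ForestOperads.opUp K - ForestOperads.opM K ∈ (ForestOperads.PRIM K).carrier 2,
      (ForestOperads.PRIM K).toOperad.IsFreelyGeneratedBy (n := 2)
        ⟨ForestOperads.opUp K - ForestOperads.opM K, h⟩) ∧
    (LinearIndependent K (ForestOperads.pElem (K := K)) ∧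
      Submodule.span K (Set.range (ForestOperads.pElem (K := K))) = ForestOperads.primH K) ∧
    ForestOperads.IsGoodTriple (ForestOperads.free₂ K) :=
  ⟨⟨ForestOperads.sub_mem_PRIM, ForestOperads.PRIM_isFreelyGeneratedBy⟩, ForestOperads.pElem_basis,
    ForestOperads.isGoodTriple_free₂⟩
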